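/- Let $d\in\{2,3\}$. Let $\Omega\subset\mathbb R^d$ be a bounded domain with Lipschitz boundary and let $A=(a_{ij})\in L^\infty(\Omega)^{d\times d}$ be symmetric with $\alpha|\xi|^2\le A(x)\xi\cdot\xi\le\beta|\xi|^2$ for all $\xi\in\mathbb R^d$ and a.e. $x\in\Omega$, where $0<\alpha<\beta<\infty$. Let $\omega\subseteq\omega^*\subseteq\Omega$, where $\omega$ is open and $\omega^*$ is a domain with Lipschitz boundary (the case $\omega^*=\omega$ is allowed). Let $\chi:\mathbb R^d\to[0,1]$ be continuous and not identically zero, with $\chi=0$ outside $\omega$, $\chi\in C^1(\omega)$ and $\nabla\chi$ bounded on $\omega$ (a partition of unity function of the interior subdomain $\omega$, extended by zero). For open $U\subseteq\Omega$ write $a_U(u,v)=\int_U A\nabla u\cdot\nabla v\,dx$ and $\|u\|_{a,U}=a_U(u,u)^{1/2}$. Put $$H_A(\omega^*)=\{v\in H^1(\omega^*): a_{\omega^*}(v,\varphi)=0\ \ \forall\varphi\in H^1_0(\omega^*)\},\qquad \mathcal M_\omega(v)=\frac{\int_\omega A\nabla(\chi v)\cdot\nabla\chi\,dx}{\int_\omega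 A\nabla\chi\cdot\nabla\chi\,dx},$$ $$H_{A,0}(\omega^*)=\{v\in H_A(\omega^*):\mathcal M_\omega(v)=0\}.$$ Then $\|\cdot\|_{a,\omega^*}$ on $H_{A,0}(\omega^*)$ and $\|\cdot\|_{a,\omega}$ on $H^1_0(\omega)$ are norms equivalent to the $H^1$ norms, and $Pv=\chi v|_\omega$ defines a compact operator $P:H_{A,0}(\omega^*)\to H^1_0(\omega)$. For all $v,\varphi\in H_{A,0}(\omega^*)$, $$a_\omega(\chi v,\chi\varphi)=\int_\omega(A\nabla\chi\cdot\nabla\chi)\,v\varphi\,dx .$$ The eigenvalues $\lambda$ of the problem: find $0\ne v\in H_{A,0}(\omega^*)$ with $$a_{\omega^*}(v,\varphi)=\lambda\,a_\omega(\chi v,\chi\varphi)\qquad\forall\varphi\in H_{A,0}(\omega^*),$$ are positive and, repeated according to multiplicity, can be arranged in an increasing sequence $\lambda_1\le\lambda_2\le\cdots$ of length $N\in\{0,1,2,\dots\}\cup\{\infty\}$; put $\lambda_k=\infty$ and $\lambda_k^{-1/2}=0$ for $k>N$. Let $v_k$, $k\le N$, be any associated linearly independent eigenfunctions (so that those with $\lambda_k=\mu$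 form a basis of the eigenspace of $\mu$). For a subspace $Q\subset H^1_0(\omega)$ let $$d(Q,\omega)=\sup_{0\ne u\in H_{A,0}(\omega^*)}\ \inf_{q\in Q}\frac{\|Pu-q\|_{a,\omega}}{\|u\|_{a,\omega^*}},\qquad d_n(\omega,\omega^*)=\inf_{\dim Q=n}d(Q,\omega).$$ Then for every $n=0,1,2,\dots$ the Kolmogorov $n$-width of $P$ is $$d_n(\omega,\omega^*)=\lambda_{n+1}^{-1/2},$$ and for every $n\le N$ the space $\hat Q(n)=\operatorname{span}\{\chi v_1,\dots,\chi v_n\}$ has dimension $n$ and is optimal, that is, $d(\hat Q(n),\omega)=d_n(\omega,\omega^*)$. -/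

import Mathlib

open MeasureTheory Set
open scoped ENNReal

noncomputable section

/-- The Euclidean space `ℝ^d`. -/
abbrev Euc (d : ℕ) : Type := EuclideanSpace ℝ (Fin d)

/-- A bounded domain with Lipschitz boundary: a bounded, open, connected, nonempty set which near
each of its boundary points is, for a suitable unit vector `ν`, the strict epigraph in direction
`ν` of a Lipschitz function `g` of the components orthogonal to `ν`. -/
structure IsLipschitzDomain {d : ℕ} (U : Set (Euc d)) : Prop where
  isOpen : IsOpen U
  isConnected : IsConnected U
  isBounded : Bornology.IsBounded U
  lipschitz_boundary : ∀ x ∈ frontier U, ∃ (ν : Euc d) (g : Euc d → ℝ) (K : NNReal) (r : ℝ),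
    ‖ν‖ = 1 ∧ LipschitzWith K g ∧ (∀ (y : Euc d) (t : ℝ), g (y + t • ν) = g y) ∧ 0 < r ∧
      ∀ y ∈ Metric.ball x r, (y ∈ U ↔ g y < inner ℝ ν y)

/-! ### Sobolev spaces -/

/-- The Hilbert space `L²(U) × L²(U; ℝ^d)`, with
`‖(u, G)‖² = ‖u‖²_{L²(U)} + ‖G‖²_{L²(U)}`. -/
abbrev L2Pair {d : ℕ} (U : Set (Euc d)) : Type :=
  WithLp 2 (Lp ℝ 2 (volume.restrict U) × Lp (Euc d) 2 (volume.restrict U))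

/-- Test functions: `C^∞` functions whose support is compact and contained in `U`. -/
structure IsTestFunction {d : ℕ} (U : Set (Euc d)) (φ : Euc d → ℝ) : Prop where
  smooth : ContDiff ℝ ((⊤ : ℕ∞) : WithTop ℕ∞) φ
  compact : HasCompactSupport φ
  support_subset : tsupport φ ⊆ U

theorem IsTestFunction.memLp {d : ℕ} {U : Set (Euc d)} {φ : Euc d → ℝ}
    (h : IsTestFunction U φ) : MemLp φ 2 (volume.restrict U) :=
  h.smooth.continuous.memLp_of_hasCompactSupport h.compact

theorem IsTestFunction.memLp_fderiv {d : ℕ} {U : Set (Euc d)} {φ : Euc d → ℝ}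
    (h : IsTestFunction U φ) (e : Euc d) :
    MemLp (fun x => fderiv ℝ φ x e) 2 (volume.restrict U) :=
  ((h.smooth.continuous_fderiv (by simp)).clm_apply
    continuous_const).memLp_of_hasCompactSupport (h.compact.fderiv_apply ℝ e)

theorem integrable_mul_fderiv {d : ℕ} {U : Set (Euc d)} {φ : Euc d → ℝ}
    (h : IsTestFunction U φ) (e : Euc d) (w : L2Pair U) :
    Integrable (fun x => w.fst x * fderiv ℝ φ x e) (volume.restrict U) :=
  (Lp.memLp w.fst).integrable_mul (h.memLp_fderiv e)

theorem integrable_inner_mul {d : ℕ} {U : Set (Euc d)} {φ : Euc d → ℝ}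
    (h : IsTestFunction U φ) (e : Euc d) (w : L2Pair U) :
    Integrable (fun x => inner ℝ (w.snd x) e * φ x) (volume.restrict U) :=
  ((Lp.memLp w.snd).inner_const e).integrable_mul h.memLp

theorem L2Pair.fst_add_ae {d : ℕ} {U : Set (Euc d)} (w z : L2Pair U) :
    ∀ᵐ x ∂(volume.restrict U), (w + z).fst x = w.fst x + z.fst x := by
  filter_upwards [Lp.coeFn_add w.fst z.fst] with x hx
  simpa using hx

theorem L2Pair.snd_add_ae {d : ℕ} {U : Set (Euc d)} (w z : L2Pair U) :
    ∀ᵐ x ∂(volume.restrict U), (w + z).snd x = w.snd x + z.snd x := by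
  filter_upwards [Lp.coeFn_add w.snd z.snd] with x hx
  simpa using hx

theorem L2Pair.fst_smul_ae {d : ℕ} {U : Set (Euc d)} (c : ℝ) (w : L2Pair U) :
    ∀ᵐ x ∂(volume.restrict U), (c • w).fst x = c * w.fst x := by
  filter_upwards [Lp.coeFn_smul c w.fst] with x hx
  simpa using hx

theorem L2Pair.snd_smul_ae {d : ℕ} {U : Set (Euc d)} (c : ℝ) (w : L2Pair U) :
    ∀ᵐ x ∂(volume.restrict U), (c • w).snd x = c • w.snd x := by
  filter_upwards [Lp.coeFn_smul c w.snd] with x hx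
  simpa using hx

theorem L2Pair.fst_zero_ae {d : ℕ} (U : Set (Euc d)) :
    ∀ᵐ x ∂(volume.restrict U), (0 : L2Pair U).fst x = 0 := by
  filter_upwards [Lp.coeFn_zero ℝ 2 (volume.restrict U)] with x hx
  simpa using hx

theorem L2Pair.snd_zero_ae {d : ℕ} (U : Set (Euc d)) :
    ∀ᵐ x ∂(volume.restrict U), (0 : L2Pair U).snd x = 0 := by
  filter_upwards [Lp.coeFn_zero (Euc d) 2 (volume.restrict U)] with x hx
  simpa using hx

/-- `H¹(U)`, realized as the set of pairs `(u, ∇u)` with `u ∈ L²(U)` whose weak gradient `∇u`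
is in `L²(U; ℝ^d)`; the norm is the usual `H¹` norm. The gradient is determined by `u`. -/
def H1 {d : ℕ} (U : Set (Euc d)) : Submodule ℝ (L2Pair U) where
  carrier := {w | ∀ φ : Euc d → ℝ, IsTestFunction U φ → ∀ e : Euc d,
    ∫ x in U, w.fst x * fderiv ℝ φ x e = -∫ x in U, inner ℝ (w.snd x) e * φ x}
  zero_mem' := by
    intro φ hφ e
    rw [integral_eq_zero_of_ae, integral_eq_zero_of_ae, neg_zero]
    · filter_upwards [L2Pair.snd_zero_ae U] with x hx
      rw [hx, inner_zero_left, zero_mul]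
      rfl
    · filter_upwards [L2Pair.fst_zero_ae U] with x hx
      rw [hx, zero_mul]
      rfl
  add_mem' := by
    intro w z hw hz φ hφ e
    have h1 : ∫ x in U, (w + z).fst x * fderiv ℝ φ x e
        = ∫ x in U, (w.fst x * fderiv ℝ φ x e + z.fst x * fderiv ℝ φ x e) := by
      apply integral_congr_ae
      filter_upwards [L2Pair.fst_add_ae w z] with x hx
      rw [hx, add_mul]
    have h2 : ∫ x in U, inner ℝ ((w + z).snd x) e * φ x
        = ∫ x in U, (inner ℝ (w.snd x) e * φ x + inner ℝ (z.snd x) e * φ x) := by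
      apply integral_congr_ae
      filter_upwards [L2Pair.snd_add_ae w z] with x hx
      rw [hx, inner_add_left, add_mul]
    rw [h1, h2, integral_add (integrable_mul_fderiv hφ e w) (integrable_mul_fderiv hφ e z),
      integral_add (integrable_inner_mul hφ e w) (integrable_inner_mul hφ e z),
      hw φ hφ e, hz φ hφ e]
    ring
  smul_mem' := by
    intro c w hw φ hφ e
    have h1 : ∫ x in U, (c • w).fst x * fderiv ℝ φ x e
        = ∫ x in U, c * (w.fst x * fderiv ℝ φ x e) := by
      apply integral_congr_ae
      filter_upwards [L2Pair.fst_smul_ae c w] with x hx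
      rw [hx, mul_assoc]
    have h2 : ∫ x in U, inner ℝ ((c • w).snd x) e * φ x
        = ∫ x in U, c * (inner ℝ (w.snd x) e * φ x) := by
      apply integral_congr_ae
      filter_upwards [L2Pair.snd_smul_ae c w] with x hx
      rw [hx, real_inner_smul_left, mul_assoc]
    rw [h1, h2, integral_const_mul, integral_const_mul, hw φ hφ e]
    ring

/-- The elements of `H¹(U)` that are represented by test functions on `U`. -/
def testSpace {d : ℕ} (U : Set (Euc d)) : Submodule ℝ (L2Pair U) where
  carrier := {w | w ∈ H1 U ∧ ∃ φ : Euc d → ℝ, IsTestFunction U φ ∧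
    ∀ᵐ x ∂(volume.restrict U), w.fst x = φ x}
  zero_mem' := ⟨(H1 U).zero_mem, fun _ => 0,
    ⟨contDiff_const, HasCompactSupport.zero, by
      have : tsupport (fun _ : Euc d => (0 : ℝ)) = ∅ := by
        rw [tsupport_eq_empty_iff]; rfl
      simp [this]⟩, L2Pair.fst_zero_ae U⟩
  add_mem' := by
    rintro w z ⟨hw, φ, hφ, hwφ⟩ ⟨hz, ψ, hψ, hzψ⟩
    refine ⟨(H1 U).add_mem hw hz, fun x => φ x + ψ x,
      ⟨hφ.smooth.add hψ.smooth, hφ.compact.add hψ.compact,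
        (tsupport_add φ ψ).trans (union_subset hφ.support_subset hψ.support_subset)⟩, ?_⟩
    filter_upwards [L2Pair.fst_add_ae w z, hwφ, hzψ] with x h1 h2 h3
    rw [h1, h2, h3]
  smul_mem' := by
    rintro c w ⟨hw, φ, hφ, hwφ⟩
    refine ⟨(H1 U).smul_mem c hw, fun x => c * φ x,
      ⟨contDiff_const.mul hφ.smooth, hφ.compact.mul_left,
        (closure_mono (Function.support_mul_subset_right _ _)).trans hφ.support_subset⟩, ?_⟩
    filter_upwards [L2Pair.fst_smul_ae c w, hwφ] with x h1 h2
    rw [h1, h2]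

/-- `H¹₀(U)`: the closure of `C_c^∞(U)` with respect to the `H¹` norm. -/
def H10 {d : ℕ} (U : Set (Euc d)) : Submodule ℝ (L2Pair U) :=
  (testSpace U).topologicalClosure

/-! ### The coefficient and the energy form -/

/-- `M ξ · η` for a matrix `M` and vectors `ξ`, `η`. -/
def matForm {d : ℕ} (M : Matrix (Fin d) (Fin d) ℝ) (ξ η : Euc d) : ℝ :=
  ∑ i, ∑ j, M i j * ξ j * η i

/-- A symmetric, uniformly elliptic matrix field on `Ω` with entries in `L^∞(Ω)`. -/
structure EllipticCoefficient {d : ℕ} (Ω : Set (Euc d)) where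
  /-- the matrix field -/
  mat : Euc d → Matrix (Fin d) (Fin d) ℝ
  memLp : ∀ i j, MemLp (fun x => mat x i j) ∞ (volume.restrict Ω)
  symm : ∀ᵐ x ∂(volume.restrict Ω), (mat x).IsSymm
  elliptic : ∃ α β : ℝ, 0 < α ∧ α < β ∧ ∀ᵐ x ∂(volume.restrict Ω), ∀ ξ : Euc d,
    α * ∑ i, ξ i ^ 2 ≤ matForm (mat x) ξ ξ ∧ matForm (mat x) ξ ξ ≤ β * ∑ i, ξ i ^ 2

theorem integrable_matForm {d : ℕ} {Ω U : Set (Euc d)} (A : EllipticCoefficient Ω)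
    (hU : U ⊆ Ω) {p q : Euc d → Euc d} (hp : MemLp p 2 (volume.restrict U))
    (hq : MemLp q 2 (volume.restrict U)) :
    Integrable (fun x => matForm (A.mat x) (p x) (q x)) (volume.restrict U) := by
  unfold matForm
  refine integrable_finsetSum _ fun i _ => integrable_finsetSum _ fun j _ => ?_
  have hA : MemLp (fun x => A.mat x i j) ∞ (volume.restrict U) :=
    (A.memLp i j).mono_measure (Measure.restrict_mono hU le_rfl)
  have hpj : MemLp (fun x => p x j) 2 (volume.restrict U) :=
    (EuclideanSpace.proj (𝕜 := ℝ) j).comp_memLp' hp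
  have hqi : MemLp (fun x => q x i) 2 (volume.restrict U) :=
    (EuclideanSpace.proj (𝕜 := ℝ) i).comp_memLp' hq
  have h2 : MemLp (fun x => A.mat x i j * p x j) 2 (volume.restrict U) := hpj.mul hA
  exact h2.integrable_mul hqi

theorem matForm_add_left {d : ℕ} (M : Matrix (Fin d) (Fin d) ℝ) (ξ ξ' η : Euc d) :
    matForm M (ξ + ξ') η = matForm M ξ η + matForm M ξ' η := by
  simp only [matForm, ← Finset.sum_add_distrib]
  refine Finset.sum_congr rfl fun i _ => Finset.sum_congr rfl fun j _ => ?_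
  simp only [PiLp.add_apply]
  ring

theorem matForm_smul_left {d : ℕ} (M : Matrix (Fin d) (Fin d) ℝ) (c : ℝ) (ξ η : Euc d) :
    matForm M (c • ξ) η = c * matForm M ξ η := by
  simp only [matForm, Finset.mul_sum]
  refine Finset.sum_congr rfl fun i _ => Finset.sum_congr rfl fun j _ => ?_
  simp only [PiLp.smul_apply, smul_eq_mul]
  ring

theorem matForm_zero_left {d : ℕ} (M : Matrix (Fin d) (Fin d) ℝ) (η : Euc d) :
    matForm M 0 η = 0 := by
  simp [matForm]

/-- The energy form `a_U(u, v) = ∫_U A ∇u · ∇v dx`. -/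
def energyForm {d : ℕ} {Ω : Set (Euc d)} (A : EllipticCoefficient Ω) {U : Set (Euc d)}
    (u v : L2Pair U) : ℝ :=
  ∫ x in U, matForm (A.mat x) (u.snd x) (v.snd x)

/-- The energy norm `‖u‖_{a,U} = a_U(u, u)^{1/2}`. -/
def energyNorm {d : ℕ} {Ω : Set (Euc d)} (A : EllipticCoefficient Ω) {U : Set (Euc d)}
    (u : L2Pair U) : ℝ :=
  Real.sqrt (energyForm A u u)

/-- The space `H_A(U)` of `A`-harmonic functions on `U`. -/
def HA {d : ℕ} {Ω : Set (Euc d)} (A : EllipticCoefficient Ω) {U : Set (Euc d)} (hU : U ⊆ Ω) :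
    Submodule ℝ (L2Pair U) where
  carrier := {v | v ∈ H1 U ∧ ∀ φ ∈ H10 U, energyForm A v φ = 0}
  zero_mem' := by
    refine ⟨(H1 U).zero_mem, fun φ _ => ?_⟩
    apply integral_eq_zero_of_ae
    filter_upwards [L2Pair.snd_zero_ae U] with x hx
    rw [hx, matForm_zero_left]
    rfl
  add_mem' := by
    rintro w z ⟨hw, hw'⟩ ⟨hz, hz'⟩
    refine ⟨(H1 U).add_mem hw hz, fun φ hφ => ?_⟩
    have h : energyForm A (w + z) φ = ∫ x in U, (matForm (A.mat x) (w.snd x) (φ.snd x)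
        + matForm (A.mat x) (z.snd x) (φ.snd x)) := by
      apply integral_congr_ae
      filter_upwards [L2Pair.snd_add_ae w z] with x hx
      rw [hx, matForm_add_left]
    rw [h, integral_add (integrable_matForm A hU (Lp.memLp _) (Lp.memLp _))
      (integrable_matForm A hU (Lp.memLp _) (Lp.memLp _))]
    have h1 := hw' φ hφ
    have h2 := hz' φ hφ
    unfold energyForm at h1 h2
    rw [h1, h2, add_zero]
  smul_mem' := by
    rintro c w ⟨hw, hw'⟩
    refine ⟨(H1 U).smul_mem c hw, fun φ hφ => ?_⟩
    have h : energyForm A (c • w) φ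
        = ∫ x in U, c * matForm (A.mat x) (w.snd x) (φ.snd x) := by
      apply integral_congr_ae
      filter_upwards [L2Pair.snd_smul_ae c w] with x hx
      rw [hx, matForm_smul_left]
    have h1 := hw' φ hφ
    unfold energyForm at h1
    rw [h, integral_const_mul, h1, mul_zero]

/-! ### The partition of unity function -/

/-- The properties of the member `χ` of the partition of unity that belongs to an interior
subdomain `ω`. The function `χ` is extended by zero to `ℝ^d`; it is continuous there, so it
vanishes on the boundary of `ω`. -/
structure PUFunction {d : ℕ} (ω : Set (Euc d)) where
  /-- the function -/
  toFun : Euc d → ℝ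
  continuous : Continuous toFun
  nonneg : ∀ x, 0 ≤ toFun x
  le_one : ∀ x, toFun x ≤ 1
  eq_zero : ∀ x, x ∉ ω → toFun x = 0
  contDiffOn : ContDiffOn ℝ 1 toFun ω
  gradient_bounded : ∃ C : ℝ, ∀ x ∈ ω, ‖gradient toFun x‖ ≤ C
  ne_zero : ∃ x, toFun x ≠ 0

/-- The mean `𝓜_ω(v) = ∫_ω A∇(χ v)·∇χ dx / ∫_ω A∇χ·∇χ dx`; here
`∇(χ v) = χ ∇v + v ∇χ`. -/
def chiMean {d : ℕ} {Ω U ω : Set (Euc d)} (A : EllipticCoefficient Ω) (χ : PUFunction ω)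
    (v : L2Pair U) : ℝ :=
  (∫ x in ω, matForm (A.mat x)
      (χ.toFun x • v.snd x + v.fst x • gradient χ.toFun x) (gradient χ.toFun x)) /
    ∫ x in ω, matForm (A.mat x) (gradient χ.toFun x) (gradient χ.toFun x)

theorem PUFunction.memLp_gradient {d : ℕ} {ω : Set (Euc d)} (χ : PUFunction ω)
    (hω : IsOpen ω) (p : ℝ≥0∞) (hfin : volume ω < ∞) :
    MemLp (gradient χ.toFun) p (volume.restrict ω) := by
  have : IsFiniteMeasure (volume.restrict ω) := ⟨by simpa using hfin⟩
  obtain ⟨C, hC⟩ := χ.gradient_bounded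
  refine MemLp.of_bound ?_ C ((ae_restrict_iff' hω.measurableSet).2 (.of_forall hC))
  have h : ContinuousOn (fun x => (InnerProductSpace.toDual ℝ (Euc d)).symm
      (fderiv ℝ χ.toFun x)) ω :=
    (InnerProductSpace.toDual ℝ (Euc d)).symm.continuous.comp_continuousOn
      (χ.contDiffOn.continuousOn_fderiv_of_isOpen hω le_rfl)
  exact h.aestronglyMeasurable hω.measurableSet

theorem PUFunction.memLp_grad_mul {d : ℕ} {U ω : Set (Euc d)} (χ : PUFunction ω)
    (hω : IsOpen ω) (hfin : volume ω < ∞) (hsub : ω ⊆ U) (v : L2Pair U) :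
    MemLp (fun x => χ.toFun x • v.snd x + v.fst x • gradient χ.toFun x) 2
      (volume.restrict ω) := by
  have hχ : MemLp χ.toFun ∞ (volume.restrict ω) := by
    refine memLp_top_of_bound χ.continuous.aestronglyMeasurable 1 (.of_forall fun x => ?_)
    rw [Real.norm_eq_abs, abs_of_nonneg (χ.nonneg x)]
    exact χ.le_one x
  have h1 : MemLp v.snd 2 (volume.restrict ω) :=
    (Lp.memLp v.snd).mono_measure (Measure.restrict_mono hsub le_rfl)
  have h2 : MemLp v.fst 2 (volume.restrict ω) :=
    (Lp.memLp v.fst).mono_measure (Measure.restrict_mono hsub le_rfl)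
  have h3 : MemLp (fun x => χ.toFun x • v.snd x) 2 (volume.restrict ω) := h1.smul hχ
  have h4 : MemLp (fun x => v.fst x • gradient χ.toFun x) 2 (volume.restrict ω) :=
    (χ.memLp_gradient hω ∞ hfin).smul h2
  exact h3.add h4

/-! ### The local configuration -/

/-- An interior subdomain `ω`, its oversampling domain `ωs` (written `ω*` in the comments) and
the computational domain `Ω`. -/
structure IsOversampling {d : ℕ} (Ω ωs ω : Set (Euc d)) : Prop where
  domain : IsLipschitzDomain Ω
  oversampling : IsLipschitzDomain ωs
  isOpen : IsOpen ω
  subset : ω ⊆ ωs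
  subset_domain : ωs ⊆ Ω

theorem IsOversampling.volume_lt_top {d : ℕ} {Ω ωs ω : Set (Euc d)}
    (h : IsOversampling Ω ωs ω) : volume ω < ∞ :=
  (h.oversampling.isBounded.subset h.subset).measure_lt_top

/-- The space `H_{A,0}(ω*)` of `A`-harmonic functions `v` on `ω*` with `𝓜_ω(v) = 0`. -/
def HA0 {d : ℕ} {Ω ωs ω : Set (Euc d)} (h : IsOversampling Ω ωs ω)
    (A : EllipticCoefficient Ω) (χ : PUFunction ω) : Submodule ℝ (L2Pair ωs) where
  carrier := {v | v ∈ HA A h.subset_domain ∧ chiMean A χ v = 0}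
  zero_mem' := by
    refine ⟨Submodule.zero_mem _, ?_⟩
    unfold chiMean
    rw [integral_eq_zero_of_ae, zero_div]
    filter_upwards [ae_restrict_of_ae_restrict_of_subset h.subset (L2Pair.snd_zero_ae ωs),
      ae_restrict_of_ae_restrict_of_subset h.subset (L2Pair.fst_zero_ae ωs)] with x h1 h2
    rw [h1, h2]
    simp [matForm_zero_left]
  add_mem' := by
    rintro w z ⟨hw, hw'⟩ ⟨hz, hz'⟩
    refine ⟨Submodule.add_mem _ hw hz, ?_⟩
    have hχ := χ.memLp_gradient h.isOpen 2 h.volume_lt_top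
    have hi : ∀ v : L2Pair ωs, Integrable (fun x => matForm (A.mat x)
        (χ.toFun x • v.snd x + v.fst x • gradient χ.toFun x) (gradient χ.toFun x))
        (volume.restrict ω) := fun v =>
      integrable_matForm A (h.subset.trans h.subset_domain)
        (χ.memLp_grad_mul h.isOpen h.volume_lt_top h.subset v) hχ
    have key : chiMean A χ (w + z) = chiMean A χ w + chiMean A χ z := by
      unfold chiMean
      rw [← add_div, ← integral_add (hi w) (hi z)]
      congr 1
      apply integral_congr_ae
      filter_upwards [ae_restrict_of_ae_restrict_of_subset h.subset (L2Pair.snd_add_ae w z),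
        ae_restrict_of_ae_restrict_of_subset h.subset (L2Pair.fst_add_ae w z)] with x h1 h2
      rw [h1, h2, ← matForm_add_left]
      congr 1
      module
    rw [key, hw', hz', add_zero]
  smul_mem' := by
    rintro c w ⟨hw, hw'⟩
    refine ⟨Submodule.smul_mem _ c hw, ?_⟩
    have key : chiMean A χ (c • w) = c * chiMean A χ w := by
      unfold chiMean
      rw [← mul_div_assoc, ← integral_const_mul]
      congr 1
      apply integral_congr_ae
      filter_upwards [ae_restrict_of_ae_restrict_of_subset h.subset (L2Pair.snd_smul_ae c w),
        ae_restrict_of_ae_restrict_of_subset h.subset (L2Pair.fst_smul_ae c w)] with x h1 h2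
      rw [h1, h2, ← matForm_smul_left]
      congr 1
      module
    rw [key, hw', mul_zero]

section Operator

variable {d : ℕ} {Ω ωs ω : Set (Euc d)} {h : IsOversampling Ω ωs ω}
  {A : EllipticCoefficient Ω} {χ : PUFunction ω}

/-- `P` is the partition of unity operator `(P v)(x) = χ(x) v(x)`, `x ∈ ω`. (This determines `P`,
because a function in `H¹(ω)` determines its weak gradient.) -/
def IsPUOperator (P : HA0 h A χ →L[ℝ] H10 ω) : Prop :=
  ∀ v : HA0 h A χ, ∀ᵐ x ∂(volume.restrict ω),
    (P v : L2Pair ω).fst x = χ.toFun x * (v : L2Pair ωs).fst x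

/-- The accuracy of approximation of the range of `P` by a subspace `Q` of `H¹₀(ω)`:
`d(Q, ω) = sup_u inf_{q ∈ Q} ‖P u - q‖_{a,ω} / ‖u‖_{a,ω*}`, the supremum being over the
nonzero `u ∈ H_{A,0}(ω*)`. -/
def approxError (P : HA0 h A χ →L[ℝ] H10 ω) (Q : Submodule ℝ (H10 ω)) : ℝ≥0∞ :=
  ⨆ (u : HA0 h A χ) (_ : u ≠ 0), ⨅ q ∈ Q,
    ENNReal.ofReal (energyNorm A ((P u - q : H10 ω) : L2Pair ω) /
      energyNorm A (u : L2Pair ωs))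

/-- `Q` is an `n`-dimensional space. -/
def HasDim (Q : Submodule ℝ (H10 ω)) (n : ℕ) : Prop :=
  FiniteDimensional ℝ Q ∧ Module.finrank ℝ Q = n

/-- The Kolmogorov `n`-width of `P`, the infimum of `d(Q, ω)` over the `n`-dimensional subspaces
`Q` of `H¹₀(ω)`. -/
def nWidth (P : HA0 h A χ →L[ℝ] H10 ω) (n : ℕ) : ℝ≥0∞ :=
  ⨅ (Q : Submodule ℝ (H10 ω)) (_ : HasDim Q n), approxError P Q

/-- `Q` is an optimal `n`-dimensional approximation space for `P`. -/
def IsOptimalSpace (P : HA0 h A χ →L[ℝ] H10 ω) (n : ℕ) (Q : Submodule ℝ (H10 ω)) : Prop :=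
  HasDim Q n ∧ approxError P Q = nWidth P n

/-- `v` is an eigenfunction with eigenvalue `lam` of the problem
`a_{ω*}(v, φ) = lam a_ω(χ v, χ φ)` for all `φ ∈ H_{A,0}(ω*)`. -/
def IsEigenpair (P : HA0 h A χ →L[ℝ] H10 ω) (lam : ℝ) (v : HA0 h A χ) : Prop :=
  v ≠ 0 ∧ ∀ φ : HA0 h A χ, energyForm A (v : L2Pair ωs) (φ : L2Pair ωs)
    = lam * energyForm A (P v : L2Pair ω) (P φ : L2Pair ω)

/-- The `lam k`, `k < N`, are all the eigenvalues, in increasing order and repeated according to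
multiplicity, and the `v k`, `k < N`, are associated eigenfunctions: those with `lam k = μ` are
a basis of the eigenspace of `μ`. The number `N ≤ ∞` is the number of eigenvalues. (Indices
start at `0`; the values at `k ≥ N` are irrelevant.) -/
structure IsEigensystem (P : HA0 h A χ →L[ℝ] H10 ω) (N : ℕ∞) (lam : ℕ → ℝ)
    (v : ℕ → HA0 h A χ) : Prop where
  eigenpair : ∀ k : ℕ, (k : ℕ∞) < N → IsEigenpair P (lam k) (v k)
  increasing : ∀ j k : ℕ, j ≤ k → (k : ℕ∞) < N → lam j ≤ lam k
  independent : LinearIndependent ℝ (fun k : {k : ℕ // (k : ℕ∞) < N} => v k)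
  complete : ∀ (μ : ℝ) (w : HA0 h A χ), IsEigenpair P μ w →
    w ∈ Submodule.span ℝ (v '' {k : ℕ | (k : ℕ∞) < N ∧ lam k = μ})

end Operator

end

/-! With the energy inner products, both spaces are Hilbert spaces and the eigenproblem says `v = λ
P*P v`: the numbers `λ_k^{-1/2}` are the singular values of `P`. The theorem is therefore the
classical formula for the widths of a compact operator, once equivalence of norms and compactness of
`P` are known.

The upper bound on the width subtracts from `u` its projection `p` onto the span of the first `n`
eigenfunctions. The remainder is orthogonal to them, `P` is bounded there by the next singular value
(`eq_zero_or_norm_sq_map_le`), and `P p` lies in the candidate space. The lower bound is a dimension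
count: some `u ≠ 0` in the span of `n + 1` eigenfunctions has `P u` orthogonal to a given
`n`-dimensional space, and `P` is bounded below on that span (`le_norm_sq_map`,
`exists_le_norm_sub`). Eigensystems exist by successively maximizing `‖P u‖ / ‖u‖` on orthogonal
complements (`exists_isSingularSystem`). Indices start at zero, so `lam n` is the eigenvalue
`λ_{n+1}`.

Compactness rests on the identity `a(χv, χφ) = ∫ (A∇χ·∇χ) vφ` for `A`-harmonic functions
(`energyForm_mulPair`), obtained by testing the equations with `χ²φ` and `χ²v`. Its right side
contains no derivative of `v`, so `P v` is controlled by the `L²` norm of `v`. It remains to embed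
`H_{A,0}(ω*)` compactly into `L²`, even when `ω = ω*`, since no interior regularity is used.

That embedding comes from one estimate: `‖u(· + z) - u‖ ≤ ‖z‖ ‖∇u‖` in `L²`, where the segments stay
in the domain (`eLpNorm_translate_sub_le`). Lipschitz domains have local interior cones, so for `u`
with mean zero on finitely many small balls, `|u(y)|²` is dominated by an integral of `|u(y + z) -
u(y)|²` over short `z` in a cone. Hence the `L²` norm is arbitrarily small relative to the gradient
on subspaces of finite codimension (`exists_finite_means`), which is compactness. The same estimate
gives the Friedrichs inequality and the constancy of functions with zero weak gradient. The Poincaré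
inequality on `H_{A,0}` follows by compactness, since the mean `𝓜_ω` excludes nonzero constants.

That `χv` lies in `H¹₀(ω)`, although nothing is assumed about the boundary of `ω`, is seen by
truncating `χ` near its zero set: the truncations have compact support in `ω`, and products with
compactly supported `C¹` functions can be mollified (`cutoff_mul_mem_H10`, `mul_mem_H10`). -/

open Filter Topology Metric
open scoped Convolution

/-! ### Mollifiers -/

/-- A sequence of bump functions whose supports shrink to the origin. -/
noncomputable def shrinkingBump (d n : ℕ) : ContDiffBump (0 : Euc d) :=
  ⟨1 / (2 * ((n : ℝ) + 1)), 1 / ((n : ℝ) + 1), by positivity, by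
    apply one_div_lt_one_div_of_lt <;> linarith [(Nat.cast_nonneg n : (0 : ℝ) ≤ n)]⟩

/-- The mollification of a function. -/
noncomputable def mollify {d : ℕ} {F : Type*} [NormedAddCommGroup F] [NormedSpace ℝ F] (n : ℕ)
    (f : Euc d → F) : Euc d → F :=
  ((shrinkingBump d n).normed volume) ⋆[ContinuousLinearMap.lsmul ℝ ℝ, volume] f

section Mollify

variable {d : ℕ} {F : Type*} [NormedAddCommGroup F] [NormedSpace ℝ F]

theorem tendsto_shrinkingBump_rOut (d : ℕ) :
    Tendsto (fun n => (shrinkingBump d n).rOut) atTop (𝓝 0) :=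
  tendsto_one_div_add_atTop_nhds_zero_nat

theorem mollify_apply (n : ℕ) (f : Euc d → F) (x : Euc d) :
    mollify n f x = ∫ z, (shrinkingBump d n).normed volume z • f (x - z) := rfl

theorem contDiff_mollify [CompleteSpace F] (n : ℕ) {f : Euc d → F}
    (hf : LocallyIntegrable f volume) :
    ContDiff ℝ ((⊤ : ℕ∞) : WithTop ℕ∞) (mollify n f) :=
  (shrinkingBump d n).hasCompactSupport_normed.contDiff_convolution_left _
    (shrinkingBump d n).contDiff_normed hf

theorem norm_mollify_le (n : ℕ) {f : Euc d → F} {C : ℝ} (hf : ∀ x, ‖f x‖ ≤ C) (x : Euc d) :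
    ‖mollify n f x‖ ≤ C := by
  rw [mollify_apply]
  have h1 : ∀ z, ‖(shrinkingBump d n).normed volume z • f (x - z)‖
      ≤ (shrinkingBump d n).normed volume z * C := fun z => by
    rw [norm_smul, Real.norm_of_nonneg ((shrinkingBump d n).nonneg_normed z)]
    exact mul_le_mul_of_nonneg_left (hf _) ((shrinkingBump d n).nonneg_normed z)
  refine (norm_integral_le_of_norm_le
    ((shrinkingBump d n).integrable_normed.mul_const C) (.of_forall h1)).trans ?_
  rw [integral_mul_const, (shrinkingBump d n).integral_normed, one_mul]

theorem tendsto_mollify [CompleteSpace F] {f : Euc d → F} (hf : Continuous f) (x : Euc d) :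
    Tendsto (fun n => mollify n f x) atTop (𝓝 (f x)) :=
  ContDiffBump.convolution_tendsto_right_of_continuous (tendsto_shrinkingBump_rOut d) hf x

/-- A compact subset of an open set has a closed thickening of positive radius inside it, and
mollification enlarges supports by at most the outer radius of the bump. -/
theorem eventually_tsupport_mollify_subset {f : Euc d → F} {K U : Set (Euc d)} (hK : IsCompact K)
    (hU : IsOpen U) (hKU : K ⊆ U) (hf : Function.support f ⊆ K) :
    ∀ᶠ n in atTop, HasCompactSupport (mollify n f) ∧ tsupport (mollify n f) ⊆ U := by
  obtain ⟨δ, hδ, hsub⟩ := hK.exists_cthickening_subset_open hU hKU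
  filter_upwards [(tendsto_shrinkingBump_rOut d).eventually_le_const hδ] with n hn
  have h1 : Function.support (mollify n f) ⊆ cthickening δ K := by
    refine (support_convolution_subset _).trans ?_
    rintro _ ⟨a, ha, b, hb, rfl⟩
    rw [(shrinkingBump d n).support_normed_eq, mem_ball_zero_iff] at ha
    refine mem_cthickening_of_dist_le _ b δ K (hf hb) ?_
    simpa using ha.le.trans hn
  have h2 : tsupport (mollify n f) ⊆ cthickening δ K :=
    closure_minimal h1 isClosed_cthickening
  exact ⟨hK.cthickening.of_isClosed_subset (isClosed_tsupport _) h2, h2.trans hsub⟩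

theorem fderiv_mollify (n : ℕ) {f : Euc d → ℝ} (hf : ContDiff ℝ 1 f)
    (hc : HasCompactSupport f) (x e : Euc d) :
    fderiv ℝ (mollify n f) x e = mollify n (fun y => fderiv ℝ f y e) x := by
  have hb : LocallyIntegrable ((shrinkingBump d n).normed volume) (volume : Measure (Euc d)) :=
    (shrinkingBump d n).integrable_normed.locallyIntegrable
  have h := (hc.hasFDerivAt_convolution_right (ContinuousLinearMap.lsmul ℝ ℝ) hb hf x).fderiv
  unfold mollify
  rw [h, convolution_precompR_apply _ hb (hc.fderiv ℝ) (hf.continuous_fderiv one_ne_zero)]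

end Mollify

/-! ### Weak gradients -/

section WeakGradient

variable {d : ℕ}

/-- `G` is the weak gradient of `u` on `U`. -/
def HasWeakGrad (U : Set (Euc d)) (u : Euc d → ℝ) (G : Euc d → Euc d) : Prop :=
  ∀ φ : Euc d → ℝ, IsTestFunction U φ → ∀ e : Euc d,
    ∫ x in U, u x * fderiv ℝ φ x e = -∫ x in U, inner ℝ (G x) e * φ x

theorem mem_H1_iff {U : Set (Euc d)} {w : L2Pair U} : w ∈ H1 U ↔ HasWeakGrad U w.fst w.snd :=
  Iff.rfl

/-- `HasWeakGrad` tests with smooth functions only. Mollifying `ψ` and passing to the limit by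
dominated convergence admits `C¹` test functions, which is the regularity that cutoffs made from `χ`
have. -/
theorem HasWeakGrad.integral_mul_fderiv {U : Set (Euc d)} (hU : IsOpen U) (hfin : volume U < ∞)
    {u : Euc d → ℝ} {G : Euc d → Euc d} (hu : MemLp u 2 (volume.restrict U))
    (hG : MemLp G 2 (volume.restrict U)) (h : HasWeakGrad U u G) {ψ : Euc d → ℝ}
    (hψ : ContDiff ℝ 1 ψ) (hc : HasCompactSupport ψ) (hs : tsupport ψ ⊆ U) (e : Euc d) :
    ∫ x in U, u x * fderiv ℝ ψ x e = -∫ x in U, inner ℝ (G x) e * ψ x := by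
  have : IsFiniteMeasure (volume.restrict U) := ⟨by simpa using hfin⟩
  have hu1 : Integrable u (volume.restrict U) := hu.integrable (by norm_num)
  have hG1 : Integrable (fun x => inner ℝ (G x) e) (volume.restrict U) :=
    (hG.inner_const e).integrable (by norm_num)
  have hcd : Continuous (fun y => fderiv ℝ ψ y e) :=
    (hψ.continuous_fderiv one_ne_zero).clm_apply continuous_const
  obtain ⟨C, hC⟩ := hc.exists_bound_of_continuous hψ.continuous
  obtain ⟨C', hC'⟩ := (hc.fderiv_apply ℝ e).exists_bound_of_continuous hcd
  have hcont : ∀ n, Continuous (mollify n ψ) := fun n =>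
    (contDiff_mollify n hψ.continuous.locallyIntegrable).continuous
  have hcont' : ∀ n, Continuous (mollify n (fun y => fderiv ℝ ψ y e)) := fun n =>
    (contDiff_mollify n hcd.locallyIntegrable).continuous
  have l1 : Tendsto (fun n => ∫ x in U, u x * mollify n (fun y => fderiv ℝ ψ y e) x) atTop
      (𝓝 (∫ x in U, u x * fderiv ℝ ψ x e)) := by
    refine tendsto_integral_of_dominated_convergence (fun x => ‖u x‖ * C')
      (fun n => hu1.aestronglyMeasurable.mul (hcont' n).aestronglyMeasurable)
      (hu1.norm.mul_const _) (fun n => .of_forall fun x => ?_) (.of_forall fun x => ?_)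
    · rw [norm_mul]
      exact mul_le_mul_of_nonneg_left (norm_mollify_le n hC' x) (norm_nonneg _)
    · exact (tendsto_mollify hcd x).const_mul _
  have l2 : Tendsto (fun n => -∫ x in U, inner ℝ (G x) e * mollify n ψ x) atTop
      (𝓝 (-∫ x in U, inner ℝ (G x) e * ψ x)) := by
    refine (tendsto_integral_of_dominated_convergence (fun x => ‖inner ℝ (G x) e‖ * C)
      (fun n => hG1.aestronglyMeasurable.mul (hcont n).aestronglyMeasurable)
      (hG1.norm.mul_const _) (fun n => .of_forall fun x => ?_) (.of_forall fun x => ?_)).neg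
    · rw [Pi.mul_apply, norm_mul]
      exact mul_le_mul_of_nonneg_left (norm_mollify_le n hC x) (norm_nonneg _)
    · exact (tendsto_mollify hψ.continuous x).const_mul _
  refine tendsto_nhds_unique_of_eventuallyEq l1 l2 ?_
  filter_upwards [eventually_tsupport_mollify_subset hc.isCompact hU hs (subset_tsupport ψ)]
    with n hn
  rw [← h (mollify n ψ) ⟨contDiff_mollify n hψ.continuous.locallyIntegrable, hn.1, hn.2⟩ e]
  simp_rw [fderiv_mollify n hψ hc]

/-- A function in `L²(V)` is bounded in norm by its action on test functions. -/
theorem lintegral_sq_le_of_forall_test {V : Set (Euc d)} (hV : IsOpen V) {f : Euc d → ℝ}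
    (hf : MemLp f 2 (volume.restrict V)) {M : ℝ} (hM : 0 ≤ M)
    (h : ∀ ψ : Euc d → ℝ, IsTestFunction V ψ →
      |∫ x in V, f x * ψ x| ≤ M * (eLpNorm ψ 2 (volume.restrict V)).toReal) :
    eLpNorm f 2 (volume.restrict V) ≤ ENNReal.ofReal M := by
  let D : Submodule ℝ (Lp ℝ 2 (volume.restrict V)) :=
    { carrier := {g | ∃ ψ : Euc d → ℝ, IsTestFunction V ψ ∧ g =ᵐ[volume.restrict V] ψ}
      zero_mem' := ⟨fun _ => 0, ⟨contDiff_const, HasCompactSupport.zero, by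
        have : tsupport (fun _ : Euc d => (0 : ℝ)) = ∅ := by
          rw [tsupport_eq_empty_iff]; rfl
        simp [this]⟩, Lp.coeFn_zero _ _ _⟩
      add_mem' := by
        rintro a b ⟨φ, hφ, ha⟩ ⟨ψ, hψ, hb⟩
        refine ⟨fun x => φ x + ψ x,
          ⟨hφ.smooth.add hψ.smooth, hφ.compact.add hψ.compact,
            (tsupport_add φ ψ).trans (union_subset hφ.support_subset hψ.support_subset)⟩, ?_⟩
        filter_upwards [Lp.coeFn_add a b, ha, hb] with x h1 h2 h3
        rw [h1, Pi.add_apply, h2, h3]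
      smul_mem' := by
        rintro c a ⟨φ, hφ, ha⟩
        refine ⟨fun x => c * φ x, ⟨contDiff_const.mul hφ.smooth, hφ.compact.mul_left,
          (closure_mono (Function.support_mul_subset_right _ _)).trans hφ.support_subset⟩, ?_⟩
        filter_upwards [Lp.coeFn_smul c a, ha] with x h1 h2
        rw [h1, Pi.smul_apply, h2, smul_eq_mul] }
  -- Density of test functions: an element of `L²` orthogonal to all of them vanishes by the
  -- fundamental lemma of the calculus of variations.
  have hD : D.topologicalClosure = ⊤ := by
    rw [Submodule.topologicalClosure_eq_top_iff, Submodule.eq_bot_iff]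
    intro g hg
    rw [Submodule.mem_orthogonal] at hg
    have h0 : ∀ᵐ x ∂volume, x ∈ V → g x = 0 := by
      refine hV.ae_eq_zero_of_integral_contDiff_smul_eq_zero ?_ ?_
      · exact locallyIntegrableOn_of_locallyIntegrable_restrict
          ((Lp.memLp g).locallyIntegrable (by norm_num))
      · intro ψ h1 h2 h3
        have hψ : IsTestFunction V ψ := ⟨h1, h2, h3⟩
        have h4 := hg (hψ.memLp.toLp ψ) ⟨ψ, hψ, hψ.memLp.coeFn_toLp⟩
        rw [L2.inner_def] at h4
        rw [← setIntegral_eq_integral_of_forall_compl_eq_zero (s := V), ← h4]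
        · apply integral_congr_ae
          filter_upwards [hψ.memLp.coeFn_toLp] with x hx
          simp [hx, mul_comm]
        · intro x hx
          rw [image_eq_zero_of_notMem_tsupport fun h => hx (h3 h), zero_smul]
    rw [Lp.ext_iff]
    filter_upwards [(ae_restrict_iff' hV.measurableSet).2 h0, Lp.coeFn_zero ℝ 2
      (volume.restrict V)] with x h1 h2
    rw [h1, h2]; rfl
  have key : ∀ g : Lp ℝ 2 (volume.restrict V), |inner ℝ (hf.toLp f) g| ≤ M * ‖g‖ := by
    intro g
    have hcl : IsClosed {g : Lp ℝ 2 (volume.restrict V) | |inner ℝ (hf.toLp f) g| ≤ M * ‖g‖} :=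
      isClosed_le (by fun_prop) (by fun_prop)
    have hg : g ∈ closure (D : Set (Lp ℝ 2 (volume.restrict V))) := by
      rw [← Submodule.topologicalClosure_coe, hD]; trivial
    refine closure_minimal ?_ hcl hg
    rintro a ⟨ψ, hψ, ha⟩
    have h1 : inner ℝ (hf.toLp f) a = ∫ x in V, f x * ψ x := by
      rw [L2.inner_def]
      apply integral_congr_ae
      filter_upwards [ha, hf.coeFn_toLp] with x h2 h3
      simp [h2, h3, mul_comm]
    rw [mem_ofPred_eq, h1, Lp.norm_def, eLpNorm_congr_ae ha]
    exact h ψ hψ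
  -- Pairing `f` with itself turns the bound into `‖f‖² ≤ M ‖f‖`.
  have h2 := key (hf.toLp f)
  rw [real_inner_self_eq_norm_sq, abs_of_nonneg (by positivity), sq] at h2
  have h3 : ‖hf.toLp f‖ ≤ M := by
    rcases (norm_nonneg (hf.toLp f)).eq_or_lt with h0 | h0
    · rw [← h0]; exact hM
    · exact le_of_mul_le_mul_right h2 h0
  rw [Lp.norm_toLp] at h3
  rw [← ENNReal.ofReal_toReal hf.2.ne]
  exact ENNReal.ofReal_le_ofReal h3

theorem abs_integral_inner_le {α E : Type*} [MeasurableSpace α] {μ : Measure α}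
    [NormedAddCommGroup E] [InnerProductSpace ℝ E] {f g : α → E} (hf : MemLp f 2 μ)
    (hg : MemLp g 2 μ) :
    |∫ x, inner ℝ (f x) (g x) ∂μ| ≤ (eLpNorm f 2 μ).toReal * (eLpNorm g 2 μ).toReal := by
  have h := abs_real_inner_le_norm (hf.toLp f) (hg.toLp g)
  rw [Lp.norm_toLp, Lp.norm_toLp, L2.inner_def] at h
  convert h using 2
  apply integral_congr_ae
  filter_upwards [hf.coeFn_toLp, hg.coeFn_toLp] with x h1 h2
  rw [h1, h2]

theorem memLp_translate {F : Type*} [NormedAddCommGroup F] {U V : Set (Euc d)} (hU : IsOpen U)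
    {u : Euc d → F} (hu : MemLp u 2 (volume.restrict U)) {z : Euc d}
    (hz : ∀ x ∈ V, x + z ∈ U) : MemLp (fun x => u (x + z)) 2 (volume.restrict V) := by
  have h := (measurePreserving_add_right (volume : Measure (Euc d)) z).restrict_preimage
    hU.measurableSet
  exact (hu.comp_measurePreserving h).mono_measure (Measure.restrict_mono hz le_rfl)

theorem IsTestFunction.translate {U V : Set (Euc d)} {ψ : Euc d → ℝ} (hψ : IsTestFunction V ψ)
    {z : Euc d} (hz : ∀ x ∈ V, x + z ∈ U) : IsTestFunction U (fun x => ψ (x - z)) := by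
  refine ⟨hψ.smooth.comp (contDiff_id.sub contDiff_const), ?_, ?_⟩
  · exact hψ.compact.comp_homeomorph (Homeomorph.subRight z)
  · intro x hx
    have : x - z ∈ tsupport ψ := by
      have := tsupport_comp_subset_preimage ψ (f := fun x : Euc d => x - z) (by fun_prop) hx
      exact this
    simpa using hz _ (hψ.support_subset this)

theorem IsTestFunction.eLpNorm_restrict {V : Set (Euc d)} {ψ : Euc d → ℝ} (hV : MeasurableSet V)
    (hψ : IsTestFunction V ψ) (p : ℝ≥0∞) :
    eLpNorm ψ p (volume.restrict V) = eLpNorm ψ p volume := by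
  rw [← eLpNorm_indicator_eq_eLpNorm_restrict hV, indicator_eq_self.2]
  exact (subset_tsupport ψ).trans hψ.support_subset

theorem IsTestFunction.setIntegral_mul {V : Set (Euc d)} {ψ : Euc d → ℝ}
    (hψ : IsTestFunction V ψ) (u : Euc d → ℝ) :
    ∫ x in V, u x * ψ x = ∫ x, u x * ψ x := by
  apply setIntegral_eq_integral_of_forall_compl_eq_zero
  intro x hx
  rw [image_eq_zero_of_notMem_tsupport fun h => hx (hψ.support_subset h), mul_zero]

/-- The difference of an `H¹` function and its translate is controlled by the gradient, as long as
the segments of the translation stay in the domain. -/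
theorem HasWeakGrad.eLpNorm_translate_sub_le {U V : Set (Euc d)} (hU : IsOpen U)
    (hfin : volume U < ∞) (hV : IsOpen V) {u : Euc d → ℝ} {G : Euc d → Euc d}
    (hu : MemLp u 2 (volume.restrict U)) (hG : MemLp G 2 (volume.restrict U))
    (h : HasWeakGrad U u G) {z : Euc d}
    (hz : ∀ x ∈ V, ∀ t ∈ Icc (0 : ℝ) 1, x + t • z ∈ U) :
    eLpNorm (fun x => u (x + z) - u x) 2 (volume.restrict V)
      ≤ ENNReal.ofReal (‖z‖ * (eLpNorm G 2 (volume.restrict U)).toReal) := by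
  have hz1 : ∀ x ∈ V, x + z ∈ U := fun x hx => by simpa using hz x hx 1 (by simp)
  have hz0 : V ⊆ U := fun x hx => by simpa using hz x hx 0 (by simp)
  have : IsFiniteMeasure (volume.restrict U) := ⟨by simpa using hfin⟩
  have hu1 : Integrable u (volume.restrict U) := hu.integrable (by norm_num)
  have hut := memLp_translate hU hu hz1
  have hu0 : MemLp u 2 (volume.restrict V) := hu.mono_measure (Measure.restrict_mono hz0 le_rfl)
  refine lintegral_sq_le_of_forall_test hV (hut.sub hu0) (by positivity) fun ψ hψ => ?_
  have hψt : ∀ t ∈ Icc (0 : ℝ) 1, IsTestFunction U (fun x => ψ (x - t • z)) := fun t ht =>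
    hψ.translate fun x hx => hz x hx t ht
  -- By duality it suffices to bound the pairing of the difference with `ψ`, which is `F 1 - F 0`.
  -- The translation is moved onto `ψ`, so `F` is differentiable although `u` is not, and `u` need
  -- not be approximated by smooth functions.
  let F : ℝ → ℝ := fun t => ∫ y in U, u y * ψ (y - t • z)
  have hcd : Continuous (fun y => fderiv ℝ ψ y z) :=
    (hψ.smooth.continuous_fderiv (by simp)).clm_apply continuous_const
  obtain ⟨C, hC⟩ := (hψ.compact.fderiv_apply ℝ z).exists_bound_of_continuous hcd
  have hdiff : ∀ t : ℝ, ∀ y : Euc d,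
      HasDerivAt (fun t : ℝ => ψ (y - t • z)) (-fderiv ℝ ψ (y - t • z) z) t := by
    intro t y
    have h1 : HasDerivAt (fun t : ℝ => y - t • z) (-z) t := by
      simpa using ((hasDerivAt_id t).smul_const z).const_sub y
    have h2 := ((hψ.smooth.differentiable (by simp)) (y - t • z)).hasFDerivAt.comp_hasDerivAt t h1
    simpa [Function.comp_def] using h2
  have hF : ∀ t, HasDerivAt F (∫ y in U, u y * -fderiv ℝ ψ (y - t • z) z) t := by
    intro t
    refine (hasDerivAt_integral_of_dominated_loc_of_deriv_le (s := univ)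
      (F := fun t y => u y * ψ (y - t • z))
      (F' := fun t y => u y * -fderiv ℝ ψ (y - t • z) z)
      (bound := fun y => ‖u y‖ * C) univ_mem ?_ ?_ ?_ ?_ ?_ ?_).2
    · exact .of_forall fun t => hu1.aestronglyMeasurable.mul
        (hψ.smooth.continuous.comp (by fun_prop)).aestronglyMeasurable
    · obtain ⟨C0, hC0⟩ := hψ.compact.exists_bound_of_continuous hψ.smooth.continuous
      exact hu1.mul_bdd (c := C0) (hψ.smooth.continuous.comp (by fun_prop)).aestronglyMeasurable
        (.of_forall fun x => hC0 _)
    · exact hu1.aestronglyMeasurable.mul (hcd.comp (by fun_prop)).neg.aestronglyMeasurable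
    · refine .of_forall fun y t _ => ?_
      rw [norm_mul, norm_neg]
      exact mul_le_mul_of_nonneg_left (hC _) (norm_nonneg _)
    · exact hu1.norm.mul_const _
    · exact .of_forall fun y t _ => (hdiff t y).const_mul _
  have hF' : ∀ t ∈ Icc (0 : ℝ) 1, ‖∫ y in U, u y * -fderiv ℝ ψ (y - t • z) z‖
      ≤ ‖z‖ * (eLpNorm G 2 (volume.restrict U)).toReal
        * (eLpNorm ψ 2 (volume.restrict V)).toReal := by
    intro t ht
    -- The weak gradient enters here; `ψ` translated by `t • z` is an admissible test function
    -- because the segments stay in `U`.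
    have e1 : ∫ y in U, u y * -fderiv ℝ ψ (y - t • z) z
        = ∫ y in U, inner ℝ (G y) (ψ (y - t • z) • z) := by
      have h1 := h _ (hψt t ht) z
      have h2 : ∀ y, fderiv ℝ (fun x => ψ (x - t • z)) y z = fderiv ℝ ψ (y - t • z) z := by
        intro y
        rw [fderiv_comp_sub]
      simp_rw [h2] at h1
      simp_rw [mul_neg, integral_neg, h1, neg_neg, inner_smul_right, mul_comm]
    have hm : MemLp (fun y => ψ (y - t • z) • z) 2 (volume.restrict U) :=
      (ContinuousLinearMap.toSpanSingleton ℝ z).comp_memLp' (hψt t ht).memLp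
    rw [e1, Real.norm_eq_abs]
    refine (abs_integral_inner_le hG hm).trans ?_
    have e2 : (eLpNorm (fun y => ψ (y - t • z) • z) 2 (volume.restrict U)).toReal
        = ‖z‖ * (eLpNorm ψ 2 (volume.restrict V)).toReal := by
      have e3 : eLpNorm (fun y => ψ (y - t • z) • z) 2 (volume.restrict U)
          = eLpNorm (‖z‖ • fun y => ψ (y - t • z)) 2 (volume.restrict U) := by
        apply eLpNorm_congr_norm_ae
        refine .of_forall fun y => ?_
        simp [norm_smul, mul_comm]
      have e4 : eLpNorm (fun y => ψ (y - t • z)) 2 volume = eLpNorm ψ 2 volume :=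
        eLpNorm_comp_measurePreserving (g := ψ) hψ.smooth.continuous.aestronglyMeasurable
          (measurePreserving_sub_right volume (t • z))
      rw [e3, eLpNorm_const_smul, (hψt t ht).eLpNorm_restrict hU.measurableSet, e4,
        hψ.eLpNorm_restrict hV.measurableSet]
      simp
    rw [e2]
    exact le_of_eq (by ring)
  have hfin := Convex.norm_image_sub_le_of_norm_hasDerivWithin_le
    (fun t ht => (hF t).hasDerivWithinAt) hF' (convex_Icc (0 : ℝ) 1)
    (left_mem_Icc.2 zero_le_one) (right_mem_Icc.2 zero_le_one)
  rw [sub_zero, norm_one, mul_one, Real.norm_eq_abs] at hfin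
  convert hfin using 2
  have e0 : F 0 = ∫ x in V, u x * ψ x := by
    simp only [F, zero_smul, sub_zero]
    rw [hψ.setIntegral_mul, IsTestFunction.setIntegral_mul (V := U)]
    simpa using hψt 0 (by simp)
  have e1 : F 1 = ∫ x in V, u (x + z) * ψ x := by
    simp only [F, one_smul]
    have h1 := hψt 1 (by simp)
    rw [one_smul] at h1
    rw [h1.setIntegral_mul, hψ.setIntegral_mul,
      ← integral_add_right_eq_self (fun y => u y * ψ (y - z)) z]
    simp
  have e2 := integral_sub (hut.integrable_mul hψ.memLp) (hu0.integrable_mul hψ.memLp)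
  simp only [Pi.mul_apply] at e2
  rw [e0, e1, ← e2]
  simp [sub_mul]

end WeakGradient

/-! ### Convergence of mollifications in `L²` -/

section MollifyL2

variable {d : ℕ} {F : Type*} [NormedAddCommGroup F]

/-- Translations form a continuous family of measure preserving maps, and composition with such a
family is continuous in `L²`. -/
theorem tendsto_eLpNorm_translate_sub {f : Euc d → F} (hf : MemLp f 2 volume) :
    Tendsto (fun z : Euc d => eLpNorm (fun x => f (x - z) - f x) 2 volume) (𝓝 0) (𝓝 0) := by
  let g : Euc d → C(Euc d, Euc d) :=
    ContinuousMap.curry ⟨fun p : Euc d × Euc d => p.2 - p.1, by fun_prop⟩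
  have hg : Continuous g := ContinuousMap.continuous _
  have hgm : ∀ z, MeasurePreserving (g z) (volume : Measure (Euc d)) volume := fun z =>
    measurePreserving_sub_right volume z
  have h1 := ((continuous_const (y := hf.toLp f)).compMeasurePreservingLp hg hgm
    (by norm_num)).tendsto 0
  rw [tendsto_iff_edist_tendsto_0] at h1
  refine h1.congr fun z => ?_
  rw [Lp.edist_def]
  apply eLpNorm_congr_ae
  have e1 : ∀ z, (Lp.compMeasurePreserving (g z) (hgm z) (hf.toLp f)) =ᵐ[volume]
      fun x => f (x - z) := by
    intro z
    rw [Lp.toLp_compMeasurePreserving]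
    exact MemLp.coeFn_toLp _
  filter_upwards [e1 z, e1 0] with x h2 h3
  rw [Pi.sub_apply, h2, h3, sub_zero]

variable [NormedSpace ℝ F]

/-- The error `mollify n f x - f x` is the average of `f (x - z) - f x` over the probability measure
whose density is the bump. Its square is at most the average of the squares, and Tonelli leaves the
translation errors with `‖z‖` below the outer radius. Strong measurability of the representative `f`
is what Tonelli needs on the product. -/
theorem eLpNorm_mollify_sub_le [CompleteSpace F] (n : ℕ) {f : Euc d → F}
    (hfm : StronglyMeasurable f)
    (hf : MemLp f 2 volume) {ε : ℝ≥0∞}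
    (hε : ∀ z : Euc d, ‖z‖ < (shrinkingBump d n).rOut →
      eLpNorm (fun x => f (x - z) - f x) 2 volume ≤ ε) :
    eLpNorm (fun x => mollify n f x - f x) 2 volume ≤ ε := by
  set ρ : Euc d → ℝ := (shrinkingBump d n).normed volume with hρ
  have hρc : Continuous ρ := (shrinkingBump d n).continuous_normed
  have hρ0 : ∀ z, 0 ≤ ρ z := (shrinkingBump d n).nonneg_normed
  let k : Euc d → ℝ≥0∞ := fun z => ENNReal.ofReal (ρ z)
  have hk : Measurable k := hρc.measurable.ennreal_ofReal
  let ν : Measure (Euc d) := volume.withDensity k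
  have hk1 : ∫⁻ z, k z = 1 := by
    rw [← ofReal_integral_eq_lintegral_ofReal (shrinkingBump d n).integrable_normed
      (.of_forall hρ0), (shrinkingBump d n).integral_normed, ENNReal.ofReal_one]
  have : IsProbabilityMeasure ν := ⟨by simp [ν, hk1]⟩
  have hloc : LocallyIntegrable f volume := hf.locallyIntegrable (by norm_num)
  have hpt : ∀ x, ‖mollify n f x - f x‖ₑ ^ (2 : ℝ) ≤ ∫⁻ z, ‖f (x - z) - f x‖ₑ ^ (2 : ℝ) ∂ν := by
    intro x
    have hi : Integrable (fun z => ρ z • f (x - z)) volume :=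
      (shrinkingBump d n).hasCompactSupport_normed.convolutionExists_left
        (ContinuousLinearMap.lsmul ℝ ℝ) hρc hloc x
    have hi2 : Integrable (fun z => ρ z • f x) volume :=
      (shrinkingBump d n).integrable_normed.smul_const _
    have e1 : mollify n f x - f x = ∫ z, f (x - z) - f x ∂ν := by
      rw [integral_withDensity_eq_integral_toReal_smul hk (.of_forall fun z => by simp [k])]
      have : ∀ z, (k z).toReal • (f (x - z) - f x) = ρ z • f (x - z) - ρ z • f x := fun z => by
        rw [ENNReal.toReal_ofReal (hρ0 z), smul_sub]
      simp_rw [this]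
      rw [integral_sub hi hi2, integral_smul_const, (shrinkingBump d n).integral_normed, one_smul,
        mollify_apply]
    have hm : AEStronglyMeasurable (fun z => f (x - z) - f x) ν :=
      ((hfm.comp_measurable (measurable_const.sub measurable_id)).sub
        stronglyMeasurable_const).aestronglyMeasurable
    have e2 : ‖mollify n f x - f x‖ₑ ≤ eLpNorm (fun z => f (x - z) - f x) 2 ν := by
      rw [e1]
      refine (enorm_integral_le_lintegral_enorm _).trans ?_
      rw [← eLpNorm_one_eq_lintegral_enorm]
      exact eLpNorm_le_eLpNorm_of_exponent_le (by norm_num) hm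
    have e3 := ENNReal.rpow_le_rpow e2 (by norm_num : (0 : ℝ) ≤ 2)
    refine e3.trans (le_of_eq ?_)
    rw [eLpNorm_eq_lintegral_rpow_enorm_toReal (by norm_num) (by norm_num), ← ENNReal.rpow_mul]
    simp
  rw [eLpNorm_eq_lintegral_rpow_enorm_toReal (by norm_num) (by norm_num)]
  simp only [ENNReal.toReal_ofNat]
  rw [one_div, ENNReal.rpow_inv_le_iff (by norm_num)]
  calc ∫⁻ x, ‖mollify n f x - f x‖ₑ ^ (2 : ℝ)
      ≤ ∫⁻ x, ∫⁻ z, ‖f (x - z) - f x‖ₑ ^ (2 : ℝ) ∂ν := lintegral_mono hpt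
    _ = ∫⁻ z, (∫⁻ x, ‖f (x - z) - f x‖ₑ ^ (2 : ℝ)) ∂ν := by
        apply lintegral_lintegral_swap
        have h1 : StronglyMeasurable (fun p : Euc d × Euc d => f (p.1 - p.2) - f p.1) :=
          (hfm.comp_measurable (measurable_fst.sub measurable_snd)).sub
            (hfm.comp_measurable measurable_fst)
        exact (h1.enorm.pow_const _).aemeasurable
    _ ≤ ∫⁻ z, ε ^ (2 : ℝ) ∂ν := by
        apply lintegral_mono_ae
        have h2 : ∀ᵐ z ∂ν, ‖z‖ < (shrinkingBump d n).rOut := by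
          rw [ae_withDensity_iff hk]
          refine .of_forall fun z hz => ?_
          have : z ∈ Function.support ρ := by
            intro h0
            apply hz
            simp [k, h0]
          rw [hρ, (shrinkingBump d n).support_normed_eq, mem_ball_zero_iff] at this
          exact this
        filter_upwards [h2] with z hz
        have h3 := hε z hz
        rw [eLpNorm_eq_lintegral_rpow_enorm_toReal (by norm_num) (by norm_num)] at h3
        simp only [ENNReal.toReal_ofNat] at h3
        rwa [one_div, ENNReal.rpow_inv_le_iff (by norm_num)] at h3
    _ = ε ^ (2 : ℝ) := by simp

theorem tendsto_eLpNorm_mollify_sub [CompleteSpace F] {f : Euc d → F} (hfm : StronglyMeasurable f)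
    (hf : MemLp f 2 volume) :
    Tendsto (fun n => eLpNorm (fun x => mollify n f x - f x) 2 volume) atTop (𝓝 0) := by
  rw [ENNReal.tendsto_nhds_zero]
  intro ε hε
  have h1 := (ENNReal.tendsto_nhds_zero.1 (tendsto_eLpNorm_translate_sub hf)) ε hε
  obtain ⟨r, hr, hball⟩ := Metric.eventually_nhds_iff_ball.1 h1
  filter_upwards [(tendsto_shrinkingBump_rOut d).eventually_le_const hr] with n hn
  exact eLpNorm_mollify_sub_le n hfm hf fun z hz => hball z (by simpa using hz.trans_le hn)

end MollifyL2

/-! ### Multiplication by compactly supported `C¹` functions -/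

section Product

variable {d : ℕ}

theorem inner_gradient_eq_fderiv (f : Euc d → ℝ) (x e : Euc d) :
    inner ℝ (gradient f x) e = fderiv ℝ f x e := by
  rw [← toDual_gradient, InnerProductSpace.toDual_apply_apply]

theorem continuous_gradient {f : Euc d → ℝ} (hf : ContDiff ℝ 1 f) : Continuous (gradient f) :=
  (InnerProductSpace.toDual ℝ (Euc d)).symm.continuous.comp (hf.continuous_fderiv one_ne_zero)

theorem gradient_eq_zero_of_notMem_tsupport {f : Euc d → ℝ} {x : Euc d} (hx : x ∉ tsupport f) :
    gradient f x = 0 := by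
  have : fderiv ℝ f x = 0 := by
    by_contra h
    exact hx (support_fderiv_subset ℝ h)
  rw [gradient, this, map_zero]

/-- An element of `L²(U) × L²(U; ℝ^d)` from a pair of functions. -/
noncomputable def mkL2Pair {U : Set (Euc d)} {u : Euc d → ℝ} {G : Euc d → Euc d}
    (hu : MemLp u 2 (volume.restrict U)) (hG : MemLp G 2 (volume.restrict U)) : L2Pair U :=
  WithLp.toLp 2 (hu.toLp u, hG.toLp G)

theorem mkL2Pair_fst_ae {U : Set (Euc d)} {u : Euc d → ℝ} {G : Euc d → Euc d}
    (hu : MemLp u 2 (volume.restrict U)) (hG : MemLp G 2 (volume.restrict U)) :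
    (mkL2Pair hu hG).fst =ᵐ[volume.restrict U] u := hu.coeFn_toLp

theorem mkL2Pair_snd_ae {U : Set (Euc d)} {u : Euc d → ℝ} {G : Euc d → Euc d}
    (hu : MemLp u 2 (volume.restrict U)) (hG : MemLp G 2 (volume.restrict U)) :
    (mkL2Pair hu hG).snd =ᵐ[volume.restrict U] G := hG.coeFn_toLp

theorem HasWeakGrad.congr {U : Set (Euc d)} {u u' : Euc d → ℝ} {G G' : Euc d → Euc d}
    (h : HasWeakGrad U u G) (hu : u' =ᵐ[volume.restrict U] u)
    (hG : G' =ᵐ[volume.restrict U] G) : HasWeakGrad U u' G' := by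
  intro φ hφ e
  have h1 : ∫ x in U, u' x * fderiv ℝ φ x e = ∫ x in U, u x * fderiv ℝ φ x e :=
    integral_congr_ae (by filter_upwards [hu] with x hx; rw [hx])
  have h2 : ∫ x in U, inner ℝ (G' x) e * φ x = ∫ x in U, inner ℝ (G x) e * φ x :=
    integral_congr_ae (by filter_upwards [hG] with x hx; rw [hx])
  rw [h1, h2]
  exact h φ hφ e

theorem mkL2Pair_mem_H1 {U : Set (Euc d)} {u : Euc d → ℝ} {G : Euc d → Euc d}
    (hu : MemLp u 2 (volume.restrict U)) (hG : MemLp G 2 (volume.restrict U)) :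
    mkL2Pair hu hG ∈ H1 U ↔ HasWeakGrad U u G := by
  rw [mem_H1_iff]
  exact ⟨fun h => h.congr (mkL2Pair_fst_ae hu hG).symm (mkL2Pair_snd_ae hu hG).symm,
    fun h => h.congr (mkL2Pair_fst_ae hu hG) (mkL2Pair_snd_ae hu hG)⟩

theorem hasWeakGrad_of_contDiff (U : Set (Euc d)) {f : Euc d → ℝ} (hf : ContDiff ℝ 1 f) :
    HasWeakGrad U f (gradient f) := by
  intro φ hφ e
  have h0 : ∀ x ∉ U, φ x = 0 := fun x hx =>
    image_eq_zero_of_notMem_tsupport fun h => hx (hφ.support_subset h)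
  have h0' : ∀ x ∉ U, fderiv ℝ φ x e = 0 := fun x hx => by
    rw [← inner_gradient_eq_fderiv, gradient_eq_zero_of_notMem_tsupport
      fun h => hx (hφ.support_subset h), inner_zero_left]
  rw [setIntegral_eq_integral_of_forall_compl_eq_zero fun x hx => by rw [h0' x hx, mul_zero],
    setIntegral_eq_integral_of_forall_compl_eq_zero fun x hx => by rw [h0 x hx, mul_zero]]
  simp_rw [inner_gradient_eq_fderiv]
  have hfd : Continuous fun x => fderiv ℝ f x e :=
    (hf.continuous_fderiv one_ne_zero).clm_apply continuous_const
  have hφd : Continuous fun x => fderiv ℝ φ x e :=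
    (hφ.smooth.continuous_fderiv (by simp)).clm_apply continuous_const
  refine integral_mul_fderiv_eq_neg_fderiv_mul_of_integrable ?_ ?_ ?_
    (fun x _ => hf.differentiable one_ne_zero x) (fun x _ => hφ.smooth.differentiable (by simp) x)
  · exact (hfd.mul hφ.smooth.continuous).integrable_of_hasCompactSupport hφ.compact.mul_left
  · exact (hf.continuous.mul hφd).integrable_of_hasCompactSupport
      (hφ.compact.fderiv_apply ℝ e).mul_left
  · exact (hf.continuous.mul hφ.smooth.continuous).integrable_of_hasCompactSupport
      hφ.compact.mul_left

/-- The product `η φ` is an admissible `C¹` test function wherever `φ` is supported. This freedom in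
`φ` allows the translated bumps of the next lemma, which may reach outside `U`. -/
theorem HasWeakGrad.integral_cutoff_mul_fderiv {U : Set (Euc d)} (hU : IsOpen U)
    (hfin : volume U < ∞)
    {u : Euc d → ℝ} {G : Euc d → Euc d} (hu : MemLp u 2 (volume.restrict U))
    (hG : MemLp G 2 (volume.restrict U)) (h : HasWeakGrad U u G) {η : Euc d → ℝ}
    (hη : ContDiff ℝ 1 η) (hc : HasCompactSupport η) (hs : tsupport η ⊆ U) {φ : Euc d → ℝ}
    (hφ : ContDiff ℝ 1 φ) (e : Euc d) :
    ∫ x in U, (η x * u x) * fderiv ℝ φ x e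
      = -∫ x in U, inner ℝ (η x • G x + u x • gradient η x) e * φ x := by
  have : IsFiniteMeasure (volume.restrict U) := ⟨by simpa using hfin⟩
  have hu1 : Integrable u (volume.restrict U) := hu.integrable (by norm_num)
  have hG1 : Integrable (fun x => inner ℝ (G x) e) (volume.restrict U) :=
    (hG.inner_const e).integrable (by norm_num)
  have h1 := h.integral_mul_fderiv hU hfin hu hG (hη.mul hφ) hc.mul_right
    ((tsupport_mul_subset_left).trans hs) e
  have hmul : ∀ x, fderiv ℝ (fun y => η y * φ y) x e
      = η x * fderiv ℝ φ x e + φ x * fderiv ℝ η x e := by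
    intro x
    rw [fderiv_fun_mul (hη.differentiable one_ne_zero x) (hφ.differentiable one_ne_zero x)]
    simp
  have hηd : Continuous fun x => fderiv ℝ η x e :=
    (hη.continuous_fderiv one_ne_zero).clm_apply continuous_const
  have hφd : Continuous fun x => fderiv ℝ φ x e :=
    (hφ.continuous_fderiv one_ne_zero).clm_apply continuous_const
  have bdd : ∀ {f : Euc d → ℝ} {g : Euc d → ℝ}, Integrable g (volume.restrict U) →
      Continuous f → HasCompactSupport f → Integrable (fun x => g x * f x) (volume.restrict U) := by
    intro f g hg hf hfc
    obtain ⟨C, hC⟩ := hfc.exists_bound_of_continuous hf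
    exact hg.mul_bdd (c := C) hf.aestronglyMeasurable (.of_forall hC)
  have i1 : Integrable (fun x => u x * (η x * fderiv ℝ φ x e)) (volume.restrict U) :=
    bdd hu1 (hη.continuous.mul hφd) hc.mul_right
  have i2 : Integrable (fun x => u x * (φ x * fderiv ℝ η x e)) (volume.restrict U) :=
    bdd hu1 (hφ.continuous.mul hηd) (hc.fderiv_apply ℝ e).mul_left
  have i3 : Integrable (fun x => inner ℝ (G x) e * (η x * φ x)) (volume.restrict U) :=
    bdd hG1 (hη.continuous.mul hφ.continuous) hc.mul_right
  simp_rw [hmul, mul_add] at h1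
  rw [integral_add i1 i2] at h1
  have e1 : ∫ x in U, (η x * u x) * fderiv ℝ φ x e = ∫ x in U, u x * (η x * fderiv ℝ φ x e) :=
    integral_congr_ae (.of_forall fun x => by ring)
  have e2 : ∫ x in U, inner ℝ (η x • G x + u x • gradient η x) e * φ x
      = ∫ x in U, (inner ℝ (G x) e * (η x * φ x) + u x * (φ x * fderiv ℝ η x e)) :=
    integral_congr_ae (.of_forall fun x => by
      simp only [inner_add_left, real_inner_smul_left, inner_gradient_eq_fderiv]; ring)
  rw [e1, e2, integral_add i3 i2]
  linarith

/-- The derivative of the mollification falls on the bump `ρ`. With `φ y = ρ (x - y)` as test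
function in the weak product rule it moves onto `η u`; the sign from the reflection cancels the sign
in the weak gradient. The cutoff makes extension by zero harmless, so `x` may lie anywhere. -/
theorem HasWeakGrad.gradient_mollify_cutoff_mul {U : Set (Euc d)} (hU : IsOpen U)
    (hfin : volume U < ∞)
    {u : Euc d → ℝ} {G : Euc d → Euc d} (hu : MemLp u 2 (volume.restrict U))
    (hG : MemLp G 2 (volume.restrict U)) (h : HasWeakGrad U u G) {η : Euc d → ℝ}
    (hη : ContDiff ℝ 1 η) (hc : HasCompactSupport η) (hs : tsupport η ⊆ U)
    (hloc : LocallyIntegrable (fun x => η x * u x) volume)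
    (hloc' : LocallyIntegrable (fun x => η x • G x + u x • gradient η x) volume)
    (n : ℕ) (x : Euc d) :
    gradient (mollify n fun x => η x * u x) x
      = mollify n (fun x => η x • G x + u x • gradient η x) x := by
  set f : Euc d → ℝ := fun x => η x * u x
  set H : Euc d → Euc d := fun x => η x • G x + u x • gradient η x
  set ρ : Euc d → ℝ := (shrinkingBump d n).normed volume with hρ
  have hρs : ContDiff ℝ 1 ρ := (shrinkingBump d n).contDiff_normed
  have hρc : HasCompactSupport ρ := (shrinkingBump d n).hasCompactSupport_normed
  refine ext_inner_right ℝ fun e => ?_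
  rw [inner_gradient_eq_fderiv]
  have hfd := (hρc.hasFDerivAt_convolution_left (ContinuousLinearMap.lsmul ℝ ℝ) hρs hloc x).fderiv
  have hex : Integrable (fun t => ((ContinuousLinearMap.lsmul ℝ ℝ).precompL (Euc d)
      (fderiv ℝ ρ t) (f (x - t)) : Euc d →L[ℝ] ℝ)) volume :=
    (hρc.fderiv ℝ).convolutionExists_left _ (hρs.continuous_fderiv one_ne_zero) hloc x
  have e1 : fderiv ℝ (mollify n f) x e = ∫ t, fderiv ℝ ρ t e * f (x - t) := by
    unfold mollify
    rw [hfd, convolution_def, ContinuousLinearMap.integral_apply hex]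
    rfl
  let φ : Euc d → ℝ := fun y => ρ (x - y)
  have hφ : ContDiff ℝ 1 φ := hρs.comp (contDiff_const.sub contDiff_id)
  have hφd : ∀ y, fderiv ℝ φ y e = -fderiv ℝ ρ (x - y) e := by
    intro y
    have h2 : HasFDerivAt φ ((fderiv ℝ ρ (x - y)).comp (-ContinuousLinearMap.id ℝ (Euc d))) y :=
      (hρs.differentiable one_ne_zero (x - y)).hasFDerivAt.comp y ((hasFDerivAt_id y).const_sub x)
    rw [h2.fderiv]
    simp
  have hz : ∀ y ∉ U, η y = 0 ∧ gradient η y = 0 := fun y hy =>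
    ⟨image_eq_zero_of_notMem_tsupport fun h => hy (hs h),
      gradient_eq_zero_of_notMem_tsupport fun h => hy (hs h)⟩
  have h1 := h.integral_cutoff_mul_fderiv hU hfin hu hG hη hc hs hφ e
  rw [setIntegral_eq_integral_of_forall_compl_eq_zero fun y hy => by simp [(hz y hy).1],
    setIntegral_eq_integral_of_forall_compl_eq_zero fun y hy => by
      simp [(hz y hy).1, (hz y hy).2]] at h1
  have hi : Integrable (fun z => ρ z • H (x - z)) volume :=
    hρc.convolutionExists_left (ContinuousLinearMap.lsmul ℝ ℝ) hρs.continuous hloc' x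
  have e3 : ∫ z, ρ z • H (x - z) = ∫ y, ρ (x - y) • H y := by
    rw [← integral_sub_left_eq_self (fun z => ρ z • H (x - z)) volume x]
    simp only [sub_sub_cancel]
  have e4 : ∫ t, fderiv ℝ ρ t e * f (x - t) = ∫ y, fderiv ℝ ρ (x - y) e * f y := by
    rw [← integral_sub_left_eq_self (fun t => fderiv ℝ ρ t e * f (x - t)) volume x]
    simp only [sub_sub_cancel]
  have hi' : Integrable (fun y => ρ (x - y) • H y) volume := by
    simpa only [sub_sub_cancel] using hi.comp_sub_left x
  rw [e1, mollify_apply, ← hρ, e3, e4, real_inner_comm, ← integral_inner hi']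
  have e2 : ∫ y, fderiv ℝ ρ (x - y) e * f y = -∫ y, η y * u y * fderiv ℝ φ y e := by
    rw [← integral_neg]
    refine integral_congr_ae (.of_forall fun y => ?_)
    simp only [hφd, f]; ring
  rw [e2, h1, neg_neg]
  refine integral_congr_ae (.of_forall fun y => ?_)
  simp only [inner_smul_right, φ, H]
  rw [real_inner_comm, mul_comm]

end Product

/-! ### Products that belong to `H¹₀` -/

section Cutoff

variable {d : ℕ}

theorem L2Pair.norm_le_add {U : Set (Euc d)} (w : L2Pair U) : ‖w‖ ≤ ‖w.fst‖ + ‖w.snd‖ := by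
  have h := WithLp.prod_norm_sq_eq_of_L2 w
  refine abs_le_of_sq_le_sq' ?_ (by positivity) |>.2
  rw [h]
  nlinarith [norm_nonneg w.fst, norm_nonneg w.snd]

theorem L2Pair.inner_eq {U : Set (Euc d)} (w z : L2Pair U) :
    inner ℝ w z = (∫ x in U, inner ℝ (w.fst x) (z.fst x))
      + ∫ x in U, inner ℝ (w.snd x) (z.snd x) := by
  rw [WithLp.prod_inner_apply, L2.inner_def, L2.inner_def]
  rfl

theorem IsTestFunction.memLp_gradient {U : Set (Euc d)} {φ : Euc d → ℝ}
    (h : IsTestFunction U φ) : MemLp (gradient φ) 2 (volume.restrict U) := by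
  refine (continuous_gradient (h.smooth.of_le (by simp))).memLp_of_hasCompactSupport ?_
  refine HasCompactSupport.of_support_subset_isCompact h.compact fun x hx => ?_
  by_contra hx'
  exact hx (gradient_eq_zero_of_notMem_tsupport hx')

theorem IsTestFunction.mkL2Pair_mem_testSpace {U : Set (Euc d)} {φ : Euc d → ℝ}
    (h : IsTestFunction U φ) : mkL2Pair h.memLp h.memLp_gradient ∈ testSpace U :=
  ⟨(mkL2Pair_mem_H1 _ _).2 (hasWeakGrad_of_contDiff U (h.smooth.of_le (by simp))), φ, h,
    mkL2Pair_fst_ae _ _⟩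

theorem memLp_of_restrict {F : Type*} [NormedAddCommGroup F] {U : Set (Euc d)} (hU : IsOpen U)
    {f : Euc d → F} {p : ℝ≥0∞} (hf : MemLp f p (volume.restrict U)) (h0 : ∀ x ∉ U, f x = 0) :
    MemLp f p volume := by
  rw [← memLp_indicator_iff_restrict hU.measurableSet] at hf
  rwa [indicator_eq_self.2] at hf
  intro x hx
  by_contra h
  exact hx (h0 x h)

/-- The product of an `H¹` function and a compactly supported `C¹` function is in `H¹₀`. -/
theorem cutoff_mul_mem_H10 {U : Set (Euc d)} (hU : IsOpen U) (hfin : volume U < ∞) {v w : L2Pair U}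
    (hv : v ∈ H1 U) {η : Euc d → ℝ} (hη : ContDiff ℝ 1 η) (hc : HasCompactSupport η)
    (hs : tsupport η ⊆ U) (h1 : w.fst =ᵐ[volume.restrict U] fun x => η x * v.fst x)
    (h2 : w.snd =ᵐ[volume.restrict U] fun x => η x • v.snd x + v.fst x • gradient η x) :
    w ∈ H10 U := by
  set f : Euc d → ℝ := fun x => η x * v.fst x with hf
  set H : Euc d → Euc d := fun x => η x • v.snd x + v.fst x • gradient η x with hH
  have hfm : StronglyMeasurable f :=
    hη.continuous.stronglyMeasurable.mul (Lp.stronglyMeasurable _)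
  have hHm : StronglyMeasurable H :=
    (hη.continuous.stronglyMeasurable.smul (Lp.stronglyMeasurable _)).add
      ((Lp.stronglyMeasurable v.fst).smul (continuous_gradient hη).stronglyMeasurable)
  have hz : ∀ y ∉ tsupport η, η y = 0 ∧ gradient η y = 0 := fun y hy =>
    ⟨image_eq_zero_of_notMem_tsupport hy, gradient_eq_zero_of_notMem_tsupport hy⟩
  have hf2 : MemLp f 2 volume := memLp_of_restrict hU ((Lp.memLp w.fst).ae_eq h1) fun x hx => by
    simp [f, hz x fun h => hx (hs h)]
  have hH2 : MemLp H 2 volume := memLp_of_restrict hU ((Lp.memLp w.snd).ae_eq h2) fun x hx => by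
    simp [H, hz x fun h => hx (hs h)]
  have hfl : LocallyIntegrable f volume := hf2.locallyIntegrable (by norm_num)
  have hHl : LocallyIntegrable H volume := hH2.locallyIntegrable (by norm_num)
  have hfs : Function.support f ⊆ tsupport η := fun x hx => by
    by_contra h
    exact hx (by simp [f, hz x h])
  have hgrad : ∀ n, gradient (mollify n f) = mollify n H := fun n => funext fun x =>
    HasWeakGrad.gradient_mollify_cutoff_mul hU hfin (Lp.memLp _) (Lp.memLp _) hv hη hc hs hfl hHl
      n x
  change w ∈ (testSpace U).topologicalClosure
  rw [← SetLike.mem_coe, Submodule.topologicalClosure_coe, Metric.mem_closure_iff]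
  intro ε hε
  have hε2 : 0 < ENNReal.ofReal (ε / 2) := ENNReal.ofReal_pos.2 (by positivity)
  -- At one index the mollification is a test function on `U`, and both it and its gradient, which
  -- is the mollification of `H`, are within `ε / 2` of their limits.
  obtain ⟨n, hn1, hn2, hn3⟩ := ((eventually_tsupport_mollify_subset hc.isCompact hU hs hfs).and
    (((tendsto_eLpNorm_mollify_sub hfm hf2).eventually_lt_const hε2).and
      ((tendsto_eLpNorm_mollify_sub hHm hH2).eventually_lt_const hε2))).exists
  have ht : IsTestFunction U (mollify n f) := ⟨contDiff_mollify n hfl, hn1.1, hn1.2⟩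
  refine ⟨_, ht.mkL2Pair_mem_testSpace, ?_⟩
  rw [dist_comm, dist_eq_norm]
  have key : ∀ {F : Type} [NormedAddCommGroup F] {a b : Lp F 2 (volume.restrict U)}
      {p q : Euc d → F}, a =ᵐ[volume.restrict U] p → b =ᵐ[volume.restrict U] q →
      eLpNorm (fun x => p x - q x) 2 volume < ENNReal.ofReal (ε / 2) → ‖a - b‖ < ε / 2 := by
    intro F _ a b p q ha hb hlt
    rw [Lp.norm_def]
    have e : eLpNorm (a - b : Lp F 2 (volume.restrict U)) 2 (volume.restrict U)
        ≤ eLpNorm (fun x => p x - q x) 2 volume := by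
      rw [eLpNorm_congr_ae (g := fun x => p x - q x)]
      · exact eLpNorm_mono_measure _ Measure.restrict_le_self
      · filter_upwards [Lp.coeFn_sub a b, ha, hb] with x h1 h2 h3
        rw [h1, Pi.sub_apply, h2, h3]
    exact ENNReal.toReal_lt_of_lt_ofReal (e.trans_lt hlt)
  have k1 := key (mkL2Pair_fst_ae ht.memLp ht.memLp_gradient) h1 hn2
  have k2 := key ((mkL2Pair_snd_ae ht.memLp ht.memLp_gradient).trans
    (.of_forall fun x => by rw [hgrad])) h2 hn3
  refine (L2Pair.norm_le_add _).trans_lt ?_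
  rw [WithLp.sub_fst, WithLp.sub_snd]
  linarith

/-! ### Smooth truncation -/

/-- The derivative of the truncation: it vanishes up to `1 / (k + 1)`. -/
noncomputable def truncDeriv (k : ℕ) (s : ℝ) : ℝ := max 0 (min 1 ((k + 1) * s - 1))

/-- A `C¹` truncation that vanishes near zero and approximates the identity on `[0, ∞)`. -/
noncomputable def trunc (k : ℕ) (t : ℝ) : ℝ := ∫ s in (0 : ℝ)..t, truncDeriv k s

theorem continuous_truncDeriv (k : ℕ) : Continuous (truncDeriv k) := by
  unfold truncDeriv; fun_prop

theorem truncDeriv_nonneg (k : ℕ) (s : ℝ) : 0 ≤ truncDeriv k s := le_max_left _ _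

theorem truncDeriv_le_one (k : ℕ) (s : ℝ) : truncDeriv k s ≤ 1 :=
  max_le zero_le_one (min_le_left _ _)

theorem truncDeriv_eq_zero (k : ℕ) {s : ℝ} (hs : s ≤ 1 / (k + 1)) : truncDeriv k s = 0 := by
  have : ((k : ℝ) + 1) * s ≤ 1 := by
    rw [le_div_iff₀ (by positivity)] at hs
    linarith
  exact max_eq_left ((min_le_right _ _).trans (by linarith))

theorem tendsto_truncDeriv {s : ℝ} (hs : 0 < s) :
    Tendsto (fun k => truncDeriv k s) atTop (𝓝 1) := by
  refine tendsto_const_nhds.congr' ?_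
  filter_upwards [eventually_ge_atTop (Nat.ceil (2 / s))] with k hk
  have h1 : 2 / s ≤ k := (Nat.le_ceil _).trans (by exact_mod_cast hk)
  rw [div_le_iff₀ hs] at h1
  rw [truncDeriv, min_eq_left (by nlinarith), max_eq_right zero_le_one]

theorem hasDerivAt_trunc (k : ℕ) (t : ℝ) : HasDerivAt (trunc k) (truncDeriv k t) t :=
  intervalIntegral.integral_hasDerivAt_right ((continuous_truncDeriv k).intervalIntegrable _ _)
    ((continuous_truncDeriv k).stronglyMeasurableAtFilter _ _) (continuous_truncDeriv k).continuousAt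

theorem contDiff_trunc (k : ℕ) : ContDiff ℝ 1 (trunc k) := by
  rw [contDiff_one_iff_deriv]
  refine ⟨fun t => (hasDerivAt_trunc k t).differentiableAt, ?_⟩
  rw [show deriv (trunc k) = truncDeriv k from funext fun t => (hasDerivAt_trunc k t).deriv]
  exact continuous_truncDeriv k

theorem trunc_eq_zero (k : ℕ) {t : ℝ} (ht : t ≤ 1 / (k + 1)) : trunc k t = 0 := by
  rw [trunc, intervalIntegral.integral_congr (g := fun _ => 0)]
  · simp
  · intro s hs
    refine truncDeriv_eq_zero k ?_
    have : (0 : ℝ) ≤ 1 / (k + 1) := by positivity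
    rcases le_total 0 t with h | h
    · rw [uIcc_of_le h] at hs; exact hs.2.trans ht
    · rw [uIcc_of_ge h] at hs; exact hs.2.trans this

theorem abs_trunc_le (k : ℕ) (t : ℝ) : |trunc k t| ≤ |t| := by
  have := intervalIntegral.norm_integral_le_of_norm_le_const (a := 0) (b := t)
    (f := truncDeriv k) (C := 1) fun s _ => by
      rw [Real.norm_of_nonneg (truncDeriv_nonneg k s)]; exact truncDeriv_le_one k s
  simpa [trunc] using this

theorem tendsto_trunc {t : ℝ} (ht : 0 ≤ t) : Tendsto (fun k => trunc k t) atTop (𝓝 t) := by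
  have h : Tendsto (fun k => ∫ s in (0 : ℝ)..t, truncDeriv k s) atTop
      (𝓝 (∫ _ in (0 : ℝ)..t, (1 : ℝ))) := by
    refine intervalIntegral.tendsto_integral_filter_of_dominated_convergence (fun _ => 1)
      (.of_forall fun k => (continuous_truncDeriv k).aestronglyMeasurable)
      (.of_forall fun k => .of_forall fun s _ => ?_) (by simp) (.of_forall fun s hs => ?_)
    · rw [Real.norm_of_nonneg (truncDeriv_nonneg k s)]; exact truncDeriv_le_one k s
    · rw [uIoc_of_le ht] at hs
      exact tendsto_truncDeriv hs.1
  simpa [trunc] using h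

end Cutoff

/-! ### Multiplication by the partition of unity function -/

namespace PUFunction

variable {d : ℕ} {ω : Set (Euc d)} (χ : PUFunction ω)

theorem differentiableAt (hω : IsOpen ω) {x : Euc d} (hx : x ∈ ω) :
    DifferentiableAt ℝ χ.toFun x :=
  (χ.contDiffOn.contDiffAt (hω.mem_nhds hx)).differentiableAt one_ne_zero

/-- A zero of the nonnegative function `χ` is a minimum. This matters because `truncDeriv k 0 = 0`
for all `k`: at the zeros of `χ`, the gradients of the truncations tend to that of `χ` only because
the latter vanishes. -/
theorem gradient_eq_zero_of_eq_zero {x : Euc d} (hx : χ.toFun x = 0) : gradient χ.toFun x = 0 := by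
  have h : IsLocalMin χ.toFun x := .of_forall fun y => hx ▸ χ.nonneg y
  rw [gradient, h.fderiv_eq_zero, map_zero]

/-- The truncations of `χ`. -/
noncomputable def truncation (k : ℕ) (x : Euc d) : ℝ := trunc k (χ.toFun x)

/-- The superlevel set is closed because `χ` is continuous on the whole space, and it lies in `ω`
because `χ` vanishes elsewhere. Truncation thus yields compact support in `ω` without any regularity
of its boundary. -/
theorem tsupport_truncation_subset (k : ℕ) :
    tsupport (χ.truncation k) ⊆ {x | 1 / ((k : ℝ) + 1) ≤ χ.toFun x} := by
  refine closure_minimal (fun x hx => ?_) (isClosed_le continuous_const χ.continuous)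
  by_contra h
  exact hx (trunc_eq_zero k (le_of_not_ge h))

theorem tsupport_truncation_subset_domain (k : ℕ) : tsupport (χ.truncation k) ⊆ ω := by
  intro x hx
  by_contra h
  have h1 : 1 / ((k : ℝ) + 1) ≤ χ.toFun x := χ.tsupport_truncation_subset k hx
  rw [χ.eq_zero x h] at h1
  have : (0 : ℝ) < 1 / (k + 1) := by positivity
  linarith

theorem hasCompactSupport_truncation (hb : Bornology.IsBounded ω) (k : ℕ) :
    HasCompactSupport (χ.truncation k) :=
  Metric.isCompact_of_isClosed_isBounded (isClosed_tsupport _)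
    (hb.subset (χ.tsupport_truncation_subset_domain k))

theorem contDiff_truncation (hω : IsOpen ω) (k : ℕ) : ContDiff ℝ 1 (χ.truncation k) := by
  rw [contDiff_iff_contDiffAt]
  intro x
  by_cases hx : x ∈ ω
  · exact (contDiff_trunc k).contDiffAt.comp x (χ.contDiffOn.contDiffAt (hω.mem_nhds hx))
  · have : x ∉ tsupport (χ.truncation k) := fun h => hx (χ.tsupport_truncation_subset_domain k h)
    exact contDiffAt_const.congr_of_eventuallyEq (notMem_tsupport_iff_eventuallyEq.1 this)

theorem gradient_truncation (hω : IsOpen ω) (k : ℕ) {x : Euc d} (hx : x ∈ ω) :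
    gradient (χ.truncation k) x = truncDeriv k (χ.toFun x) • gradient χ.toFun x := by
  have h1 := (hasDerivAt_trunc k (χ.toFun x)).comp_hasFDerivAt x
    (χ.differentiableAt hω hx).hasFDerivAt
  have h2 : fderiv ℝ (χ.truncation k) x = truncDeriv k (χ.toFun x) • fderiv ℝ χ.toFun x :=
    h1.fderiv
  rw [gradient, h2, gradient, map_smul]

theorem abs_le_one (x : Euc d) : |χ.toFun x| ≤ 1 := by
  rw [abs_of_nonneg (χ.nonneg x)]
  exact χ.le_one x

/-- The product of `χ` and an `H¹` function is in `H¹₀`. -/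
theorem mul_mem_H10 (hω : IsOpen ω) (hb : Bornology.IsBounded ω) {v w : L2Pair ω}
    (hv : v ∈ H1 ω) (h1 : w.fst =ᵐ[volume.restrict ω] fun x => χ.toFun x * v.fst x)
    (h2 : w.snd =ᵐ[volume.restrict ω]
      fun x => χ.toFun x • v.snd x + v.fst x • gradient χ.toFun x) :
    w ∈ H10 ω := by
  have hfin : volume ω < ∞ := hb.measure_lt_top
  obtain ⟨C, hC⟩ := χ.gradient_bounded
  have hm1 : ∀ k, MemLp (fun x => χ.truncation k x * v.fst x) 2 (volume.restrict ω) := fun k => by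
    refine (Lp.memLp v.fst).of_le ((χ.contDiff_truncation hω k).continuous.aestronglyMeasurable.mul
      (Lp.aestronglyMeasurable _)) (.of_forall fun x => ?_)
    rw [norm_mul]
    exact mul_le_of_le_one_left (norm_nonneg _) ((abs_trunc_le _ _).trans (χ.abs_le_one x))
  have hb2 : ∀ k, ∀ᵐ x ∂(volume.restrict ω),
      ‖χ.truncation k x • v.snd x + v.fst x • gradient (χ.truncation k) x‖
        ≤ ‖v.snd x‖ + C * ‖v.fst x‖ := fun k => by
    rw [ae_restrict_iff' hω.measurableSet]
    refine .of_forall fun x hx => (norm_add_le _ _).trans (add_le_add ?_ ?_)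
    · rw [norm_smul]
      exact mul_le_of_le_one_left (norm_nonneg _) ((abs_trunc_le _ _).trans (χ.abs_le_one x))
    · rw [norm_smul, mul_comm, χ.gradient_truncation hω k hx, norm_smul,
        Real.norm_of_nonneg (truncDeriv_nonneg _ _)]
      refine mul_le_mul_of_nonneg_right ?_ (norm_nonneg _)
      exact (mul_le_of_le_one_left (norm_nonneg _) (truncDeriv_le_one _ _)).trans (hC x hx)
  have hbm : MemLp (fun x => ‖v.snd x‖ + C * ‖v.fst x‖) 2 (volume.restrict ω) :=
    (Lp.memLp v.snd).norm.add ((Lp.memLp v.fst).norm.const_mul C)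
  have hs2 : ∀ k, AEStronglyMeasurable
      (fun x => χ.truncation k x • v.snd x + v.fst x • gradient (χ.truncation k) x)
      (volume.restrict ω) := fun k =>
    (((χ.contDiff_truncation hω k).continuous.aestronglyMeasurable.smul
      (Lp.aestronglyMeasurable _)).add ((Lp.aestronglyMeasurable v.fst).smul
        (continuous_gradient (χ.contDiff_truncation hω k)).aestronglyMeasurable))
  have hm2 : ∀ k, MemLp
      (fun x => χ.truncation k x • v.snd x + v.fst x • gradient (χ.truncation k) x) 2
      (volume.restrict ω) := fun k => by
    refine hbm.of_le (hs2 k) ?_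
    filter_upwards [hb2 k] with x hx
    exact hx.trans (le_abs_self _)
  have hw : ∀ k, mkL2Pair (hm1 k) (hm2 k) ∈ H10 ω := fun k =>
    cutoff_mul_mem_H10 hω hfin hv (χ.contDiff_truncation hω k)
      (χ.hasCompactSupport_truncation hb k) (χ.tsupport_truncation_subset_domain k)
      (mkL2Pair_fst_ae _ _) (mkL2Pair_snd_ae _ _)
  -- A closed subspace equals its double orthogonal complement, so weak convergence of the truncated
  -- products suffices: only inner products with a fixed `y` pass to the limit.
  have hcl : (H10 ω)ᗮᗮ = H10 ω := by
    rw [Submodule.orthogonal_orthogonal_eq_closure]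
    exact (testSpace ω).isClosed_topologicalClosure.submodule_topologicalClosure_eq
  rw [← hcl, Submodule.mem_orthogonal]
  intro y hy
  have h0 : ∀ k, inner ℝ y (mkL2Pair (hm1 k) (hm2 k)) = 0 := fun k =>
    (Submodule.mem_orthogonal' _ _).1 hy _ (hw k)
  have l1 : Tendsto (fun k => ∫ x in ω, inner ℝ (y.fst x) (χ.truncation k x * v.fst x)) atTop
      (𝓝 (∫ x in ω, inner ℝ (y.fst x) (χ.toFun x * v.fst x))) := by
    refine tendsto_integral_of_dominated_convergence (fun x => ‖y.fst x‖ * ‖v.fst x‖)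
      (fun k => (Lp.aestronglyMeasurable _).inner (hm1 k).1)
      ((Lp.memLp y.fst).norm.integrable_mul (Lp.memLp v.fst).norm)
      (fun k => .of_forall fun x => ?_) (.of_forall fun x => ?_)
    · refine (norm_inner_le_norm _ _).trans (mul_le_mul_of_nonneg_left ?_ (norm_nonneg _))
      rw [norm_mul]
      exact mul_le_of_le_one_left (norm_nonneg _) ((abs_trunc_le _ _).trans (χ.abs_le_one x))
    · exact tendsto_const_nhds.inner ((tendsto_trunc (χ.nonneg x)).mul_const _)
  have l2 : Tendsto (fun k => ∫ x in ω, inner ℝ (y.snd x)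
      (χ.truncation k x • v.snd x + v.fst x • gradient (χ.truncation k) x)) atTop
      (𝓝 (∫ x in ω, inner ℝ (y.snd x)
        (χ.toFun x • v.snd x + v.fst x • gradient χ.toFun x))) := by
    refine tendsto_integral_of_dominated_convergence
      (fun x => ‖y.snd x‖ * (‖v.snd x‖ + C * ‖v.fst x‖))
      (fun k => (Lp.aestronglyMeasurable _).inner (hs2 k))
      ((Lp.memLp y.snd).norm.integrable_mul hbm)
      (fun k => ?_) ((ae_restrict_iff' hω.measurableSet).2 (.of_forall fun x hx => ?_))
    · filter_upwards [hb2 k] with x hx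
      exact (norm_inner_le_norm _ _).trans (mul_le_mul_of_nonneg_left hx (norm_nonneg _))
    · refine tendsto_const_nhds.inner (((tendsto_trunc (χ.nonneg x)).smul_const _).add
        (Tendsto.const_smul ?_ _))
      simp_rw [χ.gradient_truncation hω _ hx]
      rcases (χ.nonneg x).eq_or_lt with h | h
      · rw [χ.gradient_eq_zero_of_eq_zero h.symm]
        simp
      · simpa using (tendsto_truncDeriv h).smul_const (gradient χ.toFun x)
  have e : ∀ {w' : L2Pair ω} {p : Euc d → ℝ} {q : Euc d → Euc d},
      w'.fst =ᵐ[volume.restrict ω] p → w'.snd =ᵐ[volume.restrict ω] q →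
      inner ℝ y w' = (∫ x in ω, inner ℝ (y.fst x) (p x))
        + ∫ x in ω, inner ℝ (y.snd x) (q x) := by
    intro w' p q hp hq
    rw [L2Pair.inner_eq]
    congr 1
    · exact integral_congr_ae (by filter_upwards [hp] with x hx; rw [hx])
    · exact integral_congr_ae (by filter_upwards [hq] with x hx; rw [hx])
  rw [e h1 h2]
  refine tendsto_nhds_unique (l1.add l2) (tendsto_const_nhds.congr fun k => ?_)
  rw [← e (mkL2Pair_fst_ae (hm1 k) (hm2 k)) (mkL2Pair_snd_ae (hm1 k) (hm2 k)), h0 k]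

/-- The square of a partition of unity function. -/
noncomputable def sq (hω : IsOpen ω) : PUFunction ω where
  toFun x := χ.toFun x * χ.toFun x
  continuous := χ.continuous.mul χ.continuous
  nonneg x := mul_nonneg (χ.nonneg x) (χ.nonneg x)
  le_one x := mul_le_one₀ (χ.le_one x) (χ.nonneg x) (χ.le_one x)
  eq_zero x hx := by rw [χ.eq_zero x hx, mul_zero]
  contDiffOn := χ.contDiffOn.mul χ.contDiffOn
  gradient_bounded := by
    obtain ⟨C, hC⟩ := χ.gradient_bounded
    refine ⟨C + C, fun x hx => ?_⟩
    have hd := χ.differentiableAt hω hx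
    have : gradient (fun y => χ.toFun y * χ.toFun y) x
        = χ.toFun x • gradient χ.toFun x + χ.toFun x • gradient χ.toFun x := by
      rw [gradient, fderiv_fun_mul hd hd, map_add, map_smul]
      rfl
    rw [this]
    have h1 : ‖χ.toFun x • gradient χ.toFun x‖ ≤ C := by
      rw [norm_smul]
      exact (mul_le_of_le_one_left (norm_nonneg _) (χ.abs_le_one x)).trans (hC x hx)
    exact (norm_add_le _ _).trans (add_le_add h1 h1)
  ne_zero := by
    obtain ⟨x, hx⟩ := χ.ne_zero
    exact ⟨x, mul_ne_zero hx hx⟩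

theorem gradient_sq (hω : IsOpen ω) {x : Euc d} (hx : x ∈ ω) :
    gradient (χ.sq hω).toFun x = (2 * χ.toFun x) • gradient χ.toFun x := by
  have hd := χ.differentiableAt hω hx
  change gradient (fun y => χ.toFun y * χ.toFun y) x = _
  rw [gradient, fderiv_fun_mul hd hd, map_add, map_smul, gradient]
  module

end PUFunction

/-! ### A Poincaré inequality on subspaces of finite codimension -/

section Rellich

variable {d : ℕ}

theorem eLpNorm_two_sq {α E : Type*} [MeasurableSpace α] [NormedAddCommGroup E] (f : α → E)
    (μ : Measure α) : eLpNorm f 2 μ ^ 2 = ∫⁻ x, ‖f x‖ₑ ^ 2 ∂μ := by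
  rw [eLpNorm_eq_lintegral_rpow_enorm_toReal (by norm_num) (by norm_num), ← ENNReal.rpow_two,
    ← ENNReal.rpow_mul]
  simp

/-- The uniform interior cone property of Lipschitz domains. -/
theorem IsLipschitzDomain.exists_cone {U : Set (Euc d)} (hU : IsLipschitzDomain U) {x : Euc d}
    (hx : x ∈ closure U) : ∃ (ν : Euc d) (r c h : ℝ), 0 < r ∧ 0 < c ∧ 0 < h ∧
      ∀ y ∈ ball x r ∩ U, ∀ s ∈ Icc 0 h, ∀ e : Euc d, ‖e‖ ≤ c → y + s • (ν + e) ∈ U := by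
  by_cases hxU : x ∈ U
  · obtain ⟨r, hr, hball⟩ := Metric.isOpen_iff.1 hU.isOpen x hxU
    -- At an interior point no direction is needed; with `ν = 0` the cone is a small ball.
    refine ⟨0, r / 2, 1, r / 2, by positivity, one_pos, by positivity,
      fun y hy s hs e he => hball ?_⟩
    have h1 : ‖y - x‖ < r / 2 := by simpa [dist_eq_norm] using hy.1
    have h2 : ‖s • e‖ ≤ r / 2 := by
      rw [norm_smul, Real.norm_of_nonneg hs.1]
      nlinarith [hs.1, hs.2, norm_nonneg e]
    rw [mem_ball, dist_eq_norm, zero_add, add_sub_right_comm]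
    exact (norm_add_le _ _).trans_lt (by linarith)
  · have hf : x ∈ frontier U := ⟨hx, by rwa [hU.isOpen.interior_eq]⟩
    obtain ⟨ν, g, K, r, hν, hg, hinv, hr, hball⟩ := hU.lipschitz_boundary x hf
    have hK : (0 : ℝ) ≤ K := K.coe_nonneg
    -- The aperture is `c / 2`. A move by `s (ν + e)` raises the height by at least `s (1 - c / 2)`
    -- and raises `g` by at most `K s c / 2`; since `(c / 2) (1 + K) = 1 / 2`, the point stays above
    -- the graph.
    set c : ℝ := 1 / (1 + K) with hc
    have hc0 : 0 < c := by positivity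
    have hcK : c * (1 + K) = 1 := by rw [hc]; field_simp
    have hc1 : c ≤ 1 := by nlinarith
    refine ⟨ν, r / 2, c / 2, r / 4, by positivity, by positivity, by positivity,
      fun y hy s hs e he => ?_⟩
    have h1 : ‖y - x‖ < r / 2 := by simpa [dist_eq_norm] using hy.1
    have h2 : ‖s • (ν + e)‖ ≤ r / 2 := by
      rw [norm_smul, Real.norm_of_nonneg hs.1]
      have h3 : ‖ν + e‖ ≤ 2 := (norm_add_le _ _).trans (by linarith)
      nlinarith [hs.1, hs.2, norm_nonneg (ν + e)]
    have hyx : y ∈ ball x r := by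
      rw [mem_ball, dist_eq_norm]; linarith
    have hz : y + s • (ν + e) ∈ ball x r := by
      rw [mem_ball, dist_eq_norm, add_sub_right_comm]
      exact (norm_add_le _ _).trans_lt (by linarith)
    have hyU := (hball y hyx).1 hy.2
    rw [hball _ hz]
    rcases hs.1.eq_or_lt with h0 | h0
    · simpa [← h0] using hyU
    have e1 : y + s • (ν + e) = (y + s • e) + s • ν := by module
    have e2 : g (y + s • e) ≤ g y + K * (s * (c / 2)) := by
      have := hg.dist_le_mul (y + s • e) y
      rw [Real.dist_eq, dist_eq_norm, add_sub_cancel_left, norm_smul,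
        Real.norm_of_nonneg hs.1] at this
      have h4 := (abs_le.1 this).2
      have h5 : (K : ℝ) * (s * ‖e‖) ≤ K * (s * (c / 2)) := by gcongr
      linarith
    have e3 : inner ℝ ν (y + s • (ν + e)) = inner ℝ ν y + s * (1 + inner ℝ ν e) := by
      rw [inner_add_right, inner_smul_right, inner_add_right, real_inner_self_eq_norm_sq, hν]
      ring
    have e4 : -(c / 2) ≤ inner ℝ ν e := by
      have := (abs_le.1 (abs_real_inner_le_norm ν e)).1
      rw [hν, one_mul] at this
      linarith
    rw [e3, e1, hinv]
    nlinarith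

/-- Mean zero removes the cross term: `∫ (u - a)² = ∫ u² + a² |B|`. -/
theorem enorm_sq_mul_measure_le {B : Set (Euc d)} {u : Euc d → ℝ}
    (hfin : volume B ≠ ∞) (hu : MemLp u 2 (volume.restrict B)) (h0 : ∫ q in B, u q = 0) (a : ℝ) :
    ‖a‖ₑ ^ 2 * volume B ≤ ∫⁻ q in B, ‖u q - a‖ₑ ^ 2 := by
  have : IsFiniteMeasure (volume.restrict B) := ⟨by simpa using hfin.lt_top⟩
  have hu1 : Integrable u (volume.restrict B) := hu.integrable (by norm_num)
  have hsq : ∀ b : ℝ, ‖b‖ₑ ^ 2 = ENNReal.ofReal (b ^ 2) := fun b => by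
    rw [← ofReal_norm, ← ENNReal.ofReal_pow (norm_nonneg b), Real.norm_eq_abs, sq_abs]
  simp_rw [hsq]
  have hi2 : Integrable (fun q => u q ^ 2) (volume.restrict B) := hu.integrable_sq
  have hi : Integrable (fun q => (u q - a) ^ 2) (volume.restrict B) :=
    (hu.sub (memLp_const a)).integrable_sq
  rw [← ofReal_integral_eq_lintegral_ofReal hi (.of_forall fun q => sq_nonneg _),
    ← ENNReal.ofReal_toReal hfin, ← ENNReal.ofReal_mul (sq_nonneg a)]
  apply ENNReal.ofReal_le_ofReal
  have e1 : ∫ q in B, (u q - a) ^ 2 = ∫ q in B, (u q ^ 2 + (-(2 * a) * u q + a ^ 2)) :=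
    integral_congr_ae (.of_forall fun q => by ring)
  have hi3 : Integrable (fun q => -(2 * a) * u q) (volume.restrict B) := hu1.const_mul _
  have hi4 : Integrable (fun q => -(2 * a) * u q + a ^ 2) (volume.restrict B) :=
    hi3.add (integrable_const _)
  rw [e1, integral_add hi2 hi4, integral_add hi3 (integrable_const _), integral_const_mul, h0,
    integral_const]
  have : 0 ≤ ∫ q in B, u q ^ 2 := integral_nonneg fun q => sq_nonneg _
  simp only [smul_eq_mul, Measure.real, Measure.restrict_apply_univ]
  linarith

/-- If `u` has mean zero on finitely many suitable balls, then its `L²` norm on a set that has the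
cone property is small compared with its gradient. -/
theorem exists_finite_means_of_cone {U V : Set (Euc d)} (hU : IsOpen U) (hfin : volume U < ∞)
    (hV : IsOpen V) (hVb : Bornology.IsBounded V) (ν : Euc d) {c h₀ : ℝ} (hc : 0 < c)
    (hh₀ : 0 < h₀)
    (hcone : ∀ y ∈ V, ∀ s ∈ Icc 0 h₀, ∀ e : Euc d, ‖e‖ ≤ c → y + s • (ν + e) ∈ U)
    {δ : ℝ} (hδ : 0 < δ) :
    ∃ S : Set (Set (Euc d)), S.Finite ∧ (∀ B ∈ S, MeasurableSet B ∧ B ⊆ U) ∧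
      ∀ (u : Euc d → ℝ) (G : Euc d → Euc d), StronglyMeasurable u →
        MemLp u 2 (volume.restrict U) → MemLp G 2 (volume.restrict U) → HasWeakGrad U u G →
        (∀ B ∈ S, ∫ x in B, u x = 0) →
        ∫⁻ x in V, ‖u x‖ₑ ^ 2
          ≤ ENNReal.ofReal (δ * (eLpNorm G 2 (volume.restrict U)).toReal) ^ 2 := by
  -- The translations below have length at most `h (‖ν‖ + c)`, and `2 ^ d` is the ratio of the
  -- volumes of balls of radii `h c` and `h c / 2`.
  obtain ⟨h, hh, hhh₀, hhδ⟩ : ∃ h : ℝ, 0 < h ∧ h ≤ h₀ ∧ 2 ^ d * (h * (‖ν‖ + c)) ≤ δ := by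
    have hp : 0 < 2 ^ d * (‖ν‖ + c) := by positivity
    refine ⟨min h₀ (δ / (2 ^ d * (‖ν‖ + c))), by positivity, min_le_left _ _, ?_⟩
    have : min h₀ (δ / (2 ^ d * (‖ν‖ + c))) ≤ δ / (2 ^ d * (‖ν‖ + c)) := min_le_right _ _
    rw [le_div_iff₀ hp] at this
    linarith
  have hr : 0 < h * c / 2 := by positivity
  -- Every such `z` is `h (ν + e)` with `‖e‖ ≤ c`, so the segment from `y` to `y + z` runs inside
  -- the cone at `y`.
  have hseg : ∀ z ∈ ball (h • ν) (h * c), ∀ y ∈ V, ∀ t ∈ Icc (0 : ℝ) 1, y + t • z ∈ U := by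
    intro z hz y hy t ht
    have e : y + t • z = y + (t * h) • (ν + (h⁻¹ • z - ν)) := by
      rw [add_sub_cancel, smul_smul, mul_assoc, mul_inv_cancel₀ hh.ne', mul_one]
    rw [e]
    refine hcone y hy _ ⟨mul_nonneg ht.1 hh.le, ?_⟩ _ ?_
    · nlinarith [ht.1, ht.2]
    · have : h⁻¹ • z - ν = h⁻¹ • (z - h • ν) := by
        rw [smul_sub, smul_smul, inv_mul_cancel₀ hh.ne', one_smul]
      rw [mem_ball, dist_eq_norm] at hz
      rw [this, norm_smul, norm_inv, Real.norm_of_nonneg hh.le, inv_mul_le_iff₀ hh]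
      exact hz.le
  -- The net has half the radius: for `y` within `h c / 2` of `p`, every point of the ball of radius
  -- `h c / 2` about `p + h • ν` is `y + z` with `z` in the ball of radius `h c` about `h • ν`.
  obtain ⟨P, hPV, hPf, hP⟩ : ∃ P ⊆ V, P.Finite ∧ V ⊆ ⋃ p ∈ P, ball p (h * c / 2) := by
    obtain ⟨P, h1, h2, h3⟩ := (totallyBounded_iff_subset.1
      (hVb.isCompact_closure.totallyBounded.subset subset_closure)) _
      (Metric.dist_mem_uniformity hr)
    exact ⟨P, h1, h2, h3⟩
  have hBU : ∀ p ∈ V, ball (p + h • ν) (h * c / 2) ⊆ U := by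
    intro p hp q hq
    have h1 := hseg (q - p) ?_ p hp 1 (by simp)
    · simpa using h1
    · rw [mem_ball, dist_eq_norm] at hq ⊢
      rw [sub_sub]
      linarith
  refine ⟨(fun p => ball (p + h • ν) (h * c / 2)) '' P, hPf.image _, ?_, ?_⟩
  · rintro _ ⟨p, hp, rfl⟩
    exact ⟨measurableSet_ball, hBU p (hPV hp)⟩
  intro u G hum hu hG hw hmean
  set M := (eLpNorm G 2 (volume.restrict U)).toReal
  set S := ball (h • ν) (h * c)
  set b : ℝ≥0∞ := volume (ball (0 : Euc d) (h * c / 2)) with hb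
  have hb0 : b ≠ 0 := (measure_ball_pos _ _ hr).ne'
  have hbt : b ≠ ∞ := measure_ball_lt_top.ne
  -- Since `u` has mean zero on the ball attached to a net point near `y`, the value `u y` is
  -- controlled by the differences `u q - u y` on that ball; enlarging the domain of integration to
  -- `y + S` removes the dependence on the net point.
  have hpt : ∀ y ∈ V, ‖u y‖ₑ ^ 2 * b ≤ ∫⁻ z in S, ‖u (y + z) - u y‖ₑ ^ 2 := by
    intro y hy
    obtain ⟨p, hp, hyp⟩ := mem_iUnion₂.1 (hP hy)
    have hBp := hBU p (hPV hp)
    have e0 : volume (ball (p + h • ν) (h * c / 2)) = b := Measure.addHaar_ball_center ..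
    have e1 := enorm_sq_mul_measure_le (B := ball (p + h • ν) (h * c / 2))
      measure_ball_lt_top.ne (hu.mono_measure (Measure.restrict_mono hBp le_rfl))
      (hmean _ ⟨p, hp, rfl⟩) (u y)
    rw [e0] at e1
    refine e1.trans ?_
    have e2 : ball (p + h • ν) (h * c / 2) ⊆ (fun q => q - y) ⁻¹' S := by
      intro q hq
      rw [mem_ball, dist_eq_norm] at hq hyp
      rw [mem_preimage, mem_ball, dist_eq_norm]
      have : q - y - h • ν = (q - (p + h • ν)) - (y - p) := by abel
      rw [this]
      exact (norm_sub_le _ _).trans_lt (by linarith)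
    refine (lintegral_mono_set e2).trans (le_of_eq ?_)
    have e3 := (measurePreserving_sub_right (volume : Measure (Euc d)) y).setLIntegral_comp_preimage_emb
      (MeasurableEquiv.subRight y).measurableEmbedding (fun z => ‖u (y + z) - u y‖ₑ ^ 2) S
    rw [← e3]
    simp
  have hint : (∫⁻ x in V, ‖u x‖ₑ ^ 2) * b
      ≤ volume S * ENNReal.ofReal (h * (‖ν‖ + c) * M) ^ 2 := by
    rw [← lintegral_mul_const' _ _ hbt]
    -- After exchanging the integrals, the translation estimate applies for each fixed `z`.
    calc ∫⁻ y in V, ‖u y‖ₑ ^ 2 * b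
        ≤ ∫⁻ y in V, ∫⁻ z in S, ‖u (y + z) - u y‖ₑ ^ 2 :=
          setLIntegral_mono' hV.measurableSet hpt
      _ = ∫⁻ z in S, (∫⁻ y in V, ‖u (y + z) - u y‖ₑ ^ 2) := by
          apply lintegral_lintegral_swap
          have h1 : StronglyMeasurable (fun p : Euc d × Euc d => u (p.1 + p.2) - u p.1) :=
            (hum.comp_measurable (measurable_fst.add measurable_snd)).sub
              (hum.comp_measurable measurable_fst)
          exact (h1.enorm.pow_const 2).aemeasurable
      _ ≤ ∫⁻ _ in S, ENNReal.ofReal (h * (‖ν‖ + c) * M) ^ 2 := by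
          refine setLIntegral_mono' measurableSet_ball fun z hz => ?_
          rw [← eLpNorm_two_sq]
          refine pow_le_pow_left' ((hw.eLpNorm_translate_sub_le hU hfin hV hu hG
            (hseg z hz)).trans (ENNReal.ofReal_le_ofReal ?_)) 2
          refine mul_le_mul_of_nonneg_right ?_ ENNReal.toReal_nonneg
          rw [mem_ball, dist_eq_norm] at hz
          have := norm_le_norm_add_norm_sub' z (h • ν)
          rw [norm_smul, Real.norm_of_nonneg hh.le] at this
          linarith
      _ = volume S * ENNReal.ofReal (h * (‖ν‖ + c) * M) ^ 2 := by
          rw [setLIntegral_const, mul_comm]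
  have hS : volume S = ENNReal.ofReal (2 ^ d) * b := by
    have e1 : volume S = volume (ball (0 : Euc d) (h * c)) := Measure.addHaar_ball_center ..
    rw [e1, hb, show h * c = 2 * (h * c / 2) by ring,
      Measure.addHaar_ball_mul_of_pos volume (0 : Euc d) two_pos]
    simp
  rw [hS, mul_right_comm] at hint
  have hint2 := (ENNReal.mul_le_mul_iff_left hb0 hbt).1 hint
  refine hint2.trans ?_
  rw [← ENNReal.ofReal_pow (by positivity), ← ENNReal.ofReal_pow (by positivity),
    ← ENNReal.ofReal_mul (by positivity)]
  apply ENNReal.ofReal_le_ofReal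
  have hM : 0 ≤ M := ENNReal.toReal_nonneg
  have h2d : (1 : ℝ) ≤ 2 ^ d := one_le_pow₀ (by norm_num)
  have hA : 0 ≤ h * (‖ν‖ + c) := by positivity
  rw [mul_pow _ M, mul_pow δ M, ← mul_assoc]
  refine mul_le_mul_of_nonneg_right ?_ (sq_nonneg M)
  calc 2 ^ d * (h * (‖ν‖ + c)) ^ 2 ≤ (2 ^ d * (h * (‖ν‖ + c))) ^ 2 := by
        rw [mul_pow (2 ^ d)]
        exact mul_le_mul_of_nonneg_right (le_self_pow₀ h2d two_ne_zero) (sq_nonneg _)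
    _ ≤ δ ^ 2 := by gcongr

/-- On a Lipschitz domain, the `L²` norm is small compared with the gradient on a subspace of `H¹`
of finite codimension. -/
theorem IsLipschitzDomain.exists_finite_means {U : Set (Euc d)} (hU : IsLipschitzDomain U)
    {ε : ℝ} (hε : 0 < ε) :
    ∃ S : Set (Set (Euc d)), S.Finite ∧ (∀ B ∈ S, MeasurableSet B ∧ B ⊆ U) ∧
      ∀ w ∈ H1 U, (∀ B ∈ S, ∫ x in B, w.fst x = 0) → ‖w.fst‖ ≤ ε * ‖w.snd‖ := by
  have hfin : volume U < ∞ := hU.isBounded.measure_lt_top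
  choose! ν r c h hr hc hh hcone using fun x (hx : x ∈ closure U) => hU.exists_cone hx
  obtain ⟨t, ht, hcov⟩ := (hU.isBounded.isCompact_closure).elim_nhds_subcover
    (fun x => ball x (r x)) fun x hx => ball_mem_nhds x (hr x hx)
  -- The extra one keeps `m` positive even for an empty cover; summing the squared local bounds
  -- costs a factor `t.card ≤ m ^ 2`.
  set m : ℝ := t.card + 1 with hm
  have hm1 : 1 ≤ m := by simp [hm]
  have hδ : 0 < ε / m := by positivity
  choose! S hSf hSU hS using fun x (hx : x ∈ closure U) =>
    exists_finite_means_of_cone hU.isOpen hfin (isOpen_ball.inter hU.isOpen)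
      (isBounded_ball.subset inter_subset_left) (ν x) (hc x hx) (hh x hx) (hcone x hx) hδ
  refine ⟨⋃ x ∈ t, S x, t.finite_toSet.biUnion fun x hx => hSf x (ht x hx), ?_, ?_⟩
  · intro B hB
    obtain ⟨x, hx, hBx⟩ := mem_iUnion₂.1 hB
    exact hSU x (ht x hx) B hBx
  intro w hw hmean
  have hloc : ∀ x ∈ t, ∫⁻ y in ball x (r x) ∩ U, ‖w.fst y‖ₑ ^ 2
      ≤ ENNReal.ofReal (ε / m * ‖w.snd‖) ^ 2 := fun x hx => by
    rw [Lp.norm_def]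
    exact hS x (ht x hx) w.fst w.snd (Lp.stronglyMeasurable _) (Lp.memLp _) (Lp.memLp _) hw
      fun B hB => hmean B (mem_iUnion₂.2 ⟨x, hx, hB⟩)
  have hsub : U ⊆ ⋃ x : t, ball (x : Euc d) (r x) ∩ U := by
    intro y hy
    obtain ⟨x, hx, hyx⟩ := mem_iUnion₂.1 (hcov (subset_closure hy))
    exact mem_iUnion.2 ⟨⟨x, hx⟩, hyx, hy⟩
  have htot : ∫⁻ y in U, ‖w.fst y‖ₑ ^ 2 ≤ ENNReal.ofReal (ε * ‖w.snd‖) ^ 2 := by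
    calc ∫⁻ y in U, ‖w.fst y‖ₑ ^ 2
        ≤ ∫⁻ y in ⋃ x : t, ball (x : Euc d) (r x) ∩ U, ‖w.fst y‖ₑ ^ 2 := lintegral_mono_set hsub
      _ ≤ ∑' x : t, ∫⁻ y in ball (x : Euc d) (r x) ∩ U, ‖w.fst y‖ₑ ^ 2 := lintegral_iUnion_le _ _
      _ ≤ ∑' _ : t, ENNReal.ofReal (ε / m * ‖w.snd‖) ^ 2 :=
          ENNReal.tsum_le_tsum fun x => hloc x x.2
      _ = ENNReal.ofReal t.card * ENNReal.ofReal (ε / m * ‖w.snd‖) ^ 2 := by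
          rw [tsum_fintype]
          simp
      _ ≤ ENNReal.ofReal (ε * ‖w.snd‖) ^ 2 := by
          rw [← ENNReal.ofReal_pow (by positivity), ← ENNReal.ofReal_pow (by positivity),
            ← ENNReal.ofReal_mul (by positivity)]
          apply ENNReal.ofReal_le_ofReal
          rw [mul_pow, mul_pow, ← mul_assoc]
          refine mul_le_mul_of_nonneg_right ?_ (sq_nonneg _)
          rw [div_pow, ← mul_div_assoc, div_le_iff₀ (by positivity)]
          have : (t.card : ℝ) ≤ m ^ 2 := by
            have : (t.card : ℝ) ≤ m := by simp [hm]
            nlinarith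
          nlinarith [sq_nonneg ε]
  rw [← eLpNorm_two_sq] at htot
  have h2 : eLpNorm w.fst 2 (volume.restrict U) ≤ ENNReal.ofReal (ε * ‖w.snd‖) :=
    (ENNReal.pow_le_pow_left_iff (by norm_num)).1 htot
  rw [Lp.norm_def]
  exact ENNReal.toReal_le_of_le_ofReal (by positivity) h2

end Rellich

/-! ### Compact operators -/

section CompactOperators

variable {E F F' : Type*} [NormedAddCommGroup E] [InnerProductSpace ℝ E] [CompleteSpace E]
  [NormedAddCommGroup F] [NormedSpace ℝ F] [NormedAddCommGroup F'] [NormedSpace ℝ F']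

/-- An operator that is arbitrarily small on subspaces of finite codimension is compact. -/
theorem isCompactOperator_of_small_on_finite_codim [CompleteSpace F] (T : E →L[ℝ] F)
    (h : ∀ ε > 0, ∃ S : Set (E →L[ℝ] ℝ), S.Finite ∧ ∀ u, (∀ l ∈ S, l u = 0) → ‖T u‖ ≤ ε * ‖u‖) :
    IsCompactOperator T := by
  have hcl : IsClosed {f : E →L[ℝ] F | IsCompactOperator f} := isClosed_setOfPred_isCompactOperator
  have hmem : T ∈ closure {f : E →L[ℝ] F | IsCompactOperator f} := by
    rw [Metric.mem_closure_iff]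
    intro ε hε
    obtain ⟨S, hSf, hS⟩ := h (ε / 2) (by positivity)
    -- `K` is spanned by the Riesz representatives of the functionals, so all of them vanish on
    -- `Kᗮ`. There `T` is small, hence `T` is close in norm to the finite-rank operator obtained by
    -- projecting onto `K` first.
    let K : Submodule ℝ E := Submodule.span ℝ ((InnerProductSpace.toDual ℝ E).symm '' S)
    have : FiniteDimensional ℝ K := FiniteDimensional.span_of_finite ℝ (hSf.image _)
    refine ⟨(T.comp K.subtypeL).comp K.orthogonalProjectionOnto, ?_, ?_⟩
    · have : IsCompactOperator (T.comp K.subtypeL) :=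
        by
        have : ProperSpace K := FiniteDimensional.proper ℝ K
        exact isCompactOperator_of_locallyCompactSpace_rng (T.comp K.subtypeL)
      exact this.comp_clm _
    · rw [dist_eq_norm]
      refine (ContinuousLinearMap.opNorm_le_bound _ (by positivity) fun u => ?_).trans_lt
        (half_lt_self hε)
      have e1 : (T - (T.comp K.subtypeL).comp K.orthogonalProjectionOnto) u
          = T (u - K.orthogonalProjectionOnto u) := by simp
      rw [e1]
      refine (hS _ fun l hl => ?_).trans ?_
      · have h1 : u - K.orthogonalProjectionOnto u ∈ Kᗮ :=
          K.sub_starProjection_mem_orthogonal u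
        have h2 := (Submodule.mem_orthogonal _ _).1 h1 _
          (Submodule.subset_span (mem_image_of_mem (InnerProductSpace.toDual ℝ E).symm hl))
        rwa [InnerProductSpace.toDual_symm_apply] at h2
      · gcongr
        have h1 := K.norm_sq_eq_add_norm_sq_projection u
        have h2 : ‖u - K.orthogonalProjectionOnto u‖ = ‖Kᗮ.orthogonalProjectionOnto u‖ := by
          rw [← K.starProjection_apply, ← Submodule.starProjection_orthogonal_val]
          rfl
        rw [h2]
        exact Submodule.norm_orthogonalProjectionOnto_apply_le _ _
  rw [hcl.closure_eq] at hmem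
  exact hmem

/-- The compactness argument behind the Poincaré inequality. -/
theorem exists_norm_le_of_compact_of_injective {J : E →L[ℝ] F} {D : E →L[ℝ] F'}
    (hJ : IsCompactOperator J) (hJD : ∀ u, ‖u‖ ≤ ‖J u‖ + ‖D u‖) (hD : ∀ u, D u = 0 → u = 0) :
    ∃ C > 0, ∀ u, ‖u‖ ≤ C * ‖D u‖ := by
  by_contra! hcon
  have h1 : ∀ n : ℕ, ∃ u : E, ‖u‖ = 1 ∧ ‖D u‖ ≤ 1 / ((n : ℝ) + 1) := by
    intro n
    obtain ⟨u, hu⟩ := hcon (n + 1) (by positivity)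
    have hu0 : 0 < ‖u‖ := lt_of_le_of_lt (by positivity) hu
    refine ⟨‖u‖⁻¹ • u, by rw [norm_smul, norm_inv, norm_norm, inv_mul_cancel₀ hu0.ne'], ?_⟩
    rw [map_smul, norm_smul, norm_inv, norm_norm, le_div_iff₀ (by positivity), mul_assoc,
      inv_mul_le_iff₀ hu0]
    linarith
  choose u hu1 hu2 using h1
  have hcomp := hJ.isCompact_closure_image_closedBall (𝕜₁ := ℝ) (f := (J : E →ₗ[ℝ] F)) 1
  obtain ⟨y, -, φ, hφ, hy⟩ := hcomp.tendsto_subseq (x := fun n => J (u n))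
    fun n => subset_closure (mem_image_of_mem _ (by simp [hu1 n]))
  have hDu : Tendsto (fun n => D (u (φ n))) atTop (𝓝 0) := by
    have h0 : Tendsto (fun n => D (u n)) atTop (𝓝 0) :=
      squeeze_zero_norm hu2 tendsto_one_div_add_atTop_nhds_zero_nat
    exact h0.comp hφ.tendsto_atTop
  -- Both `J (u (φ n))` and `D (u (φ n))` are Cauchy, hence so is `u (φ n)` by the assumed bound.
  -- Its limit is a unit vector annihilated by `D`.
  have hc : CauchySeq (fun n => u (φ n)) := by
    rw [Metric.cauchySeq_iff]
    intro ε hε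
    obtain ⟨N1, h1⟩ := Metric.cauchySeq_iff.1 hy.cauchySeq (ε / 2) (by positivity)
    obtain ⟨N2, h2⟩ := Metric.cauchySeq_iff.1 hDu.cauchySeq (ε / 2) (by positivity)
    refine ⟨max N1 N2, fun m hm n hn => ?_⟩
    have e1 := h1 m (le_of_max_le_left hm) n (le_of_max_le_left hn)
    have e2 := h2 m (le_of_max_le_right hm) n (le_of_max_le_right hn)
    simp only [Function.comp_apply, dist_eq_norm, ← map_sub] at e1 e2 ⊢
    linarith [hJD (u (φ m) - u (φ n))]
  obtain ⟨x, hx⟩ := cauchySeq_tendsto_of_complete hc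
  have h3 : D x = 0 := tendsto_nhds_unique ((D.continuous.tendsto x).comp hx) hDu
  have h4 : ‖x‖ = 1 := tendsto_nhds_unique hx.norm (by simp [hu1])
  rw [hD x h3] at h4
  simp at h4

/-- An operator that is dominated by a compact operator is compact. -/
theorem IsCompactOperator.of_norm_le {E F F' : Type*} [NormedAddCommGroup E] [NormedSpace ℝ E]
    [NormedAddCommGroup F] [NormedSpace ℝ F] [NormedAddCommGroup F'] [NormedSpace ℝ F']
    [CompleteSpace F'] {J : E →L[ℝ] F} {T : E →L[ℝ] F'}
    (hJ : IsCompactOperator J) {C : ℝ} (hC : ∀ u, ‖T u‖ ≤ C * ‖J u‖) : IsCompactOperator T := by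
  rw [← T.coe_coe, isCompactOperator_iff_isCompact_closure_image_closedBall _ one_pos]
  refine TotallyBounded.isCompact_of_isClosed (TotallyBounded.closure ?_) isClosed_closure
  have hcomp := hJ.isCompact_closure_image_closedBall (𝕜₁ := ℝ) (f := (J : E →ₗ[ℝ] F)) 1
  have htb := hcomp.totallyBounded.subset subset_closure
  rw [Metric.totallyBounded_iff]
  intro ε hε
  have hC0 : 0 < |C| + 1 := by positivity
  obtain ⟨t, ht1, ht2, ht3⟩ := (totallyBounded_iff_subset.1 htb) _
    (Metric.dist_mem_uniformity (show 0 < ε / (|C| + 1) by positivity))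
  -- The net is chosen inside the image under `J`, so its points have preimages in the ball, and the
  -- images of these under `T` form a net. The denominator `|C| + 1` is positive whatever the sign
  -- of `C`.
  choose! g hg1 hg2 using fun y (hy : y ∈ t) => ht1 hy
  refine ⟨(fun y => T (g y)) '' t, ht2.image _, ?_⟩
  rintro _ ⟨u, hu, rfl⟩
  obtain ⟨y, hy, hyu⟩ := mem_iUnion₂.1 (ht3 (mem_image_of_mem _ hu))
  refine mem_iUnion₂.2 ⟨_, mem_image_of_mem _ hy, ?_⟩
  have h1 : ‖J u - y‖ < ε / (|C| + 1) := by simpa [dist_eq_norm] using hyu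
  have h2 : J (g y) = y := hg2 y hy
  rw [mem_ball, dist_eq_norm]
  change ‖T u - T (g y)‖ < ε
  rw [← map_sub]
  refine (hC _).trans_lt ?_
  rw [map_sub, h2]
  rw [lt_div_iff₀ hC0] at h1
  nlinarith [le_abs_self C, norm_nonneg (J u - y)]

end CompactOperators

/-! ### Changing the inner product -/

section Renorm

/-- A copy of `E`, to carry another inner product. -/
def EnergyCopy (E : Type) : Type := E

/-- A bounded, symmetric and coercive form is the inner product of a Hilbert space that is
isomorphic to the given one. -/
theorem exists_equiv_inner_eq {E : Type} [NormedAddCommGroup E] [InnerProductSpace ℝ E]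
    [CompleteSpace E] (a : E →L[ℝ] E →L[ℝ] ℝ) (hsymm : ∀ u v, a u v = a v u)
    (hcoer : IsCoercive a) :
    ∃ (E' : Type) (_ : NormedAddCommGroup E') (_ : InnerProductSpace ℝ E') (_ : CompleteSpace E')
      (e : E ≃L[ℝ] E'), ∀ u v, inner ℝ (e u) (e v) = a u v := by
  obtain ⟨c, hc, hcv⟩ := hcoer
  let iG : AddCommGroup (EnergyCopy E) := inferInstanceAs (AddCommGroup E)
  let iM : Module ℝ (EnergyCopy E) := inferInstanceAs (Module ℝ E)
  let i : E ≃ₗ[ℝ] EnergyCopy E := LinearEquiv.refl ℝ E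
  let core : InnerProductSpace.Core ℝ (EnergyCopy E) :=
    { inner := fun u v => a (i.symm u) (i.symm v)
      conj_inner_symm := fun u v => by simpa using hsymm _ _
      re_inner_nonneg := fun u => by
        have := hcv (i.symm u)
        have h2 : 0 ≤ c * ‖i.symm u‖ * ‖i.symm u‖ := by positivity
        exact h2.trans this
      add_left := fun u v w => by simp
      smul_left := fun u v r => by simp
      definite := fun u hu => by
        have h1 : c * ‖i.symm u‖ * ‖i.symm u‖ ≤ 0 := (hcv (i.symm u)).trans hu.le
        have h2 : ‖i.symm u‖ = 0 := by
          by_contra h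
          have : 0 < ‖i.symm u‖ := lt_of_le_of_ne (norm_nonneg _) (Ne.symm h)
          have : 0 < c * ‖i.symm u‖ * ‖i.symm u‖ := by positivity
          linarith
        simpa using h2 }
  let iN : NormedAddCommGroup (EnergyCopy E) := core.toNormedAddCommGroup
  let iI : InnerProductSpace ℝ (EnergyCopy E) := InnerProductSpace.ofCore core.toCore
  have hin : ∀ u v : E, inner ℝ (i u) (i v) = a u v := fun u v => rfl
  have hnorm : ∀ u : E, ‖i u‖ ^ 2 = a u u := fun u => by
    rw [← real_inner_self_eq_norm_sq, hin]
  have hup : ∀ u : E, ‖i u‖ ≤ Real.sqrt ‖a‖ * ‖u‖ := fun u => by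
    refine abs_le_of_sq_le_sq' ?_ (by positivity) |>.2
    rw [hnorm, mul_pow, Real.sq_sqrt (norm_nonneg a)]
    have := a.le_opNorm₂ u u
    rw [Real.norm_eq_abs] at this
    nlinarith [le_abs_self (a u u)]
  have hlow : ∀ u : E, Real.sqrt c * ‖u‖ ≤ ‖i u‖ := fun u => by
    refine abs_le_of_sq_le_sq' ?_ (norm_nonneg _) |>.2
    rw [hnorm, mul_pow, Real.sq_sqrt hc.le]
    have := hcv u
    linarith
  have hsc : 0 < Real.sqrt c := Real.sqrt_pos.2 hc
  -- Boundedness and coercivity make the identity bicontinuous, so completeness carries over to the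
  -- new norm.
  let e : E ≃L[ℝ] EnergyCopy E :=
    { i with
      continuous_toFun := (i.toLinearMap.mkContinuous _ hup).continuous
      continuous_invFun := (i.symm.toLinearMap.mkContinuous (Real.sqrt c)⁻¹ fun x => by
        have := hlow (i.symm x)
        rw [LinearEquiv.apply_symm_apply] at this
        rw [← div_eq_inv_mul, le_div_iff₀ hsc, mul_comm]
        exact this).continuous }
  exact ⟨EnergyCopy E, iN, iI, e.isUniformEmbedding.completeSpace_congr e.surjective |>.1
    inferInstance, e, hin⟩

end Renorm

/-! ### Singular systems of compact operators -/

section Singular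

variable {V W : Type*} [NormedAddCommGroup V] [InnerProductSpace ℝ V]
  [NormedAddCommGroup W] [InnerProductSpace ℝ W]

/-- `w` solves `⟪w, φ⟫ = μ ⟪T w, T φ⟫` for all `φ`. -/
def IsSingularVector (T : V →L[ℝ] W) (μ : ℝ) (w : V) : Prop :=
  w ≠ 0 ∧ ∀ φ : V, inner ℝ w φ = μ * inner ℝ (T w) (T φ)

/-- The `lam k`, `k < N`, are all the eigenvalues in increasing order with multiplicity, and `v k`
are linearly independent eigenvectors. -/
structure IsSingularSystem (T : V →L[ℝ] W) (N : ℕ∞) (lam : ℕ → ℝ) (v : ℕ → V) : Prop where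
  singular : ∀ k : ℕ, (k : ℕ∞) < N → IsSingularVector T (lam k) (v k)
  increasing : ∀ j k : ℕ, j ≤ k → (k : ℕ∞) < N → lam j ≤ lam k
  independent : LinearIndependent ℝ (fun k : {k : ℕ // (k : ℕ∞) < N} => v k)
  complete : ∀ (μ : ℝ) (w : V), IsSingularVector T μ w →
    w ∈ Submodule.span ℝ (v '' {k : ℕ | (k : ℕ∞) < N ∧ lam k = μ})

/-- The span of the first `n` vectors of a sequence. -/
def initialSpan (v : ℕ → V) (n : ℕ) : Submodule ℝ V := Submodule.span ℝ (v '' {k | k < n})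

instance (v : ℕ → V) (n : ℕ) : FiniteDimensional ℝ (initialSpan v n) :=
  FiniteDimensional.span_of_finite ℝ ((finite_lt_nat n).image v)

theorem initialSpan_eq_span_range (v : ℕ → V) (n : ℕ) :
    initialSpan v n = Submodule.span ℝ (range fun k : Fin n => v k) := by
  rw [initialSpan]
  congr 1
  ext x
  constructor
  · rintro ⟨k, hk, rfl⟩
    exact ⟨⟨k, hk⟩, rfl⟩
  · rintro ⟨k, rfl⟩
    exact ⟨k, k.2, rfl⟩

theorem mem_initialSpan (v : ℕ → V) {k n : ℕ} (h : k < n) : v k ∈ initialSpan v n :=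
  Submodule.subset_span ⟨k, h, rfl⟩

theorem initialSpan_mono (v : ℕ → V) {m n : ℕ} (h : m ≤ n) : initialSpan v m ≤ initialSpan v n :=
  Submodule.span_mono (image_mono fun _ hk => lt_of_lt_of_le hk h)

theorem exists_sum_of_mem_initialSpan {v : ℕ → V} {n : ℕ} {w : V} (hw : w ∈ initialSpan v n) :
    ∃ c : Fin n → ℝ, ∑ i, c i • v i = w := by
  rw [initialSpan_eq_span_range] at hw
  exact (Submodule.mem_span_range_iff_exists_fun ℝ).1 hw

section Vector

variable {T : V →L[ℝ] W} {μ : ℝ} {w : V}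

theorem IsSingularVector.norm_sq (h : IsSingularVector T μ w) : ‖w‖ ^ 2 = μ * ‖T w‖ ^ 2 := by
  have := h.2 w
  rwa [real_inner_self_eq_norm_sq, real_inner_self_eq_norm_sq] at this

theorem IsSingularVector.pos (h : IsSingularVector T μ w) : 0 < μ := by
  have h1 := h.norm_sq
  have h2 : 0 < ‖w‖ ^ 2 := by have := norm_pos_iff.2 h.1; positivity
  by_contra h3
  nlinarith [sq_nonneg ‖T w‖]

theorem IsSingularVector.inner_map (h : IsSingularVector T μ w) (φ : V) :
    inner ℝ (T w) (T φ) = μ⁻¹ * inner ℝ w φ := by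
  rw [h.2 φ, inv_mul_cancel_left₀ h.pos.ne']

theorem IsSingularVector.inner_eq_zero {μ' : ℝ} {w' : V} (h : IsSingularVector T μ w)
    (h' : IsSingularVector T μ' w') (hne : μ ≠ μ') : inner ℝ w w' = 0 := by
  have e1 := h.2 w'
  have e2 := h'.2 w
  rw [real_inner_comm, real_inner_comm (T w) (T w')] at e2
  have e3 : (μ - μ') * inner ℝ (T w) (T w') = 0 := by linarith
  rcases mul_eq_zero.1 e3 with h0 | h0
  · exact absurd (sub_eq_zero.1 h0) hne
  · rw [e1, h0, mul_zero]

/-- If `w` is singular and orthogonal to `u`, then `T w` is orthogonal to `T u`. -/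
theorem IsSingularVector.inner_map_eq_zero (h : IsSingularVector T μ w) {u : V}
    (hu : inner ℝ w u = 0) : inner ℝ (T w) (T u) = 0 := by
  rw [h.inner_map, hu, mul_zero]

end Vector

/-- Each `v k` is an eigenvector of `T*T`, so orthogonality to it survives `T`. This makes the
orthogonal complement of the span invariant under `T*T`; the `v k` need not be orthogonal to each
other. -/
theorem inner_map_eq_zero_of_mem_initialSpan {T : V →L[ℝ] W} {v : ℕ → V} {lam : ℕ → ℝ} {n : ℕ}
    (hv : ∀ k < n, IsSingularVector T (lam k) (v k)) {p r : V} (hp : p ∈ initialSpan v n)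
    (hr : r ∈ (initialSpan v n)ᗮ) : inner ℝ (T p) (T r) = 0 := by
  obtain ⟨c, rfl⟩ := exists_sum_of_mem_initialSpan hp
  rw [map_sum, sum_inner]
  refine Finset.sum_eq_zero fun i _ => ?_
  rw [map_smul, real_inner_smul_left, (hv i i.2).inner_map_eq_zero
    ((Submodule.mem_orthogonal _ _).1 hr _ (mem_initialSpan v i.2)), mul_zero]

theorem exists_sub_mem_orthogonal_initialSpan (v : ℕ → V) (n : ℕ) (u : V) :
    ∃ p ∈ initialSpan v n, u - p ∈ (initialSpan v n)ᗮ ∧ ‖u - p‖ ≤ ‖u‖ := by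
  refine ⟨(initialSpan v n).starProjection u, Submodule.starProjection_apply_mem _ _,
    (initialSpan v n).sub_starProjection_mem_orthogonal u, ?_⟩
  have h2 : ‖u - (initialSpan v n).starProjection u‖
      = ‖(initialSpan v n)ᗮ.orthogonalProjectionOnto u‖ := by
    rw [← Submodule.starProjection_orthogonal_val]
    rfl
  rw [h2]
  exact Submodule.norm_orthogonalProjectionOnto_apply_le _ _

namespace IsSingularSystem

variable {T : V →L[ℝ] W} {N : ℕ∞} {lam : ℕ → ℝ} {v : ℕ → V}

theorem singular_of_lt (h : IsSingularSystem T N lam v) {n k : ℕ} (hn : (n : ℕ∞) ≤ N) (hk : k < n) :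
    IsSingularVector T (lam k) (v k) :=
  h.singular k (lt_of_lt_of_le (by exact_mod_cast hk) hn)

theorem linearIndependent_fin (h : IsSingularSystem T N lam v) {n : ℕ} (hn : (n : ℕ∞) ≤ N) :
    LinearIndependent ℝ (fun k : Fin n => v k) :=
  h.independent.comp
    (fun k : Fin n => (⟨k, lt_of_lt_of_le (by exact_mod_cast k.2) hn⟩ : {k : ℕ // (k : ℕ∞) < N}))
    fun a b hab => Fin.ext (congrArg Subtype.val hab)

/-- Testing a relation among the `T (v k)` against `T φ` gives a relation among the `v k`, with
coefficients divided by the nonzero `lam k`. -/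
theorem linearIndependent_map (h : IsSingularSystem T N lam v) {n : ℕ} (hn : (n : ℕ∞) ≤ N) :
    LinearIndependent ℝ (fun k : Fin n => T (v k)) := by
  rw [Fintype.linearIndependent_iff]
  intro c hc
  have hz : ∑ i, (c i * (lam i)⁻¹) • v i = 0 := by
    refine ext_inner_right ℝ fun φ => ?_
    rw [inner_zero_left, sum_inner]
    have := congrArg (fun z => inner ℝ z (T φ)) hc
    simp only [sum_inner, inner_zero_left] at this
    rw [← this]
    refine Finset.sum_congr rfl fun i _ => ?_
    rw [real_inner_smul_left, real_inner_smul_left, (h.singular_of_lt hn i.2).inner_map, mul_assoc]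
  intro i
  have h1 := Fintype.linearIndependent_iff.1 (h.linearIndependent_fin hn) _ hz i
  exact (mul_eq_zero.1 h1).resolve_right (inv_ne_zero (h.singular_of_lt hn i.2).pos.ne')

end IsSingularSystem

variable [CompleteSpace V]

/-- The norm of a nonzero compact positive operator is an eigenvalue. -/
theorem exists_eigenvector_opNorm {K : V →L[ℝ] V} (hc : IsCompactOperator K) (hs : K.IsSymmetric)
    (hpos : ∀ u, 0 ≤ inner ℝ (K u) u) (h0 : K ≠ 0) : 0 < ‖K‖ ∧ ∃ w ≠ 0, K w = ‖K‖ • w := by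
  have hM : 0 < ‖K‖ := norm_pos_iff.2 h0
  have hrad := K.spectralRadius_eq_nnnorm (𝕜 := ℝ) hs.isSelfAdjoint
  -- Over `ℝ` a spectrum may be empty. Here that would make the spectral radius zero, which for a
  -- self-adjoint operator is the norm.
  have hnonempty : (spectrum ℝ K).Nonempty := by
    by_contra h
    rw [not_nonempty_iff_eq_empty] at h
    rw [spectralRadius, h] at hrad
    simp only [mem_empty_iff_false, not_false_eq_true, iSup_neg, ciSup_const] at hrad
    exact h0 (by simpa using hrad.symm)
  obtain ⟨k, hk, hkn⟩ := spectrum.exists_nnnorm_eq_spectralRadius_of_nonempty hnonempty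
  rw [hrad] at hkn
  have hkn' : |k| = ‖K‖ := by
    have := ENNReal.coe_inj.1 hkn
    simpa using congrArg NNReal.toReal this
  have hk0 : k ≠ 0 := by
    rintro rfl
    rw [abs_zero] at hkn'
    exact hM.ne hkn'
  -- Compactness makes the nonzero spectral value `k`, with `|k| = ‖K‖`, an eigenvalue; positivity
  -- of `K` then excludes `k = -‖K‖`.
  rw [← hc.hasEigenvalue_iff_mem_spectrum hk0] at hk
  obtain ⟨w, hw⟩ := hk.exists_hasEigenvector
  have hw1 : K w = k • w := hw.apply_eq_smul
  have hw2 : 0 ≤ k * ‖w‖ ^ 2 := by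
    have := hpos w
    rwa [hw1, real_inner_smul_left, real_inner_self_eq_norm_sq] at this
  have hw3 : 0 < ‖w‖ ^ 2 := by have := norm_pos_iff.2 hw.2; positivity
  have hkpos : 0 ≤ k := nonneg_of_mul_nonneg_left hw2 hw3
  rw [abs_of_nonneg hkpos] at hkn'
  exact ⟨hM, w, hw.2, hkn' ▸ hw1⟩

variable [CompleteSpace W]

/-- A compact operator attains its norm on the orthogonal complement of a span of singular
vectors, at a singular vector. -/
theorem exists_isSingularVector_of_map_ne_zero {T : V →L[ℝ] W} (hT : IsCompactOperator T)
    {v : ℕ → V} {lam : ℕ → ℝ} {n : ℕ} (hv : ∀ k < n, IsSingularVector T (lam k) (v k))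
    (hne : ∃ u ∈ (initialSpan v n)ᗮ, T u ≠ 0) :
    ∃ w ∈ (initialSpan v n)ᗮ, ∃ μ, IsSingularVector T μ w ∧
      ∀ u ∈ (initialSpan v n)ᗮ, ‖T u‖ ^ 2 ≤ μ⁻¹ * ‖u‖ ^ 2 := by
  let K : V →L[ℝ] V := T.adjoint.comp T
  have hK : ∀ u φ, inner ℝ (K u) φ = inner ℝ (T u) (T φ) := fun u φ =>
    ContinuousLinearMap.adjoint_inner_left T φ (T u)
  have hKc : IsCompactOperator K := hT.clm_comp T.adjoint
  have hinv : ∀ u ∈ (initialSpan v n)ᗮ, K u ∈ (initialSpan v n)ᗮ := by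
    intro u hu
    rw [Submodule.mem_orthogonal']
    intro p hp
    rw [hK, real_inner_comm]
    exact inner_map_eq_zero_of_mem_initialSpan hv hp hu
  -- Singular vectors are the solutions of `w = μ T*T w`. The norm of `T*T` restricted to the
  -- complement is an eigenvalue; it serves as `μ⁻¹`, and its being the norm gives the bound.
  let K' : (initialSpan v n)ᗮ →L[ℝ] (initialSpan v n)ᗮ := K.restrict hinv
  have hK' : ∀ u φ, inner ℝ (K' u) φ = inner ℝ (T u) (T φ) := fun u φ => hK u φ
  have hK'0 : K' ≠ 0 := by
    rintro h0
    obtain ⟨u, hu, hTu⟩ := hne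
    have := hK' ⟨u, hu⟩ ⟨u, hu⟩
    rw [h0, zero_apply, inner_zero_left] at this
    exact hTu (inner_self_eq_zero.1 this.symm)
  obtain ⟨hM, w, hw0, hw⟩ := exists_eigenvector_opNorm (hKc.restrict' hinv)
    (fun x y => by
      change inner ℝ (K' x) y = inner ℝ x (K' y)
      rw [hK', real_inner_comm (K' y) x, hK', real_inner_comm])
    (fun x => by
      change 0 ≤ inner ℝ (K' x) x
      rw [hK']; exact real_inner_self_nonneg) hK'0
  refine ⟨w, w.2, ‖K'‖⁻¹, ⟨fun h => hw0 (Subtype.ext h), fun φ => ?_⟩, fun u hu => ?_⟩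
  · have h1 : K w = ‖K'‖ • (w : V) := congrArg Subtype.val hw
    rw [← hK, h1, real_inner_smul_left, inv_mul_cancel_left₀ hM.ne']
  · rw [inv_inv]
    have h1 := hK' ⟨u, hu⟩ ⟨u, hu⟩
    rw [real_inner_self_eq_norm_sq] at h1
    rw [← h1]
    refine (real_inner_le_norm _ _).trans ?_
    have h2 := K'.le_opNorm ⟨u, hu⟩
    rw [sq, ← mul_assoc]
    exact mul_le_mul_of_nonneg_right h2 (norm_nonneg _)

namespace IsSingularSystem

variable {T : V →L[ℝ] W} {N : ℕ∞} {lam : ℕ → ℝ} {v : ℕ → V}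

/-- On the orthogonal complement of the first singular vectors, `T` either vanishes or is bounded
by the next singular value. -/
theorem eq_zero_or_norm_sq_map_le (h : IsSingularSystem T N lam v) (hT : IsCompactOperator T)
    {n : ℕ} (hn : (n : ℕ∞) ≤ N) :
    (∀ u ∈ (initialSpan v n)ᗮ, T u = 0) ∨
      ((n : ℕ∞) < N ∧ ∀ u ∈ (initialSpan v n)ᗮ, ‖T u‖ ^ 2 ≤ (lam n)⁻¹ * ‖u‖ ^ 2) := by
  by_cases hne : ∃ u ∈ (initialSpan v n)ᗮ, T u ≠ 0
  · right
    obtain ⟨w, hw, μ, hμ, hbd⟩ :=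
      exists_isSingularVector_of_map_ne_zero hT (fun k hk => h.singular_of_lt hn hk) hne
    have hmem := h.complete μ w hμ
    -- By completeness `w` is in the span of the `v k` with eigenvalue `μ`. If all these `k` were
    -- below `n`, then `w` would be orthogonal to itself. So `μ` is some `lam k` with `k ≥ n`.
    obtain ⟨k, hkn, hkN, rfl⟩ : ∃ k, n ≤ k ∧ (k : ℕ∞) < N ∧ lam k = μ := by
      by_contra! hcon
      have hsub : v '' {k : ℕ | (k : ℕ∞) < N ∧ lam k = μ} ⊆ v '' {k | k < n} := by
        refine image_mono fun k hk => ?_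
        by_contra hk2
        exact hcon k (not_lt.1 hk2) hk.1 hk.2
      have h1 : w ∈ initialSpan v n := Submodule.span_mono hsub hmem
      exact hμ.1 (inner_self_eq_zero.1 ((Submodule.mem_orthogonal _ _).1 hw w h1))
    have hnN : (n : ℕ∞) < N := lt_of_le_of_lt (by exact_mod_cast hkn) hkN
    refine ⟨hnN, fun u hu => (hbd u hu).trans ?_⟩
    have h1 := (h.singular n hnN).pos
    have h2 := h.increasing n k hkn hkN
    gcongr
  · left
    push Not at hne
    exact hne

theorem norm_sq_map_le (h : IsSingularSystem T N lam v) (hT : IsCompactOperator T)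
    {n : ℕ} (hn : (n : ℕ∞) < N) {u : V} (hu : u ∈ (initialSpan v n)ᗮ) :
    ‖T u‖ ^ 2 ≤ (lam n)⁻¹ * ‖u‖ ^ 2 := by
  rcases h.eq_zero_or_norm_sq_map_le hT hn.le with h1 | h1
  · rw [h1 u hu, norm_zero, zero_pow two_ne_zero]
    have := (h.singular n hn).pos
    positivity
  · exact h1.2 u hu

theorem map_eq_zero (h : IsSingularSystem T N lam v) (hT : IsCompactOperator T)
    {n : ℕ} (hn : (n : ℕ∞) = N) {u : V} (hu : u ∈ (initialSpan v n)ᗮ) : T u = 0 := by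
  rcases h.eq_zero_or_norm_sq_map_le hT hn.le with h1 | h1
  · exact h1 u hu
  · exact absurd h1.1 (by rw [hn]; exact lt_irrefl _)

/-- On the span of the first singular vectors, `T` is bounded below. -/
theorem le_norm_sq_map (h : IsSingularSystem T N lam v) {n : ℕ} (hn : (n : ℕ∞) < N) {u : V}
    (hu : u ∈ initialSpan v (n + 1)) : (lam n)⁻¹ * ‖u‖ ^ 2 ≤ ‖T u‖ ^ 2 := by
  have hn' : ((n + 1 : ℕ) : ℕ∞) ≤ N := by
    rw [Nat.cast_add, Nat.cast_one]; exact Order.add_one_le_of_lt hn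
  let K : V →L[ℝ] V := T.adjoint.comp T
  have hK : ∀ u φ, inner ℝ (K u) φ = inner ℝ (T u) (T φ) := fun u φ =>
    ContinuousLinearMap.adjoint_inner_left T φ (T u)
  have hKv : ∀ k < n + 1, K (v k) = (lam k)⁻¹ • v k := fun k hk => by
    refine ext_inner_right ℝ fun φ => ?_
    rw [hK, (h.singular_of_lt hn' hk).inner_map, real_inner_smul_left]
  set X := initialSpan v (n + 1)
  have hinv : ∀ u ∈ X, K u ∈ X := by
    intro u hu
    obtain ⟨c, rfl⟩ := exists_sum_of_mem_initialSpan hu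
    rw [map_sum]
    refine Submodule.sum_mem _ fun i _ => ?_
    rw [map_smul, hKv i i.2]
    exact Submodule.smul_mem _ _ (Submodule.smul_mem _ _ (mem_initialSpan v i.2))
  let K' : X →ₗ[ℝ] X := (K : V →ₗ[ℝ] V).restrict hinv
  have hK' : ∀ u φ : X, inner ℝ (K' u) φ = inner ℝ (T u) (T φ) := fun u φ => hK u φ
  have hsymm : K'.IsSymmetric := fun x y => by
    rw [hK', real_inner_comm (K' y) x, hK', real_inner_comm]
  rcases eq_or_ne u 0 with rfl | hu0
  · simp
  have : Nontrivial X := ⟨⟨⟨u, hu⟩, 0, fun h0 => hu0 (congrArg Subtype.val h0)⟩⟩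
  -- Eigenvectors of one eigenspace need not be orthogonal, so `u` is not simply expanded. Instead,
  -- the minimum `m` of the Rayleigh quotient of `T*T` on `X` is an eigenvalue, and linear
  -- independence forces it to be one of the `(lam i)⁻¹` with `i ≤ n`.
  have hev := hsymm.hasEigenvalue_iInf_of_finiteDimensional
  set m : ℝ := ⨅ x : { x : X // x ≠ 0 }, RCLike.re (inner ℝ (K' x) x) / ‖(x : X)‖ ^ 2
  have hm : (lam n)⁻¹ ≤ m := by
    obtain ⟨x, hx⟩ := hev.exists_hasEigenvector
    have hx1 : K' x = m • x := by simpa using hx.apply_eq_smul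
    have hx2 : K x = m • (x : V) := congrArg Subtype.val hx1
    obtain ⟨c, hc⟩ := exists_sum_of_mem_initialSpan x.2
    have hsum : ∑ i, (c i * ((lam i)⁻¹ - m)) • v i = 0 := by
      have e1 : K x = ∑ i, (c i * (lam i)⁻¹) • v i := by
        rw [← hc, map_sum]
        refine Finset.sum_congr rfl fun i _ => ?_
        rw [map_smul, hKv i i.2, smul_smul]
      have e2 : m • (x : V) = ∑ i, (c i * m) • v i := by
        rw [← hc, Finset.smul_sum]
        refine Finset.sum_congr rfl fun i _ => ?_
        rw [smul_smul, mul_comm]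
      simp_rw [mul_sub, sub_smul, Finset.sum_sub_distrib]
      rw [← e1, ← e2, hx2, sub_self]
    have hz := Fintype.linearIndependent_iff.1 (h.linearIndependent_fin hn') _ hsum
    obtain ⟨i, hi⟩ : ∃ i, c i ≠ 0 := by
      by_contra! hcon
      apply hx.2
      apply Subtype.ext
      rw [← hc]
      simp [hcon]
    have h1 : (lam i)⁻¹ = m := by
      rcases mul_eq_zero.1 (hz i) with h0 | h0
      · exact absurd h0 hi
      · exact sub_eq_zero.1 h0
    rw [← h1]
    have h2 := (h.singular_of_lt hn' i.2).pos
    have h3 := h.increasing i n (Nat.lt_succ_iff.1 i.2) hn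
    gcongr
  have hbdd : BddBelow (range fun x : { x : X // x ≠ 0 } =>
      RCLike.re (inner ℝ (K' x) x) / ‖(x : X)‖ ^ 2) := by
    refine ⟨0, ?_⟩
    rintro _ ⟨x, rfl⟩
    simp only [hK', real_inner_self_eq_norm_sq]
    have : (0 : ℝ) ≤ ‖T (x : X)‖ ^ 2 := by positivity
    exact div_nonneg this (by positivity)
  have h1 : m ≤ _ := ciInf_le hbdd ⟨⟨u, hu⟩, fun h0 => hu0 (congrArg Subtype.val h0)⟩
  simp only [hK', real_inner_self_eq_norm_sq] at h1
  change m ≤ ‖T u‖ ^ 2 / ‖u‖ ^ 2 at h1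
  have hup : 0 < ‖u‖ ^ 2 := by have := norm_pos_iff.2 hu0; positivity
  rw [le_div_iff₀ hup] at h1
  exact (mul_le_mul_of_nonneg_right hm hup.le).trans h1

/-- The best approximation from below: no `n`-dimensional space approximates better than the
`n`-th singular value. -/
theorem exists_le_norm_sub (h : IsSingularSystem T N lam v) {n : ℕ} (hn : (n : ℕ∞) < N)
    (Q : Submodule ℝ W) [FiniteDimensional ℝ Q] (hQ : Module.finrank ℝ Q ≤ n) :
    ∃ u ≠ 0, ∀ q ∈ Q, (lam n)⁻¹ * ‖u‖ ^ 2 ≤ ‖T u - q‖ ^ 2 := by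
  have hn' : ((n + 1 : ℕ) : ℕ∞) ≤ N := by
    rw [Nat.cast_add, Nat.cast_one]; exact Order.add_one_le_of_lt hn
  -- This map from dimension `n + 1` to dimension at most `n` has a kernel, whose elements `u` have
  -- `T u` orthogonal to `Q`; for them no `q` approximates better than zero.
  let f : initialSpan v (n + 1) →ₗ[ℝ] Q :=
    (Q.orthogonalProjectionOnto : W →ₗ[ℝ] Q) ∘ₗ (T : V →ₗ[ℝ] W) ∘ₗ (initialSpan v (n + 1)).subtype
  have hrank : Module.finrank ℝ (initialSpan v (n + 1)) = n + 1 := by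
    rw [initialSpan_eq_span_range, finrank_span_eq_card (h.linearIndependent_fin hn'),
      Fintype.card_fin]
  have hker : LinearMap.ker f ≠ ⊥ := LinearMap.ker_ne_bot_of_finrank_lt (by omega)
  obtain ⟨u, hu, hu0⟩ := Submodule.exists_mem_ne_zero_of_ne_bot hker
  refine ⟨u, fun h0 => hu0 (Subtype.ext h0), fun q hq => ?_⟩
  have h1 : Q.orthogonalProjectionOnto (T u) = 0 := LinearMap.mem_ker.1 hu
  have h2 : T u ∈ Qᗮ := Submodule.orthogonalProjectionOnto_eq_zero_iff.1 h1
  have h3 : inner ℝ (T u) q = 0 := (Submodule.mem_orthogonal' _ _).1 h2 q hq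
  have h4 := h.le_norm_sq_map hn u.2
  have h5 : ‖T (u : V) - q‖ ^ 2 = ‖T (u : V)‖ ^ 2 + ‖q‖ ^ 2 := by
    rw [norm_sub_sq_real, h3]; ring
  rw [h5]
  nlinarith [sq_nonneg ‖q‖]

end IsSingularSystem

end Singular

/-! ### Existence of singular systems -/

section Existence

variable {V W : Type*} [NormedAddCommGroup V] [InnerProductSpace ℝ V]
  [NormedAddCommGroup W] [InnerProductSpace ℝ W]

/-- `w` is a singular vector at which the norm of `T` on `Sᗮ` is attained. -/
def IsMaximalSingularVector (T : V →L[ℝ] W) (S : Submodule ℝ V) (w : V) : Prop :=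
  w ∈ Sᗮ ∧ ∃ μ, IsSingularVector T μ w ∧ ∀ u ∈ Sᗮ, ‖T u‖ ^ 2 ≤ μ⁻¹ * ‖u‖ ^ 2

open Classical in
/-- A choice of a maximal singular vector, or zero if there is none. -/
noncomputable def maximalVector (T : V →L[ℝ] W) (S : Submodule ℝ V) : V :=
  if h : ∃ w, IsMaximalSingularVector T S w then h.choose else 0

/-- The spaces spanned by successively chosen maximal singular vectors. -/
noncomputable def singularFlag (T : V →L[ℝ] W) : ℕ → Submodule ℝ V
  | 0 => ⊥
  | n + 1 => singularFlag T n ⊔ Submodule.span ℝ {maximalVector T (singularFlag T n)}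

/-- The successively chosen maximal singular vectors. -/
noncomputable def singularSeq (T : V →L[ℝ] W) (n : ℕ) : V := maximalVector T (singularFlag T n)

theorem singularFlag_eq (T : V →L[ℝ] W) (n : ℕ) :
    singularFlag T n = initialSpan (singularSeq T) n := by
  induction n with
  | zero => simp [singularFlag, initialSpan]
  | succ n ih =>
    have h1 : {k | k < n + 1} = {k | k < n} ∪ {n} := by
      ext k; simp [le_iff_lt_or_eq, or_comm]
    rw [singularFlag, initialSpan, h1, image_union, Submodule.span_union, image_singleton]
    rw [show singularSeq T n = maximalVector T (singularFlag T n) from rfl, ih]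
    rfl

theorem isMaximalSingularVector_singularSeq {T : V →L[ℝ] W} {n : ℕ} (h : singularSeq T n ≠ 0) :
    IsMaximalSingularVector T (initialSpan (singularSeq T) n) (singularSeq T n) := by
  rw [← singularFlag_eq]
  unfold singularSeq maximalVector at h ⊢
  by_cases hex : ∃ w, IsMaximalSingularVector T (singularFlag T n) w
  · rw [dif_pos hex]
    exact hex.choose_spec
  · rw [dif_neg hex] at h
    exact absurd rfl h

theorem singularSeq_ne_zero {T : V →L[ℝ] W} {n : ℕ} {w : V}
    (h : IsMaximalSingularVector T (initialSpan (singularSeq T) n) w) : singularSeq T n ≠ 0 := by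
  rw [← singularFlag_eq] at h
  have hex : ∃ w, IsMaximalSingularVector T (singularFlag T n) w := ⟨w, h⟩
  unfold singularSeq maximalVector
  rw [dif_pos hex]
  obtain ⟨-, μ, hμ, -⟩ := hex.choose_spec
  exact hμ.1

/-- Orthogonal singular vectors of a compact operator have unbounded eigenvalues. -/
theorem exists_lt_of_isCompactOperator {T : V →L[ℝ] W} (hT : IsCompactOperator T) {v : ℕ → V}
    {lam : ℕ → ℝ} (hv : ∀ n, IsSingularVector T (lam n) (v n))
    (hortho : ∀ m n, m ≠ n → inner ℝ (v m) (v n) = 0) (μ : ℝ) : ∃ n, μ < lam n := by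
  by_contra! hcon
  have hμ : 0 < μ := (hv 0).pos.trans_le (hcon 0)
  have hn : ∀ n, 0 < ‖v n‖ := fun n => norm_pos_iff.2 (hv n).1
  let x : ℕ → V := fun n => ‖v n‖⁻¹ • v n
  have hx : ∀ n, ‖x n‖ = 1 := fun n => by
    simp only [x]
    rw [norm_smul, norm_inv, norm_norm, inv_mul_cancel₀ (hn n).ne']
  have hTx : ∀ n, μ⁻¹ ≤ ‖T (x n)‖ ^ 2 := fun n => by
    simp only [x]
    have h1 : ‖T (v n)‖ ^ 2 = (lam n)⁻¹ * ‖v n‖ ^ 2 := by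
      rw [(hv n).norm_sq, inv_mul_cancel_left₀ (hv n).pos.ne']
    rw [map_smul, norm_smul, norm_inv, norm_norm, mul_pow, h1, inv_pow, mul_left_comm,
      inv_mul_cancel₀ (pow_ne_zero 2 (hn n).ne'), mul_one]
    exact inv_anti₀ (hv n).pos (hcon n)
  have hortho' : ∀ m n, m ≠ n → inner ℝ (T (x m)) (T (x n)) = 0 := fun m n hmn => by
    simp only [x, map_smul, real_inner_smul_left, inner_smul_right]
    rw [(hv m).inner_map_eq_zero (hortho m n hmn), mul_zero, mul_zero]
  -- If the eigenvalues were at most `μ`, the images of the normalized vectors would be orthogonal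
  -- with squared norms at least `μ⁻¹`, and no subsequence could be Cauchy.
  have hcomp := hT.isCompact_closure_image_closedBall (𝕜₁ := ℝ) (f := (T : V →ₗ[ℝ] W)) 1
  obtain ⟨y, -, φ, hφ, hy⟩ := hcomp.tendsto_subseq (x := fun n => T (x n))
    fun n => subset_closure (mem_image_of_mem _ (by simp [hx n]))
  obtain ⟨m, hm⟩ := Metric.cauchySeq_iff.1 hy.cauchySeq (Real.sqrt μ⁻¹)
    (Real.sqrt_pos.2 (inv_pos.2 hμ))
  have h1 := hm m le_rfl (m + 1) (Nat.le_succ m)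
  simp only [Function.comp_apply, dist_eq_norm] at h1
  have hne : φ m ≠ φ (m + 1) := (hφ (Nat.lt_succ_self m)).ne
  have h2 : ‖T (x (φ m)) - T (x (φ (m + 1)))‖ ^ 2 < μ⁻¹ := by
    rw [← Real.sq_sqrt (inv_pos.2 hμ).le]
    exact pow_lt_pow_left₀ h1 (norm_nonneg _) two_ne_zero
  rw [norm_sub_sq_real, hortho' _ _ hne] at h2
  have := hTx (φ m)
  have := hTx (φ (m + 1))
  have := inv_pos.2 hμ
  linarith

/-- Every compact operator has a singular system. -/
theorem exists_isSingularSystem [CompleteSpace V] [CompleteSpace W] {T : V →L[ℝ] W}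
    (hT : IsCompactOperator T) :
    ∃ (N : ℕ∞) (lam : ℕ → ℝ) (v : ℕ → V), IsSingularSystem T N lam v := by
  classical
  set v := singularSeq T with hvdef
  -- The successive choice stops at the first zero vector, which signals that `T` vanishes on the
  -- remaining complement.
  let N : ℕ∞ := if h : ∃ n, v n = 0 then (Nat.find h : ℕ∞) else ⊤
  have hN : ∀ k : ℕ, (k : ℕ∞) < N → v k ≠ 0 := by
    intro k hk h0
    have hex : ∃ n, v n = 0 := ⟨k, h0⟩
    simp only [N, dif_pos hex] at hk
    exact Nat.find_min hex (by exact_mod_cast hk) h0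
  have hmax : ∀ k : ℕ, (k : ℕ∞) < N → IsMaximalSingularVector T (initialSpan v k) (v k) :=
    fun k hk => isMaximalSingularVector_singularSeq (hN k hk)
  choose! lam hsing hbd using fun k hk => (hmax k hk).2
  have hlt : ∀ {j k : ℕ}, j < k → (k : ℕ∞) < N → inner ℝ (v j) (v k) = 0 := fun hjk hk =>
    (Submodule.mem_orthogonal _ _).1 (hmax _ hk).1 _ (mem_initialSpan v hjk)
  have hortho : ∀ j k : ℕ, (j : ℕ∞) < N → (k : ℕ∞) < N → j ≠ k → inner ℝ (v j) (v k) = 0 := by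
    intro j k hj hk hjk
    rcases lt_or_gt_of_ne hjk with h | h
    · exact hlt h hk
    · rw [real_inner_comm]; exact hlt h hj
  have hsmall : ∀ μ w, IsSingularVector T μ w → ∃ n : ℕ, (n : ℕ∞) ≤ N ∧ ∃ c : ℝ, μ * c < 1 ∧
      ∀ u ∈ (initialSpan v n)ᗮ, ‖T u‖ ^ 2 ≤ c * ‖u‖ ^ 2 := by
    intro μ w hw
    by_cases hex : ∃ n, v n = 0
    · have hNe : N = (Nat.find hex : ℕ∞) := dif_pos hex
      refine ⟨Nat.find hex, hNe.ge, 0, by simp, fun u hu => ?_⟩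
      have hTu : T u = 0 := by
        by_contra hTu
        obtain ⟨w, hw, μ, hμ⟩ := exists_isSingularVector_of_map_ne_zero hT
          (fun k hk => hsing k (by rw [hNe]; exact_mod_cast hk)) ⟨u, hu, hTu⟩
        exact singularSeq_ne_zero ⟨hw, μ, hμ⟩ (Nat.find_spec hex)
      simp [hTu]
    · have hNe : N = ⊤ := dif_neg hex
      have htop : ∀ k : ℕ, (k : ℕ∞) < N := fun k => by rw [hNe]; exact ENat.natCast_lt_top k
      obtain ⟨n, hn⟩ := exists_lt_of_isCompactOperator hT (fun n => hsing n (htop n))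
        (fun m n hmn => hortho m n (htop m) (htop n) hmn) μ
      refine ⟨n, (htop n).le, (lam n)⁻¹, ?_, hbd n (htop n)⟩
      rwa [← div_eq_mul_inv, div_lt_one (hsing n (htop n)).pos]
  refine ⟨N, lam, v, hsing, ?_, ?_, ?_⟩
  · intro j k hjk hk
    have hj : (j : ℕ∞) < N := lt_of_le_of_lt (by exact_mod_cast hjk) hk
    -- `v k` competed in the maximization that selected `v j`.
    have h1 := hbd j hj (v k)
      (Submodule.orthogonal_le (initialSpan_mono v hjk) (hmax k hk).1)
    rw [(hsing k hk).norm_sq, ← mul_assoc] at h1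
    have h2 : 0 < ‖T (v k)‖ ^ 2 := by
      have h3 := (hsing k hk).norm_sq
      have h4 : 0 < ‖v k‖ ^ 2 := by have := norm_pos_iff.2 (hN k hk); positivity
      rw [h3] at h4
      exact (mul_pos_iff_of_pos_left (hsing k hk).pos).1 h4
    have h5 : 1 ≤ (lam j)⁻¹ * lam k := by
      by_contra h6
      nlinarith
    rw [← div_eq_inv_mul, le_div_iff₀ (hsing j hj).pos] at h5
    linarith
  · refine linearIndependent_of_ne_zero_of_inner_eq_zero (fun k => hN k k.2) ?_
    intro j k hjk
    exact hortho j k j.2 k.2 fun h => hjk (Subtype.ext h)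
  · intro μ w hw
    obtain ⟨n, hn, c, hc, hbound⟩ := hsmall μ w hw
    have hsn : ∀ k < n, (k : ℕ∞) < N := fun k hk => lt_of_lt_of_le (by exact_mod_cast hk) hn
    -- The component `r` of `w` orthogonal to the span satisfies `‖r‖² = μ ‖T r‖² ≤ μ c ‖r‖²` with
    -- `μ c < 1`, hence vanishes.
    have hwn : w ∈ initialSpan v n := by
      obtain ⟨p, hp, hr, -⟩ := exists_sub_mem_orthogonal_initialSpan v n w
      set r := w - p with hrdef
      have e1 : ‖r‖ ^ 2 = inner ℝ w r := by
        have : inner ℝ p r = 0 := (Submodule.mem_orthogonal _ _).1 hr _ hp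
        rw [← real_inner_self_eq_norm_sq, hrdef, inner_sub_left, ← hrdef, this, sub_zero]
      have e2 : inner ℝ (T w) (T r) = ‖T r‖ ^ 2 := by
        have h1 : inner ℝ (T p) (T r) = 0 :=
          inner_map_eq_zero_of_mem_initialSpan (fun k hk => hsing k (hsn k hk)) hp hr
        have h2 : T w = T p + T r := by rw [← map_add, hrdef, add_sub_cancel]
        rw [h2, inner_add_left, h1, zero_add, real_inner_self_eq_norm_sq]
      have e3 : ‖r‖ ^ 2 = μ * ‖T r‖ ^ 2 := by rw [e1, hw.2, e2]
      have e4 := mul_le_mul_of_nonneg_left (hbound r hr) hw.pos.le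
      rw [← e3, ← mul_assoc] at e4
      have e5 : ‖r‖ ^ 2 ≤ 0 := by nlinarith [sq_nonneg ‖r‖]
      have e6 : r = 0 := by
        rw [← norm_eq_zero, ← sq_eq_zero_iff]
        exact le_antisymm e5 (sq_nonneg _)
      rw [hrdef, sub_eq_zero] at e6
      rw [e6]; exact hp
    obtain ⟨a, ha⟩ := exists_sum_of_mem_initialSpan hwn
    rw [← ha]
    refine Submodule.sum_mem _ fun i _ => ?_
    by_cases hi : lam i = μ
    · exact Submodule.smul_mem _ _ (Submodule.subset_span ⟨i, ⟨hsn i i.2, hi⟩, rfl⟩)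
    · have h1 : inner ℝ w (v i) = 0 := hw.inner_eq_zero (hsing i (hsn i i.2)) (Ne.symm hi)
      have h2 : inner ℝ w (v i) = a i * ‖v i‖ ^ 2 := by
        rw [← ha, sum_inner, Finset.sum_eq_single i]
        · rw [real_inner_smul_left, real_inner_self_eq_norm_sq]
        · intro j _ hji
          rw [real_inner_smul_left, hortho j i (hsn j j.2) (hsn i i.2) fun h => hji (Fin.ext h),
            mul_zero]
        · simp
      have h3 : a i = 0 := by
        rw [h1] at h2
        have h4 : ‖v i‖ ^ 2 ≠ 0 := pow_ne_zero 2 (norm_ne_zero_iff.2 (hN i (hsn i i.2)))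
        exact (mul_eq_zero.1 h2.symm).resolve_right h4
      rw [h3, zero_smul]
      exact Submodule.zero_mem _

end Existence

/-! ### The energy form -/

section Energy

variable {d : ℕ}

theorem matForm_add_right (M : Matrix (Fin d) (Fin d) ℝ) (ξ η η' : Euc d) :
    matForm M ξ (η + η') = matForm M ξ η + matForm M ξ η' := by
  simp only [matForm, ← Finset.sum_add_distrib]
  refine Finset.sum_congr rfl fun i _ => Finset.sum_congr rfl fun j _ => ?_
  simp only [PiLp.add_apply]
  ring

theorem matForm_smul_right (M : Matrix (Fin d) (Fin d) ℝ) (c : ℝ) (ξ η : Euc d) :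
    matForm M ξ (c • η) = c * matForm M ξ η := by
  simp only [matForm, Finset.mul_sum]
  refine Finset.sum_congr rfl fun i _ => Finset.sum_congr rfl fun j _ => ?_
  simp only [PiLp.smul_apply, smul_eq_mul]
  ring

theorem matForm_comm {M : Matrix (Fin d) (Fin d) ℝ} (hM : M.IsSymm) (ξ η : Euc d) :
    matForm M ξ η = matForm M η ξ := by
  unfold matForm
  rw [Finset.sum_comm]
  refine Finset.sum_congr rfl fun i _ => Finset.sum_congr rfl fun j _ => ?_
  rw [hM.apply]
  ring

theorem abs_matForm_le (M : Matrix (Fin d) (Fin d) ℝ) (ξ η : Euc d) :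
    |matForm M ξ η| ≤ (∑ i, ∑ j, |M i j|) * (‖ξ‖ * ‖η‖) := by
  unfold matForm
  simp only [Finset.sum_mul]
  refine (Finset.abs_sum_le_sum_abs _ _).trans (Finset.sum_le_sum fun i _ =>
    (Finset.abs_sum_le_sum_abs _ _).trans (Finset.sum_le_sum fun j _ => ?_))
  rw [abs_mul, abs_mul, mul_assoc]
  exact mul_le_mul_of_nonneg_left (mul_le_mul (PiLp.norm_apply_le ξ j) (PiLp.norm_apply_le η i)
    (abs_nonneg _) (norm_nonneg _)) (abs_nonneg _)

variable {Ω U : Set (Euc d)} (A : EllipticCoefficient Ω)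

/-- The essential suprema of the finitely many entries bound the form off the diagonal too,
uniformly in both vectors on one set of full measure. -/
theorem EllipticCoefficient.exists_abs_matForm_le : ∃ K : ℝ, 0 ≤ K ∧
    ∀ᵐ x ∂(volume.restrict Ω), ∀ ξ η, |matForm (A.mat x) ξ η| ≤ K * (‖ξ‖ * ‖η‖) := by
  refine ⟨∑ i, ∑ j, (eLpNorm (fun x => A.mat x i j) ∞ (volume.restrict Ω)).toReal,
    Finset.sum_nonneg fun i _ => Finset.sum_nonneg fun j _ => ENNReal.toReal_nonneg, ?_⟩
  have h : ∀ᵐ x ∂(volume.restrict Ω), ∀ i j,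
      |A.mat x i j| ≤ (eLpNorm (fun x => A.mat x i j) ∞ (volume.restrict Ω)).toReal := by
    rw [ae_all_iff]
    intro i
    rw [ae_all_iff]
    intro j
    filter_upwards [ae_le_eLpNormEssSup (f := fun x => A.mat x i j) (μ := volume.restrict Ω)]
      with x hx
    rw [eLpNorm_exponent_top, ← Real.norm_eq_abs, ← toReal_enorm]
    refine ENNReal.toReal_mono ?_ hx
    rw [← eLpNorm_exponent_top]
    exact (A.memLp i j).2.ne
  filter_upwards [h] with x hx ξ η
  exact (abs_matForm_le _ _ _).trans (mul_le_mul_of_nonneg_right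
    (Finset.sum_le_sum fun i _ => Finset.sum_le_sum fun j _ => hx i j) (by positivity))

theorem exists_abs_energyForm_le (hU : U ⊆ Ω) : ∃ K : ℝ, 0 ≤ K ∧
    ∀ u v : L2Pair U, |energyForm A u v| ≤ K * (‖u.snd‖ * ‖v.snd‖) := by
  obtain ⟨K, hK0, hK⟩ := A.exists_abs_matForm_le
  refine ⟨K, hK0, fun u v => ?_⟩
  have hi : Integrable (fun x => ‖u.snd x‖ * ‖v.snd x‖) (volume.restrict U) :=
    (Lp.memLp u.snd).norm.integrable_mul (Lp.memLp v.snd).norm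
  have h1 : |energyForm A u v| ≤ ∫ x in U, K * (‖u.snd x‖ * ‖v.snd x‖) := by
    rw [energyForm, ← Real.norm_eq_abs]
    refine norm_integral_le_of_norm_le (hi.const_mul K) ?_
    filter_upwards [ae_restrict_of_ae_restrict_of_subset hU hK] with x hx using hx _ _
  have h2 : |∫ x in U, inner ℝ ‖u.snd x‖ ‖v.snd x‖| ≤ ‖u.snd‖ * ‖v.snd‖ := by
    have h := abs_integral_inner_le (E := ℝ) (Lp.memLp u.snd).norm (Lp.memLp v.snd).norm
    rwa [eLpNorm_norm, eLpNorm_norm, ← Lp.norm_def, ← Lp.norm_def] at h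
  rw [integral_const_mul] at h1
  refine h1.trans (mul_le_mul_of_nonneg_left ((le_abs_self _).trans ?_) hK0)
  refine le_trans (le_of_eq ?_) h2
  congr 1
  exact integral_congr_ae (.of_forall fun x => by simp [mul_comm])

theorem L2Pair.norm_fst_le (u : L2Pair U) : ‖u.fst‖ ≤ ‖u‖ := WithLp.norm_fst_le ..

theorem L2Pair.norm_snd_le (u : L2Pair U) : ‖u.snd‖ ≤ ‖u‖ := WithLp.norm_snd_le ..

theorem energyForm_add_left (hU : U ⊆ Ω) (u u' v : L2Pair U) :
    energyForm A (u + u') v = energyForm A u v + energyForm A u' v := by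
  unfold energyForm
  rw [← integral_add (integrable_matForm A hU (Lp.memLp _) (Lp.memLp _))
    (integrable_matForm A hU (Lp.memLp _) (Lp.memLp _))]
  apply integral_congr_ae
  filter_upwards [L2Pair.snd_add_ae u u'] with x hx
  rw [hx, matForm_add_left]

theorem energyForm_smul_left (c : ℝ) (u v : L2Pair U) :
    energyForm A (c • u) v = c * energyForm A u v := by
  unfold energyForm
  rw [← integral_const_mul]
  apply integral_congr_ae
  filter_upwards [L2Pair.snd_smul_ae c u] with x hx
  rw [hx, matForm_smul_left]

theorem energyForm_comm (hU : U ⊆ Ω) (u v : L2Pair U) : energyForm A u v = energyForm A v u := by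
  apply integral_congr_ae
  filter_upwards [ae_restrict_of_ae_restrict_of_subset hU A.symm] with x hx
  exact matForm_comm hx _ _

/-- The energy form as a bounded bilinear form. -/
noncomputable def energyCLM (hU : U ⊆ Ω) : L2Pair U →L[ℝ] L2Pair U →L[ℝ] ℝ :=
  LinearMap.mkContinuous₂
    (LinearMap.mk₂ ℝ (energyForm A) (energyForm_add_left A hU) (energyForm_smul_left A)
      (fun u v v' => by
        simp only [energyForm_comm A hU u, energyForm_add_left A hU])
      (fun c u v => by
        simp only [energyForm_comm A hU u, energyForm_smul_left, smul_eq_mul]))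
    (exists_abs_energyForm_le A hU).choose
    (fun u v => by
      have h := (exists_abs_energyForm_le A hU).choose_spec
      refine (h.2 u v).trans ?_
      rw [mul_assoc]
      exact mul_le_mul_of_nonneg_left (mul_le_mul u.norm_snd_le v.norm_snd_le (norm_nonneg _)
        (norm_nonneg _)) h.1)

theorem Lp_norm_sq_eq_integral {F : Type} [NormedAddCommGroup F] [InnerProductSpace ℝ F]
    {μ : Measure (Euc d)} (f : Lp F 2 μ) : ‖f‖ ^ 2 = ∫ x, ‖f x‖ ^ 2 ∂μ := by
  rw [← real_inner_self_eq_norm_sq, L2.inner_def]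
  simp_rw [real_inner_self_eq_norm_sq]

theorem exists_energyForm_bounds (hU : U ⊆ Ω) : ∃ α β : ℝ, 0 < α ∧ 0 < β ∧ ∀ u : L2Pair U,
    α * ‖u.snd‖ ^ 2 ≤ energyForm A u u ∧ energyForm A u u ≤ β * ‖u.snd‖ ^ 2 := by
  obtain ⟨α, β, hα, hαβ, hell⟩ := A.elliptic
  refine ⟨α, β, hα, hα.trans hαβ, fun u => ?_⟩
  have hi : Integrable (fun x => ‖u.snd x‖ ^ 2) (volume.restrict U) :=
    (Lp.memLp u.snd).integrable_norm_pow (by norm_num)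
  have hA := integrable_matForm A hU (Lp.memLp u.snd) (Lp.memLp u.snd)
  have hae := ae_restrict_of_ae_restrict_of_subset hU hell
  have e : ∀ ξ : Euc d, ∑ i, ξ i ^ 2 = ‖ξ‖ ^ 2 := fun ξ => by
    rw [EuclideanSpace.norm_sq_eq]
    simp
  simp only [e] at hae
  rw [Lp_norm_sq_eq_integral, ← integral_const_mul, ← integral_const_mul]
  constructor
  · refine integral_mono_ae (hi.const_mul α) hA ?_
    filter_upwards [hae] with x hx using (hx _).1
  · refine integral_mono_ae hA (hi.const_mul β) ?_
    filter_upwards [hae] with x hx using (hx _).2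

end Energy

/-! ### Closedness of the Sobolev spaces -/

section Closed

variable {d : ℕ} {U : Set (Euc d)}

theorem IsTestFunction.memLp_smul_const {φ : Euc d → ℝ} (hφ : IsTestFunction U φ) (e : Euc d) :
    MemLp (fun x => φ x • e) 2 (volume.restrict U) :=
  (hφ.smooth.continuous.smul continuous_const).memLp_of_hasCompactSupport hφ.compact.smul_right

/-- The pair against which the definition of the weak gradient tests. -/
noncomputable def IsTestFunction.weakPair {φ : Euc d → ℝ} (hφ : IsTestFunction U φ) (e : Euc d) :
    L2Pair U :=
  mkL2Pair (hφ.memLp_fderiv e) (hφ.memLp_smul_const e)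

/-- Written this way, membership is orthogonality to fixed elements of the Hilbert space, from which
closedness of `H1` is immediate. -/
theorem mem_H1_iff_inner (w : L2Pair U) : w ∈ H1 U ↔ ∀ (φ : Euc d → ℝ) (hφ : IsTestFunction U φ)
    (e : Euc d), inner ℝ w (hφ.weakPair e) = 0 := by
  refine forall_congr' fun φ => forall_congr' fun hφ => forall_congr' fun e => ?_
  rw [L2Pair.inner_eq]
  have h1 : ∫ x in U, inner ℝ (w.fst x) ((hφ.weakPair e).fst x)
      = ∫ x in U, w.fst x * fderiv ℝ φ x e := by
    apply integral_congr_ae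
    filter_upwards [mkL2Pair_fst_ae (hφ.memLp_fderiv e) (hφ.memLp_smul_const e)] with x hx
    rw [IsTestFunction.weakPair, hx]
    simp [mul_comm]
  have h2 : ∫ x in U, inner ℝ (w.snd x) ((hφ.weakPair e).snd x)
      = ∫ x in U, inner ℝ (w.snd x) e * φ x := by
    apply integral_congr_ae
    filter_upwards [mkL2Pair_snd_ae (hφ.memLp_fderiv e) (hφ.memLp_smul_const e)] with x hx
    rw [IsTestFunction.weakPair, hx, real_inner_smul_right, mul_comm]
  rw [h1, h2]
  constructor <;> intro h <;> linarith

theorem isClosed_H1 : IsClosed (H1 U : Set (L2Pair U)) := by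
  have : (H1 U : Set (L2Pair U)) = ⋂ (φ : Euc d → ℝ) (hφ : IsTestFunction U φ) (e : Euc d),
      {w | inner ℝ w (hφ.weakPair e) = 0} := by
    ext w
    rw [SetLike.mem_coe, mem_H1_iff_inner]
    simp only [mem_iInter]
    rfl
  rw [this]
  exact isClosed_iInter fun φ => isClosed_iInter fun hφ => isClosed_iInter fun e =>
    isClosed_eq (continuous_id.inner continuous_const) continuous_const

theorem isClosed_H10 : IsClosed (H10 U : Set (L2Pair U)) :=
  (testSpace U).isClosed_topologicalClosure

theorem H10_induction {p : L2Pair U → Prop} (hcl : IsClosed {w | p w})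
    (h : ∀ w ∈ testSpace U, p w) {w : L2Pair U} (hw : w ∈ H10 U) : p w := by
  have : (testSpace U : Set (L2Pair U)) ⊆ {w | p w} := h
  exact closure_minimal this hcl (by rwa [← Submodule.topologicalClosure_coe])

/-- The weak gradient is unique. -/
theorem HasWeakGrad.ae_eq (hU : IsOpen U) {u : Euc d → ℝ} {G G' : Euc d → Euc d}
    (hG : MemLp G 2 (volume.restrict U)) (hG' : MemLp G' 2 (volume.restrict U))
    (h : HasWeakGrad U u G) (h' : HasWeakGrad U u G') : G =ᵐ[volume.restrict U] G' := by
  have key : ∀ i : Fin d, ∀ᵐ x, x ∈ U → G x i - G' x i = 0 := by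
    intro i
    have hl : ∀ {H : Euc d → Euc d}, MemLp H 2 (volume.restrict U) →
        MemLp (fun x => H x i) 2 (volume.restrict U) := fun hH =>
      (EuclideanSpace.proj (𝕜 := ℝ) i).comp_memLp' hH
    have hi : ∀ (H : Euc d → Euc d) x, inner ℝ (H x) (EuclideanSpace.single i (1 : ℝ)) = H x i :=
      fun H x => by simp [EuclideanSpace.inner_single_right]
    have hloc : LocallyIntegrableOn (fun x => G x i - G' x i) U :=
      locallyIntegrableOn_of_locallyIntegrable_restrict
        (((hl hG).sub (hl hG')).locallyIntegrable (by norm_num))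
    refine hU.ae_eq_zero_of_integral_contDiff_smul_eq_zero hloc fun φ hφ hc hs => ?_
    have ht : IsTestFunction U φ := ⟨hφ, hc, hs⟩
    have h1 := h φ ht (EuclideanSpace.single i 1)
    have h2 := h' φ ht (EuclideanSpace.single i 1)
    rw [h1, neg_inj] at h2
    simp_rw [hi] at h2
    rw [← setIntegral_eq_integral_of_forall_compl_eq_zero (s := U) fun x hx => by
      rw [image_eq_zero_of_notMem_tsupport fun h => hx (hs h), zero_smul]]
    have e : ∫ x in U, φ x • (G x i - G' x i) = ∫ x in U, (G x i * φ x - G' x i * φ x) :=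
      integral_congr_ae (.of_forall fun x => by simp only [smul_eq_mul]; ring)
    have i1 : Integrable (fun x => G x i * φ x) (volume.restrict U) :=
      (hl hG).integrable_mul ht.memLp
    have i2 : Integrable (fun x => G' x i * φ x) (volume.restrict U) :=
      (hl hG').integrable_mul ht.memLp
    rw [e, integral_sub i1 i2, h2, sub_self]
  have key' := ae_all_iff.2 key
  rw [Filter.EventuallyEq, ae_restrict_iff' hU.measurableSet]
  filter_upwards [key'] with x hx hxU
  ext i
  exact sub_eq_zero.1 (hx i hxU)

/-- `testSpace` prescribes only the first component; uniqueness of the weak gradient identifies the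
second. -/
theorem exists_test_of_mem_testSpace (hU : IsOpen U) {w : L2Pair U} (hw : w ∈ testSpace U) :
    ∃ φ : Euc d → ℝ, IsTestFunction U φ ∧ w.fst =ᵐ[volume.restrict U] φ ∧
      w.snd =ᵐ[volume.restrict U] gradient φ := by
  obtain ⟨h1, φ, hφ, h2⟩ := hw
  refine ⟨φ, hφ, h2, ?_⟩
  refine HasWeakGrad.ae_eq hU (Lp.memLp _) hφ.memLp_gradient ?_
    (hasWeakGrad_of_contDiff U (hφ.smooth.of_le (by simp)))
  exact (mem_H1_iff.1 h1).congr (EventuallyEq.symm h2) .rfl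

theorem norm_fst_eq {w : L2Pair U} {f : Euc d → ℝ} (h : w.fst =ᵐ[volume.restrict U] f) :
    ‖w.fst‖ = (eLpNorm f 2 (volume.restrict U)).toReal := by
  rw [Lp.norm_def, eLpNorm_congr_ae h]

theorem norm_snd_eq {w : L2Pair U} {G : Euc d → Euc d} (h : w.snd =ᵐ[volume.restrict U] G) :
    ‖w.snd‖ = (eLpNorm G 2 (volume.restrict U)).toReal := by
  rw [Lp.norm_def, eLpNorm_congr_ae h]

/-- The Friedrichs inequality. -/
theorem exists_friedrichs [Nonempty (Fin d)] (hU : IsOpen U) (hb : Bornology.IsBounded U) :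
    ∃ C : ℝ, 0 < C ∧ ∀ w ∈ H10 U, ‖w.fst‖ ≤ C * ‖w.snd‖ := by
  obtain ⟨R, hR, hsub⟩ := hb.subset_ball_lt 0 (0 : Euc d)
  refine ⟨2 * R, by positivity, fun w hw => ?_⟩
  refine H10_induction (p := fun w => ‖w.fst‖ ≤ 2 * R * ‖w.snd‖) ?_ (fun w hw => ?_) hw
  · refine isClosed_le ?_ ?_
    · exact (WithLp.continuous_fst ..).norm
    · exact continuous_const.mul (WithLp.continuous_snd ..).norm
  obtain ⟨φ, hφ, h1, h2⟩ := exists_test_of_mem_testSpace hU hw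
  let i : Fin d := Classical.arbitrary _
  -- A shift by `2 R` moves every point of `U`, which lies in the ball of radius `R`, off the
  -- support of `φ`. On `U` the translation difference is thus `-φ`, and the ball of radius `4 R`
  -- contains the segments.
  let z : Euc d := EuclideanSpace.single i (2 * R)
  have hz : ‖z‖ = 2 * R := by simp [z, abs_of_pos hR]
  have hφ1 : ContDiff ℝ 1 φ := hφ.smooth.of_le (by simp)
  have hz1 : ∀ x ∈ U, ∀ t ∈ Icc (0 : ℝ) 1, x + t • z ∈ ball (0 : Euc d) (4 * R) := by
    intro x hx t ht
    have hx' := hsub hx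
    rw [mem_ball_zero_iff] at hx' ⊢
    refine (norm_add_le _ _).trans_lt ?_
    rw [norm_smul, hz, Real.norm_of_nonneg ht.1]
    nlinarith [ht.2]
  have hUb : U ⊆ ball (0 : Euc d) (4 * R) := hsub.trans (ball_subset_ball (by linarith))
  have hφB : IsTestFunction (ball (0 : Euc d) (4 * R)) φ :=
    ⟨hφ.smooth, hφ.compact, hφ.support_subset.trans hUb⟩
  have hT := HasWeakGrad.eLpNorm_translate_sub_le isOpen_ball measure_ball_lt_top hU hφB.memLp
    hφB.memLp_gradient (hasWeakGrad_of_contDiff _ hφ1) hz1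
  have hsupp : Function.support (gradient φ) ⊆ U := fun x hx => by
    by_contra h
    exact hx (gradient_eq_zero_of_notMem_tsupport fun h' => h (hφ.support_subset h'))
  rw [eLpNorm_restrict_eq_of_support_subset (hsupp.trans hUb),
    ← eLpNorm_restrict_eq_of_support_subset hsupp, ← norm_snd_eq h2, hz] at hT
  have e : eLpNorm (fun x => φ (x + z) - φ x) 2 (volume.restrict U)
      = eLpNorm φ 2 (volume.restrict U) := by
    rw [← eLpNorm_neg φ]
    refine eLpNorm_congr_ae ((ae_restrict_iff' hU.measurableSet).2 (.of_forall fun x hx => ?_))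
    have : φ (x + z) = 0 := by
      refine image_eq_zero_of_notMem_tsupport fun h => ?_
      have h3 := hsub (hφ.support_subset h)
      have h4 := hsub hx
      rw [mem_ball_zero_iff] at h3 h4
      have := norm_sub_le (x + z) x
      rw [add_sub_cancel_left, hz] at this
      linarith
    simp [this]
  rw [e] at hT
  change ‖w.fst‖ ≤ _
  rw [norm_fst_eq h1]
  exact ENNReal.toReal_le_of_le_ofReal (by positivity) hT

end Closed

/-! ### Restriction to subdomains -/

section Restriction

variable {d : ℕ} {U V : Set (Euc d)}

theorem L2Pair.ext_ae {w z : L2Pair U} (h1 : w.fst =ᵐ[volume.restrict U] z.fst)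
    (h2 : w.snd =ᵐ[volume.restrict U] z.snd) : w = z := by
  apply (WithLp.equiv 2 _).injective
  exact Prod.ext (Lp.ext h1) (Lp.ext h2)

theorem IsTestFunction.mono (hVU : V ⊆ U) {φ : Euc d → ℝ} (hφ : IsTestFunction V φ) :
    IsTestFunction U φ :=
  ⟨hφ.smooth, hφ.compact, hφ.support_subset.trans hVU⟩

theorem IsTestFunction.gradient_eq_zero {φ : Euc d → ℝ} (hφ : IsTestFunction V φ) {x : Euc d}
    (hx : x ∉ V) : gradient φ x = 0 :=
  gradient_eq_zero_of_notMem_tsupport fun h => hx (hφ.support_subset h)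

theorem HasWeakGrad.mono (hVU : V ⊆ U) {u : Euc d → ℝ} {G : Euc d → Euc d}
    (h : HasWeakGrad U u G) : HasWeakGrad V u G := by
  intro φ hφ e
  have h1 := h φ (hφ.mono hVU) e
  rw [(hφ.mono hVU).setIntegral_mul fun x => inner ℝ (G x) e,
    setIntegral_eq_integral_of_forall_compl_eq_zero] at h1
  · rwa [hφ.setIntegral_mul fun x => inner ℝ (G x) e,
      setIntegral_eq_integral_of_forall_compl_eq_zero]
    intro x hx
    rw [← inner_gradient_eq_fderiv, hφ.gradient_eq_zero hx, inner_zero_left, mul_zero]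
  · intro x hx
    rw [← inner_gradient_eq_fderiv, (hφ.mono hVU).gradient_eq_zero hx, inner_zero_left, mul_zero]

/-- The restriction of a pair to a smaller set. -/
noncomputable def L2Pair.restrict (hVU : V ⊆ U) (v : L2Pair U) : L2Pair V :=
  mkL2Pair ((Lp.memLp v.fst).mono_measure (Measure.restrict_mono hVU le_rfl))
    ((Lp.memLp v.snd).mono_measure (Measure.restrict_mono hVU le_rfl))

theorem L2Pair.restrict_fst_ae (hVU : V ⊆ U) (v : L2Pair U) :
    (v.restrict hVU).fst =ᵐ[volume.restrict V] v.fst := mkL2Pair_fst_ae _ _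

theorem L2Pair.restrict_snd_ae (hVU : V ⊆ U) (v : L2Pair U) :
    (v.restrict hVU).snd =ᵐ[volume.restrict V] v.snd := mkL2Pair_snd_ae _ _

theorem L2Pair.restrict_mem_H1 (hVU : V ⊆ U) {v : L2Pair U} (hv : v ∈ H1 U) :
    v.restrict hVU ∈ H1 V :=
  (mkL2Pair_mem_H1 _ _).2 ((mem_H1_iff.1 hv).mono hVU)

theorem L2Pair.norm_restrict_fst_le (hVU : V ⊆ U) (v : L2Pair U) :
    ‖(v.restrict hVU).fst‖ ≤ ‖v.fst‖ := by
  rw [norm_fst_eq (v.restrict_fst_ae hVU), Lp.norm_def]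
  exact ENNReal.toReal_mono (Lp.memLp v.fst).2.ne
    (eLpNorm_mono_measure _ (Measure.restrict_mono hVU le_rfl))

/-- `A`-harmonic functions are `A`-harmonic on open subsets. -/
theorem energyForm_restrict_eq_zero {Ω : Set (Euc d)} (A : EllipticCoefficient Ω) (hU : U ⊆ Ω)
    (hV : IsOpen V) (hVU : V ⊆ U) {v : L2Pair U} (hv : v ∈ HA A hU) {w : L2Pair V}
    (hw : w ∈ H10 V) : energyForm A (v.restrict hVU) w = 0 := by
  refine H10_induction (p := fun w => energyForm A (v.restrict hVU) w = 0) ?_ (fun w hw => ?_) hw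
  · exact isClosed_eq (energyCLM A (hVU.trans hU) (v.restrict hVU)).continuous continuous_const
  obtain ⟨φ, hφ, -, h2⟩ := exists_test_of_mem_testSpace hV hw
  have hφU := hφ.mono hVU
  have h0 := hv.2 _ (subset_closure hφU.mkL2Pair_mem_testSpace)
  have e1 : energyForm A v (mkL2Pair hφU.memLp hφU.memLp_gradient)
      = ∫ x in U, matForm (A.mat x) (v.snd x) (gradient φ x) := by
    apply integral_congr_ae
    filter_upwards [mkL2Pair_snd_ae hφU.memLp hφU.memLp_gradient] with x hx
    rw [hx]
  have e2 : energyForm A (v.restrict hVU) w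
      = ∫ x in V, matForm (A.mat x) (v.snd x) (gradient φ x) := by
    apply integral_congr_ae
    filter_upwards [h2, v.restrict_snd_ae hVU] with x hx hx'
    rw [hx, hx']
  have hz : ∀ x ∉ V, matForm (A.mat x) (v.snd x) (gradient φ x) = 0 := fun x hx => by
    rw [hφ.gradient_eq_zero hx]
    simp [matForm]
  rw [e1, setIntegral_eq_integral_of_forall_compl_eq_zero fun x hx => hz x fun h => hx (hVU h)]
    at h0
  change energyForm A (v.restrict hVU) w = 0
  rw [e2, setIntegral_eq_integral_of_forall_compl_eq_zero hz, h0]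

end Restriction

/-! ### Multiplication by the partition of unity function as an operator -/

namespace PUFunction

variable {d : ℕ} {U ω : Set (Euc d)} (χ : PUFunction ω)

theorem memLp_mul (hsub : ω ⊆ U) (v : L2Pair U) :
    MemLp (fun x => χ.toFun x * v.fst x) 2 (volume.restrict ω) := by
  refine ((Lp.memLp v.fst).mono_measure (Measure.restrict_mono hsub le_rfl)).of_le
    (χ.continuous.aestronglyMeasurable.mul
      ((Lp.stronglyMeasurable v.fst).aestronglyMeasurable)) (.of_forall fun x => ?_)
  rw [norm_mul]
  exact mul_le_of_le_one_left (norm_nonneg _) (χ.abs_le_one x)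

/-- The pair `(χ v, χ ∇v + v ∇χ)`. -/
noncomputable def mulPair (hω : IsOpen ω) (hfin : volume ω < ∞) (hsub : ω ⊆ U) (v : L2Pair U) :
    L2Pair ω :=
  mkL2Pair (χ.memLp_mul hsub v) (χ.memLp_grad_mul hω hfin hsub v)

theorem mulPair_fst_ae (hω : IsOpen ω) (hfin : volume ω < ∞) (hsub : ω ⊆ U) (v : L2Pair U) :
    (χ.mulPair hω hfin hsub v).fst =ᵐ[volume.restrict ω] fun x => χ.toFun x * v.fst x :=
  mkL2Pair_fst_ae _ _

theorem mulPair_snd_ae (hω : IsOpen ω) (hfin : volume ω < ∞) (hsub : ω ⊆ U) (v : L2Pair U) :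
    (χ.mulPair hω hfin hsub v).snd =ᵐ[volume.restrict ω]
      fun x => χ.toFun x • v.snd x + v.fst x • gradient χ.toFun x :=
  mkL2Pair_snd_ae _ _

theorem mulPair_mem_H10 (hω : IsOpen ω) (hb : Bornology.IsBounded ω) (hsub : ω ⊆ U) {v : L2Pair U}
    (hv : v ∈ H1 U) : χ.mulPair hω hb.measure_lt_top hsub v ∈ H10 ω := by
  refine χ.mul_mem_H10 hω hb (v.restrict_mem_H1 hsub hv) ?_ ?_
  · filter_upwards [χ.mulPair_fst_ae hω hb.measure_lt_top hsub v, v.restrict_fst_ae hsub]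
      with x h1 h2
    rw [h1, h2]
  · filter_upwards [χ.mulPair_snd_ae hω hb.measure_lt_top hsub v, v.restrict_fst_ae hsub,
      v.restrict_snd_ae hsub] with x h1 h2 h3
    rw [h1, h2, h3]

theorem exists_norm_mulPair_le (hω : IsOpen ω) (hfin : volume ω < ∞) (hsub : ω ⊆ U) :
    ∃ C : ℝ, ∀ v : L2Pair U, ‖χ.mulPair hω hfin hsub v‖ ≤ C * ‖v‖ := by
  obtain ⟨C, hC⟩ := χ.gradient_bounded
  refine ⟨1 + (1 + |C|), fun v => ?_⟩
  have hr1 := v.norm_restrict_fst_le hsub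
  have h1 : ‖(χ.mulPair hω hfin hsub v).fst‖ ≤ ‖v.fst‖ := by
    refine le_trans ?_ hr1
    refine Lp.norm_le_norm_of_ae_le ?_
    filter_upwards [χ.mulPair_fst_ae hω hfin hsub v, v.restrict_fst_ae hsub] with x h1 h2
    rw [h1, h2, norm_mul]
    exact mul_le_of_le_one_left (norm_nonneg _) (χ.abs_le_one x)
  have h2 : ‖(χ.mulPair hω hfin hsub v).snd‖ ≤ ‖v.snd‖ + |C| * ‖v.fst‖ := by
    have hm1 : MemLp (fun x => ‖v.snd x‖) 2 (volume.restrict ω) :=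
      ((Lp.memLp v.snd).mono_measure (Measure.restrict_mono hsub le_rfl)).norm
    have hm2 : MemLp (fun x => |C| * ‖v.fst x‖) 2 (volume.restrict ω) :=
      ((Lp.memLp v.fst).mono_measure (Measure.restrict_mono hsub le_rfl)).norm.const_mul _
    have e : ‖(χ.mulPair hω hfin hsub v).snd‖ ≤ ‖hm1.toLp _ + hm2.toLp _‖ := by
      refine Lp.norm_le_norm_of_ae_le ?_
      filter_upwards [χ.mulPair_snd_ae hω hfin hsub v, Lp.coeFn_add (hm1.toLp _) (hm2.toLp _),
        hm1.coeFn_toLp, hm2.coeFn_toLp, ae_restrict_mem hω.measurableSet] with x h1 h2 h3 h4 hx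
      rw [h1, h2, Pi.add_apply, h3, h4, Real.norm_of_nonneg (by positivity)]
      refine (norm_add_le _ _).trans (add_le_add ?_ ?_)
      · rw [norm_smul]
        exact mul_le_of_le_one_left (norm_nonneg _) (χ.abs_le_one x)
      · rw [norm_smul, mul_comm]
        exact mul_le_mul_of_nonneg_right ((hC x hx).trans (le_abs_self C)) (norm_nonneg _)
    refine e.trans ((norm_add_le _ _).trans (add_le_add ?_ ?_))
    · rw [Lp.norm_toLp, eLpNorm_norm, Lp.norm_def]
      exact ENNReal.toReal_mono (Lp.memLp v.snd).2.ne
        (eLpNorm_mono_measure _ (Measure.restrict_mono hsub le_rfl))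
    · rw [Lp.norm_toLp, Lp.norm_def]
      change (eLpNorm (|C| • fun x => ‖v.fst x‖) 2 _).toReal ≤ _
      rw [eLpNorm_const_smul, eLpNorm_norm, ENNReal.toReal_mul, toReal_enorm, Real.norm_eq_abs,
        abs_abs]
      exact mul_le_mul_of_nonneg_left (ENNReal.toReal_mono (Lp.memLp v.fst).2.ne
        (eLpNorm_mono_measure _ (Measure.restrict_mono hsub le_rfl))) (abs_nonneg _)
  have h3 := v.norm_fst_le
  have h4 := v.norm_snd_le
  refine (L2Pair.norm_le_add _).trans ?_
  nlinarith [abs_nonneg C]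

/-- `v ↦ (χ v, χ ∇v + v ∇χ)` as a bounded operator. -/
noncomputable def mulCLM (hω : IsOpen ω) (hfin : volume ω < ∞) (hsub : ω ⊆ U) :
    L2Pair U →L[ℝ] L2Pair ω :=
  LinearMap.mkContinuous
    { toFun := χ.mulPair hω hfin hsub
      map_add' := fun v w => by
        refine L2Pair.ext_ae ?_ ?_
        · filter_upwards [χ.mulPair_fst_ae hω hfin hsub v, χ.mulPair_fst_ae hω hfin hsub w,
            χ.mulPair_fst_ae hω hfin hsub (v + w),
            L2Pair.fst_add_ae (χ.mulPair hω hfin hsub v) (χ.mulPair hω hfin hsub w),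
            ae_restrict_of_ae_restrict_of_subset hsub (L2Pair.fst_add_ae v w)] with x h1 h2 h3 h4 h5
          rw [h3, h4, h1, h2, h5, mul_add]
        · filter_upwards [χ.mulPair_snd_ae hω hfin hsub v, χ.mulPair_snd_ae hω hfin hsub w,
            χ.mulPair_snd_ae hω hfin hsub (v + w),
            L2Pair.snd_add_ae (χ.mulPair hω hfin hsub v) (χ.mulPair hω hfin hsub w),
            ae_restrict_of_ae_restrict_of_subset hsub (L2Pair.fst_add_ae v w),
            ae_restrict_of_ae_restrict_of_subset hsub (L2Pair.snd_add_ae v w)]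
            with x h1 h2 h3 h4 h5 h6
          rw [h3, h4, h1, h2, h5, h6]
          module
      map_smul' := fun c v => by
        refine L2Pair.ext_ae ?_ ?_
        · filter_upwards [χ.mulPair_fst_ae hω hfin hsub v, χ.mulPair_fst_ae hω hfin hsub (c • v),
            L2Pair.fst_smul_ae c (χ.mulPair hω hfin hsub v),
            ae_restrict_of_ae_restrict_of_subset hsub (L2Pair.fst_smul_ae c v)] with x h1 h2 h3 h4
          rw [h2, RingHom.id_apply, h3, h1, h4]
          ring
        · filter_upwards [χ.mulPair_snd_ae hω hfin hsub v, χ.mulPair_snd_ae hω hfin hsub (c • v),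
            L2Pair.snd_smul_ae c (χ.mulPair hω hfin hsub v),
            ae_restrict_of_ae_restrict_of_subset hsub (L2Pair.fst_smul_ae c v),
            ae_restrict_of_ae_restrict_of_subset hsub (L2Pair.snd_smul_ae c v)] with x h1 h2 h3 h4 h5
          rw [h2, RingHom.id_apply, h3, h1, h4, h5]
          module }
    (χ.exists_norm_mulPair_le hω hfin hsub).choose
    (χ.exists_norm_mulPair_le hω hfin hsub).choose_spec

@[simp] theorem mulCLM_apply (hω : IsOpen ω) (hfin : volume ω < ∞) (hsub : ω ⊆ U) (v : L2Pair U) :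
    χ.mulCLM hω hfin hsub v = χ.mulPair hω hfin hsub v := rfl

theorem memLp_two (hfin : volume ω < ∞) : MemLp χ.toFun 2 (volume.restrict ω) := by
  have : IsFiniteMeasure (volume.restrict ω) := ⟨by simpa using hfin⟩
  exact MemLp.of_bound χ.continuous.aestronglyMeasurable 1 (.of_forall χ.abs_le_one)

/-- The pair `(χ, ∇χ)`. -/
noncomputable def pair (hω : IsOpen ω) (hfin : volume ω < ∞) : L2Pair ω :=
  mkL2Pair (χ.memLp_two hfin) (χ.memLp_gradient hω 2 hfin)

theorem pair_fst_ae (hω : IsOpen ω) (hfin : volume ω < ∞) :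
    (χ.pair hω hfin).fst =ᵐ[volume.restrict ω] χ.toFun := mkL2Pair_fst_ae _ _

theorem pair_snd_ae (hω : IsOpen ω) (hfin : volume ω < ∞) :
    (χ.pair hω hfin).snd =ᵐ[volume.restrict ω] gradient χ.toFun := mkL2Pair_snd_ae _ _

/-- `χ` is its own product with the constant `1`, an `H¹` function because `ω` is bounded. -/
theorem pair_mem_H10 (hω : IsOpen ω) (hb : Bornology.IsBounded ω) :
    χ.pair hω hb.measure_lt_top ∈ H10 ω := by
  have : IsFiniteMeasure (volume.restrict ω) := ⟨by simpa using hb.measure_lt_top⟩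
  have h1 : MemLp (fun _ : Euc d => (1 : ℝ)) 2 (volume.restrict ω) := memLp_const 1
  have h2 : MemLp (fun _ : Euc d => (0 : Euc d)) 2 (volume.restrict ω) := memLp_const 0
  have hmem : mkL2Pair h1 h2 ∈ H1 ω := by
    rw [mkL2Pair_mem_H1]
    convert hasWeakGrad_of_contDiff ω (contDiff_const (c := (1 : ℝ))) using 2 with x
    simp [gradient]
  refine χ.mul_mem_H10 hω hb hmem ?_ ?_
  · filter_upwards [mkL2Pair_fst_ae h1 h2, χ.pair_fst_ae hω hb.measure_lt_top] with x h1 h2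
    rw [h1, h2, mul_one]
  · filter_upwards [mkL2Pair_fst_ae h1 h2, mkL2Pair_snd_ae h1 h2,
      χ.pair_snd_ae hω hb.measure_lt_top] with x h1 h2 h3
    rw [h1, h2, h3]
    simp

/-- This is the denominator of the mean. If it were not positive, `∇χ` would vanish, hence `χ` would
vanish almost everywhere by the Friedrichs inequality, whereas a continuous `χ` that is not
identically zero is nonzero on a nonempty open set. -/
theorem energyForm_pair_pos [Nonempty (Fin d)] {Ω : Set (Euc d)} (A : EllipticCoefficient Ω)
    (hωΩ : ω ⊆ Ω) (hω : IsOpen ω) (hb : Bornology.IsBounded ω) :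
    0 < energyForm A (χ.pair hω hb.measure_lt_top) (χ.pair hω hb.measure_lt_top) := by
  set X := χ.pair hω hb.measure_lt_top with hX
  obtain ⟨α, β, hα, -, hab⟩ := exists_energyForm_bounds A hωΩ
  obtain ⟨C, hC0, hC⟩ := exists_friedrichs hω hb
  by_contra hcon
  have h1 : X.snd = 0 := by
    have := (hab X).1
    have h2 : ‖X.snd‖ ^ 2 ≤ 0 := by
      by_contra h
      push Not at h
      nlinarith [mul_pos hα h]
    exact norm_eq_zero.1 (pow_eq_zero_iff two_ne_zero |>.1 (le_antisymm h2 (sq_nonneg _)))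
  have h2 : X.fst = 0 := by
    have := hC X (χ.pair_mem_H10 hω hb)
    rw [h1, norm_zero, mul_zero] at this
    exact norm_le_zero_iff.1 this
  obtain ⟨x₀, hx₀⟩ := χ.ne_zero
  let V : Set (Euc d) := {x | χ.toFun x ≠ 0}
  have hVo : IsOpen V := isOpen_ne_fun χ.continuous continuous_const
  have hVω : V ⊆ ω := fun x hx => by
    by_contra h
    exact hx (χ.eq_zero x h)
  have h3 : ∀ᵐ x ∂(volume.restrict ω), χ.toFun x = 0 := by
    have h0 := Lp.coeFn_zero ℝ 2 (volume.restrict ω)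
    rw [← h2] at h0
    filter_upwards [h0, χ.pair_fst_ae hω hb.measure_lt_top] with x h4 h5
    rw [← h5]
    exact h4
  have h4 : volume V = 0 := by
    rw [ae_restrict_iff' hω.measurableSet] at h3
    refine measure_mono_null (fun x hx => ?_) (ae_iff.1 h3)
    simp only [mem_ofPred_eq, Classical.not_imp]
    exact ⟨hVω hx, hx⟩
  exact (hVo.measure_pos volume ⟨x₀, hx₀⟩).ne' h4

/-- `a(χ v, χ φ) = ∫ (A∇χ·∇χ) v φ` for `A`-harmonic functions `v`, `φ`. -/
theorem energyForm_mulPair {Ω : Set (Euc d)} (A : EllipticCoefficient Ω) (hU : U ⊆ Ω)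
    (hω : IsOpen ω) (hb : Bornology.IsBounded ω) (hsub : ω ⊆ U) {v φ : L2Pair U}
    (hv : v ∈ HA A hU) (hφ : φ ∈ HA A hU) :
    energyForm A (χ.mulPair hω hb.measure_lt_top hsub v) (χ.mulPair hω hb.measure_lt_top hsub φ)
      = ∫ x in ω, matForm (A.mat x) (gradient χ.toFun x) (gradient χ.toFun x)
          * v.fst x * φ.fst x := by
  have hfin : volume ω < ∞ := hb.measure_lt_top
  have hωΩ := hsub.trans hU
  -- The equation for `v` is tested with `χ²φ` and that for `φ` with `χ²v`. By symmetry of `A`,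
  -- pointwise `A∇(χv)·∇(χφ) = ½ A∇v·∇(χ²φ) + ½ A∇φ·∇(χ²v) + (A∇χ·∇χ) vφ`, and the first two terms
  -- integrate to zero.
  have z1 := energyForm_restrict_eq_zero A hU hω hsub hv
    ((χ.sq hω).mulPair_mem_H10 hω hb hsub hφ.1)
  have z2 := energyForm_restrict_eq_zero A hU hω hsub hφ
    ((χ.sq hω).mulPair_mem_H10 hω hb hsub hv.1)
  have hi : ∀ p q : L2Pair ω, Integrable (fun x => matForm (A.mat x) (p.snd x) (q.snd x))
      (volume.restrict ω) := fun p q => integrable_matForm A hωΩ (Lp.memLp _) (Lp.memLp _)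
  have hi' : ∀ p q r s : L2Pair ω, Integrable (fun x => 1 / 2 * matForm (A.mat x) (p.snd x)
      (q.snd x) + 1 / 2 * matForm (A.mat x) (r.snd x) (s.snd x)) (volume.restrict ω) :=
    fun p q r s => ((hi p q).const_mul _).add ((hi r s).const_mul _)
  have e : energyForm A (χ.mulPair hω hfin hsub v) (χ.mulPair hω hfin hsub φ)
      - (1 / 2 * energyForm A (v.restrict hsub) ((χ.sq hω).mulPair hω hfin hsub φ)
        + 1 / 2 * energyForm A (φ.restrict hsub) ((χ.sq hω).mulPair hω hfin hsub v))
      = ∫ x in ω, matForm (A.mat x) (gradient χ.toFun x) (gradient χ.toFun x)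
          * v.fst x * φ.fst x := by
    unfold energyForm
    rw [← integral_const_mul, ← integral_const_mul,
      ← integral_add ((hi _ _).const_mul _) ((hi _ _).const_mul _),
      ← integral_sub (hi _ _) (hi' _ _ _ _)]
    apply integral_congr_ae
    filter_upwards [χ.mulPair_snd_ae hω hfin hsub v, χ.mulPair_snd_ae hω hfin hsub φ,
      (χ.sq hω).mulPair_snd_ae hω hfin hsub v, (χ.sq hω).mulPair_snd_ae hω hfin hsub φ,
      v.restrict_snd_ae hsub, φ.restrict_snd_ae hsub, ae_restrict_mem hω.measurableSet,
      ae_restrict_of_ae_restrict_of_subset hωΩ A.symm] with x h1 h2 h3 h4 h5 h6 hx hs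
    rw [h1, h2, h3, h4, h5, h6, χ.gradient_sq hω hx]
    have hsq : (χ.sq hω).toFun x = χ.toFun x * χ.toFun x := rfl
    rw [hsq]
    simp only [matForm_add_left, matForm_add_right, matForm_smul_left, matForm_smul_right]
    rw [matForm_comm hs (φ.snd x) (v.snd x), matForm_comm hs (φ.snd x) (gradient χ.toFun x)]
    rw [matForm_comm hs (v.snd x) (gradient χ.toFun x)]
    ring
  rw [z1, z2] at e
  linarith

end PUFunction

/-! ### Functions with vanishing weak gradient -/

section Constant

variable {d : ℕ} {U : Set (Euc d)}

/-- With zero gradient the translation estimate gives, for each small `z`, that `u (y + z) = u y`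
for almost every `y`. Fubini yields a single `y` for which this holds for almost every `z`, and the
points `y + z` cover the ball of radius `r / 2`. -/
theorem exists_ae_eq_const_of_ball {x₀ : Euc d} {r : ℝ} (hr : 0 < r) {u : Euc d → ℝ}
    (hum : StronglyMeasurable u) (hu : MemLp u 2 (volume.restrict (ball x₀ (2 * r))))
    (h : HasWeakGrad (ball x₀ (2 * r)) u fun _ => 0) :
    ∃ c : ℝ, ∀ᵐ x ∂(volume.restrict (ball x₀ (r / 2))), u x = c := by
  have h1 : ∀ᵐ z ∂(volume.restrict (ball (0 : Euc d) r)),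
      ∀ᵐ y ∂(volume.restrict (ball x₀ (r / 2))), u (y + z) = u y := by
    rw [ae_restrict_iff' measurableSet_ball]
    refine .of_forall fun z hz => ?_
    have hz0 : ∀ x ∈ ball x₀ (r / 2), ∀ t ∈ Icc (0 : ℝ) 1, x + t • z ∈ ball x₀ (2 * r) := by
      intro x hx t ht
      rw [mem_ball_zero_iff] at hz
      rw [mem_ball, dist_eq_norm] at hx ⊢
      have : ‖t • z‖ ≤ ‖z‖ := by
        rw [norm_smul, Real.norm_of_nonneg ht.1]
        exact mul_le_of_le_one_left (norm_nonneg _) ht.2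
      have h2 := norm_add_le (x - x₀) (t • z)
      rw [show x + t • z - x₀ = x - x₀ + t • z by abel]
      linarith
    have hT := HasWeakGrad.eLpNorm_translate_sub_le isOpen_ball measure_ball_lt_top isOpen_ball
      hu MemLp.zero' h hz0
    simp only [eLpNorm_zero', ENNReal.toReal_zero, mul_zero, ENNReal.ofReal_zero,
      nonpos_iff_eq_zero] at hT
    have hm : StronglyMeasurable fun x => u (x + z) - u x :=
      (hum.comp_measurable (measurable_id.add_const z)).sub hum
    rw [eLpNorm_eq_zero_iff hm.aestronglyMeasurable two_ne_zero] at hT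
    filter_upwards [hT] with y hy
    exact sub_eq_zero.1 hy
  have hmeas : MeasurableSet {p : Euc d × Euc d | u (p.2 + p.1) = u p.2} :=
    measurableSet_eq_fun (hum.measurable.comp (measurable_snd.add measurable_fst))
      (hum.measurable.comp measurable_snd)
  rw [Measure.ae_ae_comm hmeas] at h1
  have : (ae (volume.restrict (ball x₀ (r / 2)))).NeBot := by
    rw [ae_neBot, Ne, Measure.restrict_eq_zero]
    exact (measure_ball_pos volume x₀ (by positivity)).ne'
  obtain ⟨y, hy, hyb⟩ := (h1.and (ae_restrict_mem measurableSet_ball)).exists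
  refine ⟨u y, ?_⟩
  rw [ae_restrict_iff' measurableSet_ball] at hy ⊢
  have hq := (measurePreserving_sub_right (volume : Measure (Euc d)) y).quasiMeasurePreserving.ae hy
  filter_upwards [hq] with x hx hxb
  have : x - y ∈ ball (0 : Euc d) r := by
    rw [mem_ball_zero_iff, ← dist_eq_norm]
    rw [mem_ball] at hxb hyb
    have := dist_triangle_right x y x₀
    linarith
  simpa using hx this

/-- A function with vanishing weak gradient on a connected open set is constant. -/
theorem exists_ae_eq_const (hU : IsOpen U) (hc : IsPreconnected U) {v : L2Pair U} (hv : v ∈ H1 U)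
    (h0 : v.snd = 0) : ∃ c : ℝ, ∀ᵐ x ∂(volume.restrict U), v.fst x = c := by
  have hw : HasWeakGrad U v.fst fun _ => 0 := by
    refine (mem_H1_iff.1 hv).congr .rfl ?_
    rw [h0]
    exact (Lp.coeFn_zero _ _ _).symm
  have hloc : ∀ x : U, ∃ c r : ℝ, 0 < r ∧ ball (x : Euc d) r ⊆ U ∧
      ∀ᵐ y ∂(volume.restrict (ball (x : Euc d) r)), v.fst y = c := by
    intro x
    obtain ⟨r, hr, hsub⟩ := Metric.isOpen_iff.1 hU x x.2
    have hsub' : ball (x : Euc d) (2 * (r / 2)) ⊆ U := by rwa [mul_div_cancel₀ r two_ne_zero]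
    obtain ⟨c, hcc⟩ := exists_ae_eq_const_of_ball (half_pos hr) (Lp.stronglyMeasurable v.fst)
      ((Lp.memLp v.fst).mono_measure (Measure.restrict_mono hsub' le_rfl)) (hw.mono hsub')
    exact ⟨c, r / 2 / 2, by positivity, (ball_subset_ball (by linarith)).trans hsub, hcc⟩
  choose c r hr hsub hae using hloc
  -- Overlapping balls share a set of positive measure, so their constants agree; the constant is
  -- then a locally constant function on the connected set `U`.
  have hoverlap : ∀ x y : U, (ball (x : Euc d) (r x) ∩ ball (y : Euc d) (r y)).Nonempty →
      c x = c y := by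
    intro x y hne
    have hpos := (isOpen_ball.inter isOpen_ball).measure_pos volume hne
    have h1 := ae_restrict_of_ae_restrict_of_subset (inter_subset_left) (hae x)
      (s := ball (x : Euc d) (r x) ∩ ball (y : Euc d) (r y))
    have h2 := ae_restrict_of_ae_restrict_of_subset (inter_subset_right) (hae y)
      (s := ball (x : Euc d) (r x) ∩ ball (y : Euc d) (r y))
    have : (ae (volume.restrict (ball (x : Euc d) (r x) ∩ ball (y : Euc d) (r y)))).NeBot := by
      rw [ae_neBot, Ne, Measure.restrict_eq_zero]
      exact hpos.ne'
    obtain ⟨z, hz1, hz2⟩ := (h1.and h2).exists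
    rw [← hz1, hz2]
  have hlc : IsLocallyConstant c := by
    rw [IsLocallyConstant.iff_exists_open]
    refine fun x => ⟨Subtype.val ⁻¹' ball (x : Euc d) (r x), isOpen_ball.preimage
      continuous_subtype_val, mem_ball_self (hr x), fun y hy => hoverlap y x ⟨y, ?_, hy⟩⟩
    exact mem_ball_self (hr y)
  rcases U.eq_empty_or_nonempty with rfl | ⟨x₀, hx₀⟩
  · exact ⟨0, by simp⟩
  have : PreconnectedSpace U := isPreconnected_iff_preconnectedSpace.1 hc
  refine ⟨c ⟨x₀, hx₀⟩, ?_⟩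
  rw [ae_restrict_iff' hU.measurableSet, ae_iff]
  refine measure_null_of_locally_null _ fun x hx => ?_
  simp only [mem_ofPred_eq, Classical.not_imp] at hx
  let x' : U := ⟨x, hx.1⟩
  refine ⟨_, inter_mem_nhdsWithin _ (ball_mem_nhds x (hr x')), ?_⟩
  have h1 := hae x'
  rw [ae_restrict_iff' measurableSet_ball, ae_iff] at h1
  refine measure_mono_null ?_ h1
  rintro y ⟨hy, hyb⟩
  simp only [mem_ofPred_eq, Classical.not_imp] at hy ⊢
  refine ⟨hyb, ?_⟩
  rw [hlc.apply_eq_of_preconnectedSpace x' ⟨x₀, hx₀⟩]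
  exact hy.2

end Constant

/-! ### The space of harmonic functions with vanishing mean -/

section HarmonicSpace

variable {d : ℕ} {Ω ωs ω : Set (Euc d)} (h : IsOversampling Ω ωs ω)
  (A : EllipticCoefficient Ω) (χ : PUFunction ω)

theorem IsOversampling.isBounded {Ω ωs ω : Set (Euc d)} (h : IsOversampling Ω ωs ω) :
    Bornology.IsBounded ω :=
  h.oversampling.isBounded.subset h.subset

/-- In this form the mean is visibly continuous in `v`, and its value on constants can be read off.
-/
theorem chiMean_eq (v : L2Pair ωs) : chiMean A χ v
    = energyForm A (χ.mulCLM h.isOpen h.volume_lt_top h.subset v)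
        (χ.pair h.isOpen h.volume_lt_top)
      / energyForm A (χ.pair h.isOpen h.volume_lt_top) (χ.pair h.isOpen h.volume_lt_top) := by
  unfold chiMean energyForm
  congr 1
  · apply integral_congr_ae
    filter_upwards [χ.mulPair_snd_ae h.isOpen h.volume_lt_top h.subset v,
      χ.pair_snd_ae h.isOpen h.volume_lt_top] with x h1 h2
    rw [PUFunction.mulCLM_apply, h1, h2]
  · apply integral_congr_ae
    filter_upwards [χ.pair_snd_ae h.isOpen h.volume_lt_top] with x h2
    rw [h2]

theorem isClosed_HA0 : IsClosed (HA0 h A χ : Set (L2Pair ωs)) := by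
  have : (HA0 h A χ : Set (L2Pair ωs)) = ((H1 ωs : Set (L2Pair ωs)) ∩
      ⋂ φ ∈ H10 ωs, {v | energyForm A v φ = 0}) ∩ {v | chiMean A χ v = 0} := by
    ext v
    simp only [mem_inter_iff, mem_iInter]
    rfl
  rw [this]
  refine (isClosed_H1.inter (isClosed_biInter fun φ _ => ?_)).inter ?_
  · simp_rw [energyForm_comm A h.subset_domain _ φ]
    exact isClosed_eq (energyCLM A h.subset_domain φ).continuous continuous_const
  · simp_rw [chiMean_eq h A χ,
      energyForm_comm A (h.subset.trans h.subset_domain) _ (χ.pair h.isOpen h.volume_lt_top)]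
    exact isClosed_eq (((energyCLM A (h.subset.trans h.subset_domain) _).continuous.comp
      (ContinuousLinearMap.continuous _)).div_const _) continuous_const

instance : CompleteSpace (HA0 h A χ) := (isClosed_HA0 h A χ).completeSpace_coe

instance : CompleteSpace (H10 ω) := isClosed_H10.completeSpace_coe

/-- A function in `H_{A,0}` with vanishing gradient is zero. -/
theorem eq_zero_of_snd_eq_zero [Nonempty (Fin d)] (v : HA0 h A χ) (hv : (v : L2Pair ωs).snd = 0) :
    v = 0 := by
  obtain ⟨c, hc⟩ := exists_ae_eq_const h.oversampling.isOpen h.oversampling.isConnected.isPreconnected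
    v.2.1.1 hv
  set X := χ.pair h.isOpen h.volume_lt_top with hX
  have hpos : 0 < energyForm A X X :=
    χ.energyForm_pair_pos A (h.subset.trans h.subset_domain) h.isOpen h.isBounded
  have h0 : ∀ᵐ x ∂(volume.restrict ωs), (v : L2Pair ωs).snd x = 0 := by
    rw [hv]
    exact Lp.coeFn_zero _ _ _
  -- The mean `𝓜_ω` of the constant `c` is `c` itself, so vanishing mean forces `c = 0`.
  have h1 : energyForm A (χ.mulCLM h.isOpen h.volume_lt_top h.subset (v : L2Pair ωs)) X
      = c * energyForm A X X := by
    unfold energyForm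
    rw [← integral_const_mul]
    apply integral_congr_ae
    filter_upwards [χ.mulPair_snd_ae h.isOpen h.volume_lt_top h.subset (v : L2Pair ωs),
      χ.pair_snd_ae h.isOpen h.volume_lt_top, ae_restrict_of_ae_restrict_of_subset h.subset hc,
      ae_restrict_of_ae_restrict_of_subset h.subset h0] with x h1 h2 h3 h4
    rw [PUFunction.mulCLM_apply, h1, h2, h3, h4, smul_zero, zero_add, matForm_smul_left]
  have h2 := v.2.2
  rw [chiMean_eq h A χ, h1, mul_div_assoc, div_self hpos.ne', mul_one] at h2
  apply Subtype.ext
  refine L2Pair.ext_ae ?_ ?_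
  · filter_upwards [hc, L2Pair.fst_zero_ae ωs] with x h3 h4
    rw [h3, h2]
    exact h4.symm
  · filter_upwards [h0, L2Pair.snd_zero_ae ωs] with x h3 h4
    rw [h3]
    exact h4.symm

/-- The inclusion of `H_{A,0}` into `L²`. -/
noncomputable def fstCLM : HA0 h A χ →L[ℝ] Lp ℝ 2 (volume.restrict ωs) :=
  (WithLp.fstL 2 ℝ (Lp ℝ 2 (volume.restrict ωs)) (Lp (Euc d) 2 (volume.restrict ωs))).comp
    (HA0 h A χ).subtypeL

theorem fstCLM_apply (v : HA0 h A χ) : fstCLM h A χ v = (v : L2Pair ωs).fst := rfl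

/-- The gradient on `H_{A,0}`. -/
noncomputable def sndCLM : HA0 h A χ →L[ℝ] Lp (Euc d) 2 (volume.restrict ωs) :=
  (WithLp.sndL 2 ℝ (Lp ℝ 2 (volume.restrict ωs)) (Lp (Euc d) 2 (volume.restrict ωs))).comp
    (HA0 h A χ).subtypeL

/-- Integration over each of the finitely many sets of `exists_finite_means` is a bounded
functional, and on their common kernel the `L²` norm is at most `ε` times the `H¹` norm. -/
theorem isCompactOperator_fstCLM : IsCompactOperator (fstCLM h A χ) := by
  refine isCompactOperator_of_small_on_finite_codim _ fun ε hε => ?_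
  obtain ⟨S, hSf, hS, hmean⟩ := h.oversampling.exists_finite_means hε
  have hfinU : volume ωs < ∞ := h.oversampling.isBounded.measure_lt_top
  have hl : ∀ B : S, ∃ l : HA0 h A χ →L[ℝ] ℝ, ∀ v, l v = ∫ x in B, (v : L2Pair ωs).fst x := by
    intro B
    obtain ⟨hBm, hBU⟩ := hS B B.2
    have hfin : (volume.restrict ωs) (B : Set (Euc d)) ≠ ∞ :=
      ((Measure.restrict_apply_le _ _).trans_lt
        ((measure_mono hBU).trans_lt hfinU)).ne
    refine ⟨(innerSL ℝ (indicatorConstLp 2 hBm hfin (1 : ℝ))).comp (fstCLM h A χ), fun v => ?_⟩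
    rw [ContinuousLinearMap.comp_apply, innerSL_apply_apply, L2.inner_indicatorConstLp_one,
      Measure.restrict_restrict_of_subset hBU, fstCLM_apply]
  choose l hl using hl
  have : Finite S := hSf
  refine ⟨range l, finite_range l, fun v hv => ?_⟩
  refine (hmean v v.2.1.1 fun B hB => ?_).trans
    (mul_le_mul_of_nonneg_left (L2Pair.norm_snd_le _) hε.le)
  rw [← hl ⟨B, hB⟩]
  exact hv _ (mem_range_self _)

/-- The Poincaré inequality on `H_{A,0}`. -/
theorem exists_norm_le_norm_snd [Nonempty (Fin d)] :
    ∃ C > 0, ∀ v : HA0 h A χ, ‖v‖ ≤ C * ‖(v : L2Pair ωs).snd‖ :=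
  exists_norm_le_of_compact_of_injective (D := sndCLM h A χ) (isCompactOperator_fstCLM h A χ)
    (fun v => L2Pair.norm_le_add (v : L2Pair ωs)) (eq_zero_of_snd_eq_zero h A χ)

/-- The energy form is coercive on `H_{A,0}`. -/
theorem exists_coercive_HA0 [Nonempty (Fin d)] : ∃ c C : ℝ, 0 < c ∧ 0 < C ∧ ∀ v : HA0 h A χ,
    c * ‖v‖ ^ 2 ≤ energyForm A (v : L2Pair ωs) (v : L2Pair ωs) ∧
      energyForm A (v : L2Pair ωs) (v : L2Pair ωs) ≤ C * ‖v‖ ^ 2 := by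
  obtain ⟨α, β, hα, hβ, hab⟩ := exists_energyForm_bounds A h.subset_domain
  obtain ⟨C, hC0, hC⟩ := exists_norm_le_norm_snd h A χ
  refine ⟨α / C ^ 2, β, by positivity, hβ, fun v => ⟨?_, ?_⟩⟩
  · refine le_trans ?_ (hab v).1
    rw [div_mul_eq_mul_div, div_le_iff₀ (by positivity), mul_assoc]
    refine mul_le_mul_of_nonneg_left ?_ hα.le
    rw [← mul_pow, mul_comm]
    exact pow_le_pow_left₀ (norm_nonneg _) (hC v) 2
  · exact (hab v).2.trans (mul_le_mul_of_nonneg_left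
      (pow_le_pow_left₀ (norm_nonneg _) (L2Pair.norm_snd_le _) 2) hβ.le)

/-- The energy form is coercive on `H¹₀`. -/
theorem exists_coercive_H10 [Nonempty (Fin d)] (hω : IsOpen ω) (hb : Bornology.IsBounded ω)
    (hωΩ : ω ⊆ Ω) : ∃ c C : ℝ, 0 < c ∧ 0 < C ∧ ∀ w : H10 ω,
    c * ‖w‖ ^ 2 ≤ energyForm A (w : L2Pair ω) (w : L2Pair ω) ∧
      energyForm A (w : L2Pair ω) (w : L2Pair ω) ≤ C * ‖w‖ ^ 2 := by
  obtain ⟨α, β, hα, hβ, hab⟩ := exists_energyForm_bounds A hωΩ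
  obtain ⟨C, hC0, hC⟩ := exists_friedrichs hω hb
  refine ⟨α / (C + 1) ^ 2, β, by positivity, hβ, fun v => ⟨?_, ?_⟩⟩
  · refine le_trans ?_ (hab v).1
    rw [div_mul_eq_mul_div, div_le_iff₀ (by positivity), mul_assoc]
    refine mul_le_mul_of_nonneg_left ?_ hα.le
    rw [← mul_pow, mul_comm]
    refine pow_le_pow_left₀ (norm_nonneg _) ?_ 2
    refine (L2Pair.norm_le_add (v : L2Pair ω)).trans ?_
    have := hC v v.2
    linarith
  · exact (hab v).2.trans (mul_le_mul_of_nonneg_left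
      (pow_le_pow_left₀ (norm_nonneg _) (L2Pair.norm_snd_le _) 2) hβ.le)

/-- The partition of unity operator. -/
noncomputable def puOperator : HA0 h A χ →L[ℝ] H10 ω :=
  ((χ.mulCLM h.isOpen h.volume_lt_top h.subset).comp (HA0 h A χ).subtypeL).codRestrict (H10 ω)
    fun v => χ.mulPair_mem_H10 h.isOpen h.isBounded h.subset v.2.1.1

theorem puOperator_coe (v : HA0 h A χ) : (puOperator h A χ v : L2Pair ω)
    = χ.mulPair h.isOpen h.isBounded.measure_lt_top h.subset (v : L2Pair ωs) := rfl

theorem isPUOperator_puOperator : IsPUOperator (puOperator h A χ) := fun v =>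
  χ.mulPair_fst_ae h.isOpen h.isBounded.measure_lt_top h.subset (v : L2Pair ωs)

theorem energyForm_puOperator (v φ : HA0 h A χ) :
    energyForm A (puOperator h A χ v : L2Pair ω) (puOperator h A χ φ : L2Pair ω)
      = ∫ x in ω, matForm (A.mat x) (gradient χ.toFun x) (gradient χ.toFun x)
          * (v : L2Pair ωs).fst x * (φ : L2Pair ωs).fst x := by
  rw [puOperator_coe, puOperator_coe]
  exact χ.energyForm_mulPair A h.subset_domain h.isOpen h.isBounded h.subset v.2.1 φ.2.1

/-- A Caccioppoli-type bound: the identity for the energy of `χ v` contains `v` but not its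
gradient. No gap between `ω` and `ω*` is needed, because `χ` vanishes on the boundary of `ω`. -/
theorem exists_energyForm_puOperator_le : ∃ K : ℝ, 0 ≤ K ∧ ∀ v : HA0 h A χ,
    energyForm A (puOperator h A χ v : L2Pair ω) (puOperator h A χ v : L2Pair ω)
      ≤ K * ‖(v : L2Pair ωs).fst‖ ^ 2 := by
  have hωΩ := h.subset.trans h.subset_domain
  obtain ⟨K, hK0, hK⟩ := A.exists_abs_matForm_le
  obtain ⟨B, hB⟩ := χ.gradient_bounded
  refine ⟨K * B ^ 2, by positivity, fun v => ?_⟩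
  have hr1 := (v : L2Pair ωs).restrict_fst_ae h.subset
  have hr2 := (v : L2Pair ωs).norm_restrict_fst_le h.subset
  generalize (v : L2Pair ωs).restrict h.subset = r at hr1 hr2
  have hi : Integrable (fun x => ‖r.fst x‖ ^ 2) (volume.restrict ω) :=
    (Lp.memLp r.fst).integrable_norm_pow (by norm_num)
  rw [energyForm_puOperator]
  refine (le_abs_self _).trans ?_
  rw [← Real.norm_eq_abs]
  refine (norm_integral_le_of_norm_le (hi.const_mul (K * B ^ 2)) ?_).trans ?_
  · filter_upwards [hr1, ae_restrict_mem h.isOpen.measurableSet,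
      ae_restrict_of_ae_restrict_of_subset hωΩ hK] with x h1 hx h2
    rw [mul_assoc, norm_mul, h1, ← pow_two, norm_pow]
    refine mul_le_mul_of_nonneg_right ((h2 _ _).trans ?_) (by positivity)
    refine mul_le_mul_of_nonneg_left ?_ hK0
    rw [pow_two]
    exact mul_le_mul (hB x hx) (hB x hx) (norm_nonneg _) ((norm_nonneg _).trans (hB x hx))
  · rw [integral_const_mul, ← Lp_norm_sq_eq_integral]
    exact mul_le_mul_of_nonneg_left (pow_le_pow_left₀ (norm_nonneg _) hr2 2) (by positivity)

/-- By coercivity on `H¹₀` and the preceding bound, the operator is dominated by the compact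
inclusion into `L²`. -/
theorem isCompactOperator_puOperator [Nonempty (Fin d)] :
    IsCompactOperator (puOperator h A χ) := by
  obtain ⟨c, C, hc, -, hco⟩ := exists_coercive_H10 A h.isOpen h.isBounded
    (h.subset.trans h.subset_domain)
  obtain ⟨K, hK0, hK⟩ := exists_energyForm_puOperator_le h A χ
  have key : ∀ v : HA0 h A χ, ‖puOperator h A χ v‖ ≤ Real.sqrt (K / c) * ‖fstCLM h A χ v‖ := by
    intro v
    refine le_of_sq_le_sq ?_ (by positivity)
    have h1 := (hco (puOperator h A χ v)).1.trans (hK v)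
    rw [mul_pow, Real.sq_sqrt (by positivity), fstCLM_apply, div_mul_eq_mul_div, le_div_iff₀ hc,
      mul_comm]
    exact h1
  exact IsCompactOperator.of_norm_le (isCompactOperator_fstCLM h A χ) key

end HarmonicSpace

/-! ### `H¹₀` is infinite-dimensional -/

section InfiniteDimensional

variable {d : ℕ} {U : Set (Euc d)}

/-- Bumps in pairwise disjoint open sets are orthogonal. The result guarantees spaces `Q` of every
dimension; without one, the infimum defining `nWidth` would be over the empty family, hence
infinite. -/
theorem not_finiteDimensional_H10 [Nonempty (Fin d)] (hU : IsOpen U) (hne : U.Nonempty) :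
    ¬ FiniteDimensional ℝ (H10 U) := by
  intro hfd
  obtain ⟨x₀, hx₀⟩ := hne
  have : (𝓝[≠] x₀).NeBot := Module.punctured_nhds_neBot ℝ (Euc d) x₀
  have hinf : U.Infinite := infinite_of_mem_nhds x₀ (hU.mem_nhds hx₀)
  have : Infinite U := hinf.to_subtype
  obtain ⟨W, hWi, hWo, hWd⟩ := exists_seq_infinite_isOpen_pairwise_disjoint U
  choose y hy using fun n => (hWi n).nonempty
  have hVo : ∀ n, IsOpen (Subtype.val '' W n : Set (Euc d)) := fun n =>
    hU.isOpenMap_subtype_val _ (hWo n)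
  have hVU : ∀ n, (Subtype.val '' W n : Set (Euc d)) ⊆ U := fun n => by
    rintro _ ⟨x, -, rfl⟩
    exact x.2
  have hVd : ∀ m n, m ≠ n → ∀ x ∈ (Subtype.val '' W m : Set (Euc d)),
      x ∉ (Subtype.val '' W n : Set (Euc d)) := by
    rintro m n hmn _ ⟨x, hx, rfl⟩ ⟨x', hx', hxx⟩
    rw [Subtype.val_injective hxx] at hx'
    exact (Set.disjoint_left.1 (hWd hmn)) hx hx'
  choose φ hφs hφc hφd _ hφ1 using fun n => exists_contDiff_tsupport_subset (n := (⊤ : ℕ∞))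
    ((hVo n).mem_nhds (mem_image_of_mem Subtype.val (hy n)))
  have hφV : ∀ n, IsTestFunction (Subtype.val '' W n : Set (Euc d)) (φ n) := fun n =>
    ⟨hφd n, hφc n, hφs n⟩
  have hφU := fun n => (hφV n).mono (hVU n)
  let w : ℕ → H10 U := fun n => ⟨mkL2Pair (hφU n).memLp (hφU n).memLp_gradient,
    subset_closure (hφU n).mkL2Pair_mem_testSpace⟩
  have h1 : ∀ n, (w n : L2Pair U).fst =ᵐ[volume.restrict U] φ n := fun n => mkL2Pair_fst_ae _ _
  have h2 : ∀ n, (w n : L2Pair U).snd =ᵐ[volume.restrict U] gradient (φ n) := fun n =>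
    mkL2Pair_snd_ae _ _
  have hli : LinearIndependent ℝ w := by
    refine linearIndependent_of_ne_zero_of_inner_eq_zero (𝕜 := ℝ) (fun n hn => ?_)
      fun m n hmn => ?_
    · have h3 : ∀ᵐ x ∂(volume.restrict U), φ n x = 0 := by
        have h4 := L2Pair.fst_zero_ae U
        have h0 : (w n : L2Pair U) = 0 := by rw [hn]; rfl
        rw [← h0] at h4
        filter_upwards [h4, h1 n] with x h5 h6
        rw [← h6, h5]
      rw [ae_restrict_iff' hU.measurableSet] at h3
      have hopen : IsOpen {x | φ n x ≠ 0} := isOpen_ne_fun (hφd n).continuous continuous_const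
      refine (hopen.measure_pos volume ⟨y n, by simp [hφ1 n]⟩).ne' ?_
      refine measure_mono_null (fun x hx => ?_) (ae_iff.1 h3)
      simp only [mem_ofPred_eq, Classical.not_imp]
      exact ⟨(hφU n).support_subset (subset_tsupport _ hx), hx⟩
    · change inner ℝ (w m : L2Pair U) (w n : L2Pair U) = 0
      rw [L2Pair.inner_eq, integral_eq_zero_of_ae, integral_eq_zero_of_ae, add_zero]
      · filter_upwards [h2 m, h2 n] with x h3 h4
        rw [h3, h4]
        by_cases hx : x ∈ (Subtype.val '' W m : Set (Euc d))
        · rw [(hφV n).gradient_eq_zero (hVd m n hmn x hx), inner_zero_right]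
          rfl
        · rw [(hφV m).gradient_eq_zero hx, inner_zero_left]
          rfl
      · filter_upwards [h1 m, h1 n] with x h3 h4
        rw [h3, h4]
        by_cases hx : x ∈ (Subtype.val '' W m : Set (Euc d))
        · rw [image_eq_zero_of_notMem_tsupport fun h => hVd m n hmn x hx (hφs n h),
            inner_zero_right]
          rfl
        · rw [image_eq_zero_of_notMem_tsupport fun h => hx (hφs m h), inner_zero_left]
          rfl
  have := hli.finite
  exact not_finite ℕ

theorem exists_le_finrank_eq {V : Type*} [AddCommGroup V] [Module ℝ V]
    (hV : ¬ FiniteDimensional ℝ V) (Q : Submodule ℝ V) [FiniteDimensional ℝ Q] (k : ℕ) :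
    ∃ Q' : Submodule ℝ V, Q ≤ Q' ∧ FiniteDimensional ℝ Q' ∧
      Module.finrank ℝ Q' = Module.finrank ℝ Q + k := by
  induction k with
  | zero => exact ⟨Q, le_rfl, inferInstance, rfl⟩
  | succ k ih =>
    obtain ⟨Q', hQ, hfd, hr⟩ := ih
    have : ∃ x, x ∉ Q' := by
      by_contra! hall
      have : Q' = ⊤ := eq_top_iff.2 fun x _ => hall x
      subst this
      exact hV (Module.finite_def.2 ((Submodule.fg_top _).1 (Module.finite_def.1 hfd)))
    obtain ⟨x, hx⟩ := this
    have hx0 : x ≠ 0 := fun h => hx (h ▸ Q'.zero_mem)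
    refine ⟨Q' ⊔ Submodule.span ℝ {x}, hQ.trans le_sup_left, inferInstance, ?_⟩
    have h1 := Submodule.finrank_sup_add_finrank_inf_eq Q' (Submodule.span ℝ {x})
    have h2 : Q' ⊓ Submodule.span ℝ {x} = ⊥ :=
      ((Submodule.disjoint_span_singleton' hx0).2 hx).eq_bot
    rw [h2, finrank_bot, finrank_span_singleton hx0, add_zero] at h1
    omega

end InfiniteDimensional

/-! ### Renormed spaces -/

theorem IsSingularSystem.norm_map_le {V W : Type*} [NormedAddCommGroup V] [InnerProductSpace ℝ V]
    [CompleteSpace V] [NormedAddCommGroup W] [InnerProductSpace ℝ W] [CompleteSpace W]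
    {T : V →L[ℝ] W} {N : ℕ∞} {lam : ℕ → ℝ} {v : ℕ → V} (h : IsSingularSystem T N lam v)
    (hT : IsCompactOperator T) {n : ℕ} (hn : (n : ℕ∞) < N) {u : V} (hu : u ∈ (initialSpan v n)ᗮ)
    {t : ℝ} (ht : ‖u‖ ≤ t) : ‖T u‖ ≤ lam n ^ (-(1 / 2) : ℝ) * t := by
  have hpos := (h.singular n hn).pos
  have ht0 : 0 ≤ t := (norm_nonneg u).trans ht
  rw [Real.rpow_neg hpos.le, ← Real.sqrt_eq_rpow]
  refine le_of_sq_le_sq ?_ (by positivity)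
  rw [mul_pow, inv_pow, Real.sq_sqrt hpos.le]
  exact (h.norm_sq_map_le hT hn hu).trans
    (mul_le_mul_of_nonneg_left (pow_le_pow_left₀ (norm_nonneg _) ht 2) (inv_nonneg.2 hpos.le))

section Transfer

variable {d : ℕ} {V W : Type*} [NormedAddCommGroup V] [InnerProductSpace ℝ V]
  [NormedAddCommGroup W] [InnerProductSpace ℝ W]

/-- `e` identifies a space of pairs, with the energy inner product, with an inner product space. -/
def IsEnergyIso {Ω U : Set (Euc d)} (A : EllipticCoefficient Ω) {S : Submodule ℝ (L2Pair U)}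
    (e : S ≃L[ℝ] V) : Prop :=
  ∀ u v : S, inner ℝ (e u) (e v) = energyForm A (u : L2Pair U) (v : L2Pair U)

theorem IsEnergyIso.energyNorm_eq {Ω U : Set (Euc d)} {A : EllipticCoefficient Ω}
    {S : Submodule ℝ (L2Pair U)} {e : S ≃L[ℝ] V} (he : IsEnergyIso A e) (u : S) :
    energyNorm A (u : L2Pair U) = ‖e u‖ := by
  rw [energyNorm, ← he, real_inner_self_eq_norm_sq, Real.sqrt_sq (norm_nonneg _)]

/-- Coercivity turns the energy form into an equivalent Hilbert inner product, so that the theory of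
singular systems applies to `P`. -/
theorem exists_isEnergyIso {Ω U : Set (Euc d)} (A : EllipticCoefficient Ω) (hU : U ⊆ Ω)
    (S : Submodule ℝ (L2Pair U)) [CompleteSpace S] {c : ℝ} (hc : 0 < c)
    (hco : ∀ u : S, c * ‖u‖ ^ 2 ≤ energyForm A (u : L2Pair U) (u : L2Pair U)) :
    ∃ (E : Type) (_ : NormedAddCommGroup E) (_ : InnerProductSpace ℝ E) (_ : CompleteSpace E)
      (e : S ≃L[ℝ] E), IsEnergyIso A e := by
  obtain ⟨a, ha⟩ : ∃ a : S →L[ℝ] S →L[ℝ] ℝ,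
      ∀ u v : S, a u v = energyForm A (u : L2Pair U) (v : L2Pair U) :=
    ⟨(energyCLM A hU).bilinearComp S.subtypeL S.subtypeL, fun _ _ => rfl⟩
  have hsymm : ∀ u v : S, a u v = a v u := fun u v =>
    (ha u v).trans ((energyForm_comm A hU _ _).trans (ha v u).symm)
  have hcoer : IsCoercive a := ⟨c, hc, fun u =>
    (le_of_eq (by rw [mul_assoc, ← pow_two])).trans ((hco u).trans_eq (ha u u).symm)⟩
  obtain ⟨E, i₁, i₂, i₃, e, he⟩ := exists_equiv_inner_eq a hsymm hcoer
  exact ⟨E, i₁, i₂, i₃, e, fun u v => (he u v).trans (ha u v)⟩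

variable {Ω ωs ω : Set (Euc d)} {h : IsOversampling Ω ωs ω}
  {A : EllipticCoefficient Ω} {χ : PUFunction ω} {P : HA0 h A χ →L[ℝ] H10 ω}
  {e : HA0 h A χ ≃L[ℝ] V} {f : H10 ω ≃L[ℝ] W}

/-- The operator `P` between renormed spaces. -/
noncomputable def renormed (P : HA0 h A χ →L[ℝ] H10 ω) (e : HA0 h A χ ≃L[ℝ] V)
    (f : H10 ω ≃L[ℝ] W) : V →L[ℝ] W :=
  (f : H10 ω →L[ℝ] W).comp (P.comp (e.symm : V →L[ℝ] HA0 h A χ))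

theorem renormed_apply (u : HA0 h A χ) : renormed P e f (e u) = f (P u) := by
  simp [renormed]

theorem isCompactOperator_renormed (hP : IsCompactOperator P) :
    IsCompactOperator (renormed P e f) :=
  (hP.comp_clm (e.symm : V →L[ℝ] HA0 h A χ)).clm_comp (f : H10 ω →L[ℝ] W)

/-- In the energy inner products the weak eigenproblem is literally the singular vector equation;
surjectivity of `e` matches the test functions. -/
theorem isSingularVector_iff (he : IsEnergyIso A e) (hf : IsEnergyIso A f) {lam : ℝ}
    {v : HA0 h A χ} : IsSingularVector (renormed P e f) lam (e v) ↔ IsEigenpair P lam v := by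
  refine and_congr (by simp) ?_
  have hT : ∀ φ, inner ℝ (renormed P e f (e v)) (renormed P e f (e φ))
      = energyForm A (P v : L2Pair ω) (P φ : L2Pair ω) := fun φ => by
    rw [renormed_apply, renormed_apply]
    exact hf _ _
  constructor
  · intro hv φ
    exact (he v φ).symm.trans ((hv (e φ)).trans (congrArg _ (hT φ)))
  · intro hv φ
    obtain ⟨φ, rfl⟩ := e.surjective φ
    exact (he v φ).trans ((hv φ).trans (congrArg _ (hT φ).symm))

theorem isSingularSystem_iff (he : IsEnergyIso A e) (hf : IsEnergyIso A f) {N : ℕ∞} {lam : ℕ → ℝ}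
    {v : ℕ → HA0 h A χ} :
    IsSingularSystem (renormed P e f) N lam (fun k => e (v k)) ↔ IsEigensystem P N lam v := by
  have hli : LinearIndependent ℝ (fun k : {k : ℕ // (k : ℕ∞) < N} => e (v k)) ↔
      LinearIndependent ℝ (fun k : {k : ℕ // (k : ℕ∞) < N} => v k) :=
    LinearMap.linearIndependent_iff (v := fun k : {k : ℕ // (k : ℕ∞) < N} => v k)
      (e.toLinearEquiv : HA0 h A χ →ₗ[ℝ] V) e.toLinearEquiv.ker
  have hspan : ∀ (S : Set ℕ) (w : HA0 h A χ),
      e w ∈ Submodule.span ℝ ((fun k => e (v k)) '' S) ↔ w ∈ Submodule.span ℝ (v '' S) := by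
    intro S w
    have : (fun k => e (v k)) '' S = (e : HA0 h A χ →ₗ[ℝ] V) '' (v '' S) := by
      rw [image_image]
      rfl
    rw [this, ← Submodule.map_span]
    exact ⟨fun ⟨w', hw', hww⟩ => e.injective hww ▸ hw', Submodule.mem_map_of_mem⟩
  constructor
  · intro hs
    exact ⟨fun k hk => (isSingularVector_iff he hf).1 (hs.singular k hk), hs.increasing,
      hli.1 hs.independent,
      fun μ w hw => (hspan _ w).1 (hs.complete μ _ ((isSingularVector_iff he hf).2 hw))⟩
  · intro hs
    refine ⟨fun k hk => (isSingularVector_iff he hf).2 (hs.eigenpair k hk), hs.increasing,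
      hli.2 hs.independent, fun μ w hw => ?_⟩
    obtain ⟨w, rfl⟩ := e.surjective w
    exact (hspan _ w).2 (hs.complete μ w ((isSingularVector_iff he hf).1 hw))

theorem approxError_le (he : IsEnergyIso A e) (hf : IsEnergyIso A f) {Q : Submodule ℝ (H10 ω)}
    {s : ℝ} (hs : ∀ u, ∃ q ∈ Q, ‖f (P u) - f q‖ ≤ s * ‖e u‖) :
    approxError P Q ≤ ENNReal.ofReal s := by
  refine iSup₂_le fun u hu => ?_
  obtain ⟨q, hq, hle⟩ := hs u
  refine (iInf₂_le q hq).trans (ENNReal.ofReal_le_ofReal ?_)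
  have hpos : 0 < ‖e u‖ := norm_pos_iff.2 (by simpa using hu)
  rw [hf.energyNorm_eq, he.energyNorm_eq, map_sub, div_le_iff₀ hpos]
  exact hle

theorem le_approxError (he : IsEnergyIso A e) (hf : IsEnergyIso A f) {Q : Submodule ℝ (H10 ω)}
    {s : ℝ} {u : HA0 h A χ} (hu : u ≠ 0) (hs : ∀ q ∈ Q, s * ‖e u‖ ≤ ‖f (P u) - f q‖) :
    ENNReal.ofReal s ≤ approxError P Q := by
  refine le_trans ?_ (le_iSup₂ u hu)
  refine le_iInf₂ fun q hq => ENNReal.ofReal_le_ofReal ?_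
  have hpos : 0 < ‖e u‖ := norm_pos_iff.2 (by simpa using hu)
  rw [hf.energyNorm_eq, he.energyNorm_eq, map_sub, le_div_iff₀ hpos]
  exact hs q hq

theorem nWidth_le {Q : Submodule ℝ (H10 ω)} {n : ℕ} (hQ : HasDim Q n) :
    nWidth P n ≤ approxError P Q := iInf₂_le Q hQ

theorem hasDim_initialSpan (he : IsEnergyIso A e) (hf : IsEnergyIso A f) {N : ℕ∞} {lam : ℕ → ℝ}
    {v : ℕ → HA0 h A χ} [CompleteSpace V] (hv : IsEigensystem P N lam v) {n : ℕ} (hn : (n : ℕ∞) ≤ N) :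
    HasDim (initialSpan (fun k => P (v k)) n) n := by
  refine ⟨inferInstance, ?_⟩
  have h1 := ((isSingularSystem_iff he hf).2 hv).linearIndependent_map hn
  simp only [renormed_apply] at h1
  have h2 : LinearIndependent ℝ (fun k : Fin n => P (v k)) :=
    LinearIndependent.of_comp (f : H10 ω →ₗ[ℝ] W) h1
  rw [initialSpan_eq_span_range, finrank_span_eq_card h2, Fintype.card_fin]

theorem exists_mem_initialSpan_map (v : ℕ → HA0 h A χ) {n : ℕ} {p : V}
    (hp : p ∈ initialSpan (fun k => e (v k)) n) :
    ∃ q ∈ initialSpan (fun k => P (v k)) n, f q = renormed P e f p := by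
  obtain ⟨c, rfl⟩ := exists_sum_of_mem_initialSpan hp
  refine ⟨∑ i : Fin n, c i • P (v i), Submodule.sum_mem _ fun i _ =>
    Submodule.smul_mem _ _ (mem_initialSpan _ i.2), ?_⟩
  simp [renormed_apply]

variable [CompleteSpace V] [CompleteSpace W] {N : ℕ∞} {lam : ℕ → ℝ} {v : ℕ → HA0 h A χ}

/-- The competitor for `u` is the image of its energy projection onto the eigenfunctions, so the
error is `P` applied to a vector orthogonal to them. -/
theorem approxError_initialSpan_le (he : IsEnergyIso A e) (hf : IsEnergyIso A f)
    (hP : IsCompactOperator P) (hv : IsEigensystem P N lam v) {n : ℕ} (hn : (n : ℕ∞) < N) :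
    approxError P (initialSpan (fun k => P (v k)) n)
      ≤ ENNReal.ofReal (lam n ^ (-(1 / 2) : ℝ)) := by
  have hs := (isSingularSystem_iff he hf).2 hv
  have hpos := (hs.singular n hn).pos
  refine approxError_le he hf fun u => ?_
  obtain ⟨p, hp, hpo, hpn⟩ := exists_sub_mem_orthogonal_initialSpan (fun k => e (v k)) n (e u)
  obtain ⟨q, hq, hqp⟩ := exists_mem_initialSpan_map (P := P) (f := f) v hp
  refine ⟨q, hq, ?_⟩
  rw [hqp, ← renormed_apply (e := e), ← map_sub]
  exact hs.norm_map_le (isCompactOperator_renormed hP) hn hpo hpn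

/-- With `N` finite and all eigenfunctions used, `P` vanishes on the orthogonal complement. `Q` may
be larger than the span, as is needed for `n > N`. -/
theorem approxError_eq_zero (he : IsEnergyIso A e) (hf : IsEnergyIso A f)
    (hP : IsCompactOperator P) (hv : IsEigensystem P N lam v) {n : ℕ} (hn : (n : ℕ∞) = N)
    {Q : Submodule ℝ (H10 ω)} (hQ : initialSpan (fun k => P (v k)) n ≤ Q) :
    approxError P Q = 0 := by
  have hs := (isSingularSystem_iff he hf).2 hv
  rw [← nonpos_iff_eq_zero, ← ENNReal.ofReal_zero]
  refine approxError_le he hf fun u => ?_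
  obtain ⟨p, hp, hpo, -⟩ := exists_sub_mem_orthogonal_initialSpan (fun k => e (v k)) n (e u)
  obtain ⟨q, hq, hqp⟩ := exists_mem_initialSpan_map (P := P) (f := f) v hp
  refine ⟨q, hQ hq, ?_⟩
  rw [hqp, ← renormed_apply (e := e), ← map_sub,
    hs.map_eq_zero (isCompactOperator_renormed hP) hn hpo]
  simp

theorem le_nWidth (he : IsEnergyIso A e) (hf : IsEnergyIso A f)
    (hv : IsEigensystem P N lam v) {n : ℕ} (hn : (n : ℕ∞) < N) :
    ENNReal.ofReal (lam n ^ (-(1 / 2) : ℝ)) ≤ nWidth P n := by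
  have hs := (isSingularSystem_iff he hf).2 hv
  have hpos := (hs.singular n hn).pos
  refine le_iInf₂ fun Q hQ => ?_
  have := hQ.1
  obtain ⟨w, hw, hle⟩ := hs.exists_le_norm_sub hn (Q.map (f : H10 ω →ₗ[ℝ] W))
    ((Submodule.finrank_map_le _ _).trans hQ.2.le)
  obtain ⟨u, rfl⟩ := e.surjective w
  refine le_approxError he hf (u := u) (by simpa using hw) fun q hq => ?_
  have h1 := hle (f q) (Submodule.mem_map_of_mem hq)
  rw [renormed_apply] at h1
  rw [Real.rpow_neg hpos.le, ← Real.sqrt_eq_rpow]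
  refine le_of_sq_le_sq ?_ (norm_nonneg _)
  rwa [mul_pow, inv_pow, Real.sq_sqrt hpos.le]

theorem nWidth_eq (he : IsEnergyIso A e) (hf : IsEnergyIso A f) (hP : IsCompactOperator P)
    (hv : IsEigensystem P N lam v) {n : ℕ} (hn : (n : ℕ∞) < N) :
    nWidth P n = ENNReal.ofReal (lam n ^ (-(1 / 2) : ℝ)) :=
  le_antisymm ((nWidth_le (hasDim_initialSpan he hf hv hn.le)).trans
    (approxError_initialSpan_le he hf hP hv hn)) (le_nWidth he hf hv hn)

/-- The width ranges over spaces of dimension exactly `n`, so the span of the `N` images is enlarged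
inside the infinite-dimensional `H10 ω`. -/
theorem nWidth_eq_zero (he : IsEnergyIso A e) (hf : IsEnergyIso A f) (hP : IsCompactOperator P)
    (hv : IsEigensystem P N lam v) (hinf : ¬ FiniteDimensional ℝ (H10 ω)) {n : ℕ}
    (hn : N ≤ (n : ℕ∞)) : nWidth P n = 0 := by
  lift N to ℕ using ne_top_of_le_ne_top (ENat.natCast_ne_top n) hn
  obtain ⟨Q, hQ, hfd, hr⟩ :=
    exists_le_finrank_eq hinf (initialSpan (fun k => P (v k)) N) (n - N)
  have hNn : N ≤ n := by exact_mod_cast hn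
  rw [(hasDim_initialSpan he hf hv le_rfl).2, Nat.add_sub_cancel' hNn] at hr
  rw [← nonpos_iff_eq_zero, ← approxError_eq_zero he hf hP hv rfl hQ]
  exact nWidth_le ⟨hfd, hr⟩

theorem isOptimalSpace_initialSpan (he : IsEnergyIso A e) (hf : IsEnergyIso A f)
    (hP : IsCompactOperator P) (hv : IsEigensystem P N lam v) {n : ℕ} (hn : (n : ℕ∞) ≤ N) :
    IsOptimalSpace P n (initialSpan (fun k => P (v k)) n) := by
  have hdim := hasDim_initialSpan he hf hv hn
  refine ⟨hdim, le_antisymm ?_ (nWidth_le hdim)⟩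
  rcases hn.lt_or_eq with hlt | heq
  · rw [nWidth_eq he hf hP hv hlt]
    exact approxError_initialSpan_le he hf hP hv hlt
  · rw [approxError_eq_zero he hf hP hv heq le_rfl]
    exact zero_le

end Transfer

/-! ### Assembly: energy norms, eigensystems and widths of the partition of unity operator -/

theorem energyNorm_bounds {d : ℕ} {Ω U : Set (Euc d)} {A : EllipticCoefficient Ω}
    {S : Submodule ℝ (L2Pair U)} {c C : ℝ} (hc : 0 < c) (hC : 0 < C)
    (hco : ∀ u : S, c * ‖u‖ ^ 2 ≤ energyForm A (u : L2Pair U) (u : L2Pair U) ∧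
      energyForm A (u : L2Pair U) (u : L2Pair U) ≤ C * ‖u‖ ^ 2) (u : S) :
    Real.sqrt c * ‖u‖ ≤ energyNorm A (u : L2Pair U) ∧
      energyNorm A (u : L2Pair U) ≤ Real.sqrt C * ‖u‖ := by
  have e : ∀ b : ℝ, 0 < b → Real.sqrt b * ‖u‖ = Real.sqrt (b * ‖u‖ ^ 2) := fun b hb => by
    rw [Real.sqrt_mul hb.le, Real.sqrt_sq (norm_nonneg _)]
  rw [e c hc, e C hC]
  exact ⟨Real.sqrt_le_sqrt (hco u).1, Real.sqrt_le_sqrt (hco u).2⟩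

theorem exists_isEigensystem {d : ℕ} {Ω ωs ω : Set (Euc d)} {h : IsOversampling Ω ωs ω}
    {A : EllipticCoefficient Ω} {χ : PUFunction ω} {P : HA0 h A χ →L[ℝ] H10 ω}
    (hP : IsCompactOperator P) {V W : Type*}
    [NormedAddCommGroup V] [InnerProductSpace ℝ V] [CompleteSpace V]
    [NormedAddCommGroup W] [InnerProductSpace ℝ W] [CompleteSpace W]
    {e : HA0 h A χ ≃L[ℝ] V} {f : H10 ω ≃L[ℝ] W} (he : IsEnergyIso A e) (hf : IsEnergyIso A f) :
    ∃ (N : ℕ∞) (lam : ℕ → ℝ) (v : ℕ → HA0 h A χ), IsEigensystem P N lam v := by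
  obtain ⟨N, lam, v, hv⟩ := exists_isSingularSystem
    (isCompactOperator_renormed (e := e) (f := f) hP)
  refine ⟨N, lam, fun k => e.symm (v k), (isSingularSystem_iff he hf).1 ?_⟩
  simpa using hv

theorem exists_energyIsos {d : ℕ} [Nonempty (Fin d)] {Ω ωs ω : Set (Euc d)}
    (h : IsOversampling Ω ωs ω) (A : EllipticCoefficient Ω) (χ : PUFunction ω) :
    ∃ (V W : Type) (_ : NormedAddCommGroup V) (_ : InnerProductSpace ℝ V) (_ : CompleteSpace V)
      (_ : NormedAddCommGroup W) (_ : InnerProductSpace ℝ W) (_ : CompleteSpace W)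
      (e : HA0 h A χ ≃L[ℝ] V) (f : H10 ω ≃L[ℝ] W), IsEnergyIso A e ∧ IsEnergyIso A f := by
  obtain ⟨c₁, C₁, hc₁, hC₁, hco₁⟩ := exists_coercive_HA0 h A χ
  obtain ⟨V, i₁, i₂, i₃, e, he⟩ := exists_isEnergyIso A h.subset_domain (HA0 h A χ) hc₁
    fun u => (hco₁ u).1
  obtain ⟨c₂, C₂, hc₂, hC₂, hco₂⟩ := exists_coercive_H10 A h.isOpen h.isBounded
    (h.subset.trans h.subset_domain)
  obtain ⟨W, j₁, j₂, j₃, f, hf⟩ := exists_isEnergyIso A (h.subset.trans h.subset_domain) (H10 ω)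
    hc₂ fun u => (hco₂ u).1
  exact ⟨V, W, i₁, i₂, i₃, j₁, j₂, j₃, e, f, he, hf⟩

theorem nWidth_spec {d : ℕ} {Ω ωs ω : Set (Euc d)} {h : IsOversampling Ω ωs ω}
    {A : EllipticCoefficient Ω} {χ : PUFunction ω} {P : HA0 h A χ →L[ℝ] H10 ω}
    (hP : IsCompactOperator P) {V W : Type*}
    [NormedAddCommGroup V] [InnerProductSpace ℝ V] [CompleteSpace V]
    [NormedAddCommGroup W] [InnerProductSpace ℝ W] [CompleteSpace W]
    {e : HA0 h A χ ≃L[ℝ] V} {f : H10 ω ≃L[ℝ] W} (he : IsEnergyIso A e) (hf : IsEnergyIso A f)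
    (hinf : ¬ FiniteDimensional ℝ (H10 ω)) (N : ℕ∞) (lam : ℕ → ℝ) (v : ℕ → HA0 h A χ)
    (hv : IsEigensystem P N lam v) (n : ℕ) :
    ((n : ℕ∞) < N → 0 < lam n ∧ nWidth P n = ENNReal.ofReal (lam n ^ (-(1 / 2) : ℝ))) ∧
      (N ≤ (n : ℕ∞) → nWidth P n = 0) ∧
      ((n : ℕ∞) ≤ N → IsOptimalSpace P n (initialSpan (fun k => P (v k)) n)) :=
  ⟨fun hn => ⟨(((isSingularSystem_iff he hf).2 hv).singular n hn).pos, nWidth_eq he hf hP hv hn⟩,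
    nWidth_eq_zero he hf hP hv hinf, isOptimalSpace_initialSpan he hf hP hv⟩

theorem exists_isEigensystem_and_nWidth {d : ℕ} [Nonempty (Fin d)] {Ω ωs ω : Set (Euc d)}
    {h : IsOversampling Ω ωs ω} {A : EllipticCoefficient Ω} {χ : PUFunction ω}
    {P : HA0 h A χ →L[ℝ] H10 ω} (hP : IsCompactOperator P)
    (hinf : ¬ FiniteDimensional ℝ (H10 ω)) :
    (∃ (N : ℕ∞) (lam : ℕ → ℝ) (v : ℕ → HA0 h A χ), IsEigensystem P N lam v) ∧
      ∀ (N : ℕ∞) (lam : ℕ → ℝ) (v : ℕ → HA0 h A χ), IsEigensystem P N lam v → ∀ n : ℕ,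
        ((n : ℕ∞) < N → 0 < lam n ∧ nWidth P n = ENNReal.ofReal (lam n ^ (-(1 / 2) : ℝ))) ∧
          (N ≤ (n : ℕ∞) → nWidth P n = 0) ∧
          ((n : ℕ∞) ≤ N → IsOptimalSpace P n (initialSpan (fun k => P (v k)) n)) := by
  obtain ⟨V, W, _, _, _, _, _, _, e, f, he, hf⟩ := exists_energyIsos h A χ
  exact ⟨exists_isEigensystem hP he hf, nWidth_spec hP he hf hinf⟩

theorem theorem3p2 {d : ℕ} (hd : d = 2 ∨ d = 3) {Ω ωs ω : Set (Euc d)}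
    (h : IsOversampling Ω ωs ω) (A : EllipticCoefficient Ω) (χ : PUFunction ω) :
    -- the energy norms are norms, equivalent to the Sobolev norms
    (∃ c C : ℝ, 0 < c ∧
      (∀ v : HA0 h A χ, c * ‖v‖ ≤ energyNorm A (v : L2Pair ωs) ∧
        energyNorm A (v : L2Pair ωs) ≤ C * ‖v‖) ∧
      ∀ w : H10 ω, c * ‖w‖ ≤ energyNorm A (w : L2Pair ω) ∧
        energyNorm A (w : L2Pair ω) ≤ C * ‖w‖) ∧
    -- multiplication by `χ` is a compact operator
    ∃ P : HA0 h A χ →L[ℝ] H10 ω, IsPUOperator P ∧ IsCompactOperator P ∧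
      -- the two forms of the right-hand side of the eigenproblem agree
      (∀ v φ : HA0 h A χ, energyForm A (P v : L2Pair ω) (P φ : L2Pair ω)
        = ∫ x in ω, matForm (A.mat x) (gradient χ.toFun x) (gradient χ.toFun x)
            * (v : L2Pair ωs).fst x * (φ : L2Pair ωs).fst x) ∧
      -- the eigenvalues can be arranged in increasing order
      (∃ (N : ℕ∞) (lam : ℕ → ℝ) (v : ℕ → HA0 h A χ), IsEigensystem P N lam v) ∧
      -- the `n`-width and the optimal space
      ∀ (N : ℕ∞) (lam : ℕ → ℝ) (v : ℕ → HA0 h A χ), IsEigensystem P N lam v →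
        ∀ n : ℕ,
          ((n : ℕ∞) < N → 0 < lam n ∧
            nWidth P n = ENNReal.ofReal (lam n ^ (-(1 / 2) : ℝ))) ∧
          (N ≤ (n : ℕ∞) → nWidth P n = 0) ∧
          ((n : ℕ∞) ≤ N →
            IsOptimalSpace P n (Submodule.span ℝ ((fun k => P (v k)) '' {k : ℕ | k < n}))) := by
  -- A coordinate direction is needed for the translation in the Friedrichs inequality and for `H10
  -- ω` to be infinite-dimensional.
  have : Nonempty (Fin d) := ⟨⟨0, by omega⟩⟩
  have hωΩ := h.subset.trans h.subset_domain
  have hinf : ¬ FiniteDimensional ℝ (H10 ω) := by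
    obtain ⟨x, hx⟩ := χ.ne_zero
    exact not_finiteDimensional_H10 h.isOpen ⟨x, by_contra fun hxω => hx (χ.eq_zero x hxω)⟩
  obtain ⟨c₁, C₁, hc₁, hC₁, hco₁⟩ := exists_coercive_HA0 h A χ
  obtain ⟨c₂, C₂, hc₂, hC₂, hco₂⟩ := exists_coercive_H10 A h.isOpen h.isBounded hωΩ
  have hP := isCompactOperator_puOperator h A χ
  refine ⟨⟨min (Real.sqrt c₁) (Real.sqrt c₂), max (Real.sqrt C₁) (Real.sqrt C₂),
    lt_min (Real.sqrt_pos.2 hc₁) (Real.sqrt_pos.2 hc₂), fun v => ?_, fun w => ?_⟩,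
    puOperator h A χ, isPUOperator_puOperator h A χ, hP, energyForm_puOperator h A χ,
    exists_isEigensystem_and_nWidth hP hinf⟩
  · have hv := energyNorm_bounds hc₁ hC₁ hco₁ v
    exact ⟨(mul_le_mul_of_nonneg_right (min_le_left _ _) (norm_nonneg _)).trans hv.1,
      hv.2.trans (mul_le_mul_of_nonneg_right (le_max_left _ _) (norm_nonneg _))⟩
  · have hw := energyNorm_bounds hc₂ hC₂ hco₂ w
    exact ⟨(mul_le_mul_of_nonneg_right (min_le_right _ _) (norm_nonneg _)).trans hw.1,
      hw.2.trans (mul_le_mul_of_nonneg_right (le_max_right _ _) (norm_nonneg _))⟩
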